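/- Work in the external-memory (disk-access) model in its comparison-based, decision-tree form: the internal memory holds at most $M$ cells, the infinite disk is divided into blocks of $B$ cells, one I/O moves cells of one block between disk and memory, two records may be compared (at no cost) when both lie entirely in memory, and the cost of an algorithm is its number of I/Os. The input consists of $S\ge 1$ records of size $1$ (small) and $L/w\ge 1$ records of size $w$ (large; total volume $L$), with distinct keys, where $1\le B\le w\le M/2$. The *stripes* are the maximal runs of large records in the sorted order; $k$ is their number and $L_1,\dots,L_k$ are their volumes, in ascending order of the stripes. *Two-Sized Sorting*: the records are stored contiguously on disk in arbitrary order; the output is the sorted sequence of all records, stored contiguously on disk. *PLE (placement of large elements)*: the small records are given sorted, followed by the large records in arbitrary order; the output is a contiguously stored sequence of all records that is sorted except that the large records within a stripe may be in any order. Algorithms have to be correct on all inputs with the given numbers of records. For fixed $B$, $M$, $w$, $S$ and $(L_1,\dots,L_k)$, let $\mathrm{Sort}$ and $\mathrm{PLE}$ be the I/O complexities of the two problems, i.e. the best possible worst-case number of I/Os over the inputs with these stripe volumes (for sorting, the worst case is also over the initial order of the records on disk). Then $$\mathrm{Sort}=\Theta\left(\frac{S}{B}\log_{M/B}\frac{S}{B}+\mathrm{PLE}+\left(\sum_{i=1}^{k}\frac{L_i}{B}\log_{M/w}\frac{L_i}{w}+\frac{L}{B}\right)\right),$$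 where the implied constants are absolute. Moreover, the upper bound is achieved without knowledge of the stripes: for every algorithm $P$ that solves PLE and every initial order of the records on disk there is a sorting algorithm that, for all sequences of stripe volumes simultaneously, makes at most a constant times $$\frac{S}{B}\log_{M/B}\frac{S}{B}+T_P(L_1,\dots,L_k)+\sum_{i=1}^{k}\frac{L_i}{B}\log_{M/w}\frac{L_i}{w}+\frac{L}{B}$$ I/Os on the inputs with stripe volumes $L_1,\dots,L_k$, where $T_P(L_1,\dots,L_k)$ is the largest number of I/Os of $P$ on PLE inputs with these stripe volumes. -/

import Mathlib

/-! # Two-sized sorting and the placement of large elements in external memory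

There are `S` small records (size `1`) and `n` large records (size `w`).  An input is given by the
(unknown) sorted order of the records; an algorithm learns about it only through comparisons
of records that lie entirely in internal memory. -/

/-- The records: `Sum.inl i` is the `i`-th small one, `Sum.inr i` the `i`-th large one. -/
abbrev Item (S n : ℕ) := Fin S ⊕ Fin n

/-- A cell is one unit of a record: `(x, j)` is the `j`-th unit of `x`, for `j` below the size
of `x`. -/
abbrev Cell (S n : ℕ) := Item S n × ℕ

/-- The external memory is an infinite array of places that are empty or hold one cell. With block
size `B`, block `b` consists of the addresses `b * B, …, b * B + B - 1`. -/
abbrev Disk (S n : ℕ) := ℕ → Option (Cell S n)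

/-- The size of a record. -/
def itemSize {S n : ℕ} (w : ℕ) : Item S n → ℕ
  | .inl _ => 1
  | .inr _ => w

/-- The cells of a record, in order. -/
def itemCells {S n : ℕ} (w : ℕ) (x : Item S n) : List (Cell S n) :=
  (List.range (itemSize w x)).map fun j => (x, j)

/-- The cells of a sequence of records that is stored contiguously. -/
def contiguousCells {S n : ℕ} (w : ℕ) (l : List (Item S n)) : List (Cell S n) :=
  l.flatMap (itemCells w)

/-- The sequence `l` of records is stored contiguously in `d`, from the address `a` on. -/
def StoredAt {S n : ℕ} (w : ℕ) (d : Disk S n) (a : ℕ) (l : List (Item S n)) : Prop :=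
  ∀ j < (contiguousCells w l).length, d (a + j) = (contiguousCells w l)[j]?

/-- `l` lists every record exactly once. -/
def IsListing {S n : ℕ} (l : List (Item S n)) : Prop :=
  l.Nodup ∧ ∀ x, x ∈ l

/-- `x` comes before `y` in the sequence `σ`. -/
def Before {S n : ℕ} (σ : List (Item S n)) (x y : Item S n) : Prop :=
  σ.idxOf x < σ.idxOf y

/-- `x` and `y` are large and no small record lies between them in the sorted order `σ`. -/
def SameStripe {S n : ℕ} (σ : List (Item S n)) (x y : Item S n) : Prop :=
  x.isRight ∧ y.isRight ∧
    ∀ i : Fin S, ¬ (Before σ x (.inl i) ∧ Before σ (.inl i) y) ∧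
      ¬ (Before σ y (.inl i) ∧ Before σ (.inl i) x)

/-- The numbers of records in the large-record stripes (the maximal runs of large records) of the
sorted order `σ`, in ascending order of the stripes. -/
def stripeSizes {S n : ℕ} (σ : List (Item S n)) : List ℕ :=
  ((σ.splitOnP fun x => x.isLeft).map List.length).filter fun m => m ≠ 0

/-- `ℓ` is a possible sequence of stripe sizes for `S` small and `n` large records. -/
def IsProfile (S n : ℕ) (ℓ : List ℕ) : Prop :=
  ℓ.sum = n ∧ (∀ m ∈ ℓ, 0 < m) ∧ ℓ.length ≤ S + 1

/-! ### The machine -/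

/-- The parameters of the machine: block size `B`, internal memory size `M`, and the size `w` of
the large records. -/
structure Params where
  B : ℕ
  M : ℕ
  w : ℕ

/-- A configuration: the cells in internal memory and the contents of the disk. -/
structure Conf (S n : ℕ) where
  mem : Finset (Cell S n)
  disk : Disk S n

/-- The cells that lie in block `b`. -/
def blockCells {S n : ℕ} (B : ℕ) (d : Disk S n) (b : ℕ) : Finset (Cell S n) :=
  (Finset.range B).biUnion fun j => (d (b * B + j)).toFinset

/-- The disk after block `b` is overwritten by `f 0, …, f (B - 1)`. -/
def writeBlock {S n : ℕ} (B : ℕ) (d : Disk S n) (b : ℕ) (f : ℕ → Option (Cell S n)) :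
    Disk S n :=
  fun a => if a / B = b then f (a % B) else d a

/-- The record `x` is in internal memory in its entirety. -/
def InMemory {S n : ℕ} (w : ℕ) (mem : Finset (Cell S n)) (x : Item S n) : Prop :=
  ∀ j < itemSize w x, (x, j) ∈ mem

/-- Comparison-based external-memory algorithms, as decision trees.
* `halt a` stops; the output begins at the disk address `a`.
* `read b K A` inputs block `b`; of the old memory contents and of the block, the cells in `K` are
  kept. It continues with `A`.
* `write b f A` outputs cells that are in memory to block `b`, and continues with `A`.
* `compare x y A A'` compares `x` with `y`, and continues with `A` if `x` is smaller, and with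
  `A'` otherwise. -/
inductive Alg (S n : ℕ) : Type
  | halt (a : ℕ) : Alg S n
  | read (b : ℕ) (K : Finset (Cell S n)) (A : Alg S n) : Alg S n
  | write (b : ℕ) (f : ℕ → Option (Cell S n)) (A : Alg S n) : Alg S n
  | compare (x y : Item S n) (A A' : Alg S n) : Alg S n

/-- `Runs p σ A c t a d`: on an input with sorted order `σ`, the algorithm `A`, started in the
configuration `c`, never performs an illegal step and halts after exactly `t` block transfers, with
disk contents `d` and output address `a`. At most `p.M` cells may be in memory, only cells in memory
may be written, and only records that are entirely in memory may be compared.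
Comparisons are free. -/
inductive Runs {S n : ℕ} (p : Params) (σ : List (Item S n)) :
    Alg S n → Conf S n → ℕ → ℕ → Disk S n → Prop
  | halt (a : ℕ) (c : Conf S n) : Runs p σ (.halt a) c 0 a c.disk
  | read {b : ℕ} {K : Finset (Cell S n)} {A : Alg S n} {c : Conf S n} {t a : ℕ} {d : Disk S n}
      (hmem : ((c.mem ∪ blockCells p.B c.disk b) ∩ K).card ≤ p.M)
      (h : Runs p σ A ⟨(c.mem ∪ blockCells p.B c.disk b) ∩ K, c.disk⟩ t a d) :
      Runs p σ (.read b K A) c (t + 1) a d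
  | write {b : ℕ} {f : ℕ → Option (Cell S n)} {A : Alg S n} {c : Conf S n} {t a : ℕ} {d : Disk S n}
      (hmem : ∀ j < p.B, ∀ x, f j = some x → x ∈ c.mem)
      (h : Runs p σ A ⟨c.mem, writeBlock p.B c.disk b f⟩ t a d) :
      Runs p σ (.write b f A) c (t + 1) a d
  | compare_lt {x y : Item S n} {A A' : Alg S n} {c : Conf S n} {t a : ℕ} {d : Disk S n}
      (hx : InMemory p.w c.mem x) (hy : InMemory p.w c.mem y) (hlt : Before σ x y)
      (h : Runs p σ A c t a d) :
      Runs p σ (.compare x y A A') c t a d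
  | compare_not_lt {x y : Item S n} {A A' : Alg S n} {c : Conf S n} {t a : ℕ} {d : Disk S n}
      (hx : InMemory p.w c.mem x) (hy : InMemory p.w c.mem y) (hlt : ¬ Before σ x y)
      (h : Runs p σ A' c t a d) :
      Runs p σ (.compare x y A A') c t a d

/-- The start: the memory is empty, and the disk holds the records in the order of `l`,
contiguously from the address `0` on, and nothing else. -/
def start {S n : ℕ} (w : ℕ) (l : List (Item S n)) : Conf S n :=
  ⟨∅, fun a => (contiguousCells w l)[a]?⟩

/-! ### The two problems -/

/-- `A` solves Two-Sized Sorting when the records are initially stored in the order of `l`: for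
every sorted order `σ` of the records, the output is the sorted sequence of all records, stored
contiguously. -/
def SolvesSort {S n : ℕ} (p : Params) (l : List (Item S n)) (A : Alg S n) : Prop :=
  ∀ σ, IsListing σ → ∃ t a d, Runs p σ A (start p.w l) t a d ∧ StoredAt p.w d a σ

/-- `A` makes at most `t` block transfers on every sorting input with stripe sizes `ℓ` that is
initially stored in the order of `l`. -/
def SortCostLE {S n : ℕ} (p : Params) (l : List (Item S n)) (A : Alg S n) (ℓ : List ℕ) (t : ℕ) :
    Prop :=
  ∀ σ, IsListing σ → stripeSizes σ = ℓ →
    ∀ t' a d, Runs p σ A (start p.w l) t' a d → t' ≤ t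

/-- The initial order of the records in PLE: first the small, then the large records. -/
def pleLayout (S n : ℕ) : List (Item S n) :=
  (List.finRange S).map Sum.inl ++ (List.finRange n).map Sum.inr

/-- The small records are sorted by their index. -/
def SmallSorted {S n : ℕ} (σ : List (Item S n)) : Prop :=
  ∀ i j : Fin S, i < j → Before σ (.inl i) (.inl j)

/-- `out` is a correct output of PLE: a sequence of all records that is sorted, except that the
large records within a stripe may be in any order. -/
def IsPLEOutput {S n : ℕ} (σ out : List (Item S n)) : Prop :=
  IsListing out ∧ out.Pairwise fun x y => Before σ x y ∨ SameStripe σ x y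

/-- `A` solves PLE, the placement of large elements: the small records are given in sorted order,
the large ones in arbitrary order, and for every sorted order `σ` that agrees with the given order
of the small records, a correct output is stored contiguously. -/
def SolvesPLE {S n : ℕ} (p : Params) (A : Alg S n) : Prop :=
  ∀ σ, IsListing σ → SmallSorted σ →
    ∃ t a d, Runs p σ A (start p.w (pleLayout S n)) t a d ∧
      ∃ out, IsPLEOutput σ out ∧ StoredAt p.w d a out

/-- `A` makes at most `t` block transfers on every PLE input with stripe sizes `ℓ`. -/
def PLECostLE {S n : ℕ} (p : Params) (A : Alg S n) (ℓ : List ℕ) (t : ℕ) : Prop :=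
  ∀ σ, IsListing σ → SmallSorted σ → stripeSizes σ = ℓ →
    ∀ t' a d, Runs p σ A (start p.w (pleLayout S n)) t' a d → t' ≤ t

/-- `t` is the I/O complexity of Two-Sized Sorting for the stripe sizes `ℓ`: the least number such
that, however the records are stored initially, some sorting algorithm makes at most `t` block
transfers on every input with these stripe sizes. -/
def IsSortComplexity (S n : ℕ) (p : Params) (ℓ : List ℕ) (t : ℕ) : Prop :=
  IsLeast {t | ∀ l : List (Item S n), IsListing l →
    ∃ A : Alg S n, SolvesSort p l A ∧ SortCostLE p l A ℓ t} t

/-- `t` is the I/O complexity of PLE for the stripe sizes `ℓ`. -/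
def IsPLEComplexity (S n : ℕ) (p : Params) (ℓ : List ℕ) (t : ℕ) : Prop :=
  IsLeast {t | ∃ A : Alg S n, SolvesPLE p A ∧ PLECostLE p A ℓ t} t

/-- The bound
`(S/B) log_{M/B} (S/B) + ple + (∑ i, (L_i/B) log_{M/w} (L_i/w) + L/B)`,
where `L_i = ℓ_i * w` is the volume of the `i`-th stripe and `L` is the total volume of the large
records. -/
noncomputable def sortingBound (S : ℕ) (p : Params) (ℓ : List ℕ) (ple : ℝ) : ℝ :=
  (S : ℝ) / p.B * Real.logb ((p.M : ℝ) / p.B) ((S : ℝ) / p.B) + ple +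
    ((ℓ.map fun m : ℕ => ((m * p.w : ℕ) : ℝ) / p.B *
        Real.logb ((p.M : ℝ) / p.w) (((m * p.w : ℕ) : ℝ) / p.w)).sum +
      ((ℓ.sum * p.w : ℕ) : ℝ) / p.B)

set_option autoImplicit false

/-! Upper bound: the small records are sorted by multiway mergesort, the given PLE algorithm runs on
the result, and the stripes of its output are sorted. An algorithm is merely a decision tree, so it
may be described by what is known: `Strat` follows the set `Φ` of orders consistent with the answers
so far, a step may depend on anything on which all of `Φ` agrees, and `Strat.exists_alg` recovers
the tree. Since `B ≤ w`, a large record can be fetched on its own with O(w/B) transfers. Hence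
sorting the stripes need not move anything: `Strat.sortKnowledge` only gathers comparisons, and
`Strat.finish` puts all records in place once. The PLE algorithm is simulated on relabelled records
in an empty region of the disk (`Strat.simulate`); relabelling keeps the stripe sizes, hence the
cost bound. The result is `exists_sorting_alg`.

The scans cost O((S + L)/B), and S/B log(S/B) does not dominate S/B (it is even negative for S < B).
However, every sequence of stripe sizes occurs in an order that begins with a large record. Then PLE
has to displace every small record, so S/B ≤ PLE (`SolvesPLE.smalls_le_cost`).

Lower bound: each summand is bounded by a multiple of Sort separately. A sorting algorithm also
solves PLE. All records have to pass through memory, which gives L/B (`SolvesSort.volume_le`). The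
two logarithmic terms are counting arguments over a family of orders with the given stripe sizes: at
each step a largest class of the surviving orders is kept, and at a leaf at most one order survives,
since the output determines it. For the small records the large ones are kept in a fixed relative
order; a read merges at most `B` new records into the known order in memory, which costs a factor of
about (M/B)^O(B), and the order inside a block is new only on its first access (`card_le_of_small`).
For the large records only the order within stripes varies. About w cells must come in before a
record can be inserted among the O(M/w) records represented in memory, and a potential measures
partially loaded records (`card_pow_le_of_large`). -/

instance Sum.lawfulBEq {α β : Type*} [BEq α] [BEq β] [LawfulBEq α] [LawfulBEq β] :
    LawfulBEq (α ⊕ β) where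
  eq_of_beq {a b} h := by
    cases a <;> cases b
    · exact congrArg _ (eq_of_beq (α := α) h)
    · cases h
    · cases h
    · exact congrArg _ (eq_of_beq (α := β) h)
  rfl {a} := by
    cases a
    · exact beq_self_eq_true (α := α) _
    · exact beq_self_eq_true (α := β) _

/-! ### Strategies

A strategy is a decision tree seen from the set `Φ` of sorted orders that are consistent with
the comparisons made so far. -/

/-- `Strat p R Φ c t`: from the configuration `c`, reached after `t` block transfers, when exactly
the sorted orders in `Φ` are possible, one can continue so that `R` holds at every leaf. -/
inductive Strat {S n : ℕ} (p : Params) (R : Set (List (Item S n)) → Conf S n → ℕ → Prop) :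
    Set (List (Item S n)) → Conf S n → ℕ → Prop
  | done {Φ : Set (List (Item S n))} {c : Conf S n} {t : ℕ} (h : R Φ c t) : Strat p R Φ c t
  -- A branch with no consistent order is reached by no input, so it may be abandoned without a
  -- legal program.
  | empty {c : Conf S n} {t : ℕ} : Strat p R ∅ c t
  | read {Φ : Set (List (Item S n))} {c : Conf S n} {t : ℕ} (b : ℕ) (K : Finset (Cell S n))
      (hK : ((c.mem ∪ blockCells p.B c.disk b) ∩ K).card ≤ p.M)
      (h : Strat p R Φ ⟨(c.mem ∪ blockCells p.B c.disk b) ∩ K, c.disk⟩ (t + 1)) :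
      Strat p R Φ c t
  | write {Φ : Set (List (Item S n))} {c : Conf S n} {t : ℕ} (b : ℕ) (f : ℕ → Option (Cell S n))
      (hf : ∀ j < p.B, ∀ x, f j = some x → x ∈ c.mem)
      (h : Strat p R Φ ⟨c.mem, writeBlock p.B c.disk b f⟩ (t + 1)) : Strat p R Φ c t
  | compare {Φ : Set (List (Item S n))} {c : Conf S n} {t : ℕ} (x y : Item S n)
      (hx : InMemory p.w c.mem x) (hy : InMemory p.w c.mem y)
      (h : Strat p R (Φ ∩ {σ | Before σ x y}) c t)
      (h' : Strat p R (Φ ∩ {σ | ¬ Before σ x y}) c t) : Strat p R Φ c t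

section

variable {S n : ℕ} {p : Params}

/-- Sequential composition: each leaf is continued by a further strategy. -/
theorem Strat.bind {R R' : Set (List (Item S n)) → Conf S n → ℕ → Prop}
    {Φ : Set (List (Item S n))} {c : Conf S n} {t : ℕ} (h : Strat p R Φ c t)
    (hR : ∀ Φ' c' t', R Φ' c' t' → Strat p R' Φ' c' t') : Strat p R' Φ c t := by
  induction h with
  | done h => exact hR _ _ _ h
  | empty => exact .empty
  | read b K hK _ ih => exact .read b K hK ih
  | write b f hf _ ih => exact .write b f hf ih
  | compare x y hx hy _ _ ih ih' => exact .compare x y hx hy ih ih'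

/-- Comparisons only shrink `Φ`, so everything known before a phase remains known after it. -/
theorem Strat.subset {R : Set (List (Item S n)) → Conf S n → ℕ → Prop}
    {Φ : Set (List (Item S n))} {c : Conf S n} {t : ℕ} (h : Strat p R Φ c t) :
    Strat p (fun Φ' c' t' => R Φ' c' t' ∧ Φ' ⊆ Φ) Φ c t := by
  induction h with
  | done h => exact .done ⟨h, subset_rfl⟩
  | empty => exact .empty
  | read b K hK _ ih => exact .read b K hK ih
  | write b f hf _ ih => exact .write b f hf ih
  | compare x y hx hy _ _ ih ih' =>
    exact .compare x y hx hy
      (ih.bind fun _ _ _ h => .done ⟨h.1, h.2.trans Set.inter_subset_left⟩)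
      (ih'.bind fun _ _ _ h => .done ⟨h.1, h.2.trans Set.inter_subset_left⟩)

/-- Only finitely many places of the disk are occupied. -/
def FinDisk (d : Disk S n) : Prop := ∃ N, ∀ a, N ≤ a → d a = none

theorem FinDisk.writeBlock {B : ℕ} (hB : 1 ≤ B) {d : Disk S n} (hd : FinDisk d) (b : ℕ)
    (f : ℕ → Option (Cell S n)) : FinDisk (writeBlock B d b f) := by
  obtain ⟨N, hN⟩ := hd
  refine ⟨max N ((b + 1) * B), fun a ha => ?_⟩
  have h : a / B ≠ b := by
    have := (Nat.le_div_iff_mul_le hB).2 ((le_max_right _ _).trans ha)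
    omega
  simp [_root_.writeBlock, h, hN a ((le_max_left _ _).trans ha)]

/-- This applies to arbitrary strategies, in particular to a simulated PLE algorithm, so there is
still an empty region to write to afterwards. -/
theorem Strat.finDisk (hB : 1 ≤ p.B) {R : Set (List (Item S n)) → Conf S n → ℕ → Prop}
    {Φ : Set (List (Item S n))} {c : Conf S n} {t : ℕ} (h : Strat p R Φ c t)
    (hc : FinDisk c.disk) :
    Strat p (fun Φ' c' t' => R Φ' c' t' ∧ FinDisk c'.disk) Φ c t := by
  induction h with
  | done h => exact .done ⟨h, hc⟩
  | empty => exact .empty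
  | read b K hK _ ih => exact .read b K hK (ih hc)
  | write b f hf _ ih => exact .write b f hf (ih (hc.writeBlock hB b f))
  | compare x y hx hy _ _ ih ih' => exact .compare x y hx hy (ih hc) (ih' hc)

/-- A strategy whose leaves meet a postcondition is carried out by an algorithm. -/
theorem Strat.exists_alg {Post : List (Item S n) → ℕ → ℕ → Disk S n → Prop}
    {Φ : Set (List (Item S n))} {c : Conf S n} {t : ℕ}
    (h : Strat p (fun Φ' c' t' => ∃ a, ∀ σ ∈ Φ', Post σ t' a c'.disk) Φ c t) :
    ∃ A : Alg S n, ∀ σ ∈ Φ, ∃ t' a d, Runs p σ A c t' a d ∧ Post σ (t + t') a d := by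
  induction h with
  | @done Φ c t h =>
    obtain ⟨a, ha⟩ := h
    exact ⟨.halt a, fun σ hσ => ⟨0, a, c.disk, .halt a c, ha σ hσ⟩⟩
  | empty => exact ⟨.halt 0, fun σ hσ => hσ.elim⟩
  | read b K hK _ ih =>
    obtain ⟨A, hA⟩ := ih
    refine ⟨.read b K A, fun σ hσ => ?_⟩
    obtain ⟨t', a, d, h, h'⟩ := hA σ hσ
    exact ⟨t' + 1, a, d, .read hK h, by rwa [← add_assoc, add_right_comm]⟩
  | write b f hf _ ih =>
    obtain ⟨A, hA⟩ := ih
    refine ⟨.write b f A, fun σ hσ => ?_⟩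
    obtain ⟨t', a, d, h, h'⟩ := hA σ hσ
    exact ⟨t' + 1, a, d, .write hf h, by rwa [← add_assoc, add_right_comm]⟩
  | compare x y hx hy _ _ ih ih' =>
    obtain ⟨A, hA⟩ := ih
    obtain ⟨A', hA'⟩ := ih'
    refine ⟨.compare x y A A', fun σ hσ => ?_⟩
    by_cases hxy : Before σ x y
    · obtain ⟨t', a, d, h, h'⟩ := hA σ ⟨hσ, hxy⟩
      exact ⟨t', a, d, .compare_lt hx hy hxy h, h'⟩
    · obtain ⟨t', a, d, h, h'⟩ := hA' σ ⟨hσ, hxy⟩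
      exact ⟨t', a, d, .compare_not_lt hx hy hxy h, h'⟩

/-- Runs are deterministic for a fixed order; this identifies the run supplied by correctness with
any run whose cost is being bounded. -/
theorem Runs.unique {σ : List (Item S n)} {A : Alg S n} {c : Conf S n} {t t' a a' : ℕ}
    {d d' : Disk S n} (h : Runs p σ A c t a d) (h' : Runs p σ A c t' a' d') :
    t = t' ∧ a = a' ∧ d = d' := by
  induction h generalizing t' a' d' with
  | halt a c => cases h'; simp
  | read hmem _ ih =>
    cases h' with
    | read _ h' => obtain ⟨rfl, rfl, rfl⟩ := ih h'; simp
  | write hmem _ ih =>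
    cases h' with
    | write _ h' => obtain ⟨rfl, rfl, rfl⟩ := ih h'; simp
  | compare_lt hx hy hlt _ ih =>
    cases h' with
    | compare_lt _ _ _ h' => exact ih h'
    | compare_not_lt _ _ hlt' _ => exact absurd hlt hlt'
  | compare_not_lt hx hy hlt _ ih =>
    cases h' with
    | compare_lt _ _ hlt' _ => exact absurd hlt' hlt
    | compare_not_lt _ _ _ h' => exact ih h'

/-! ### Knowledge -/

/-- The relative order of the records in `X` is known. -/
def Agree (Φ : Set (List (Item S n))) (X : Set (Item S n)) : Prop :=
  ∀ σ ∈ Φ, ∀ σ' ∈ Φ, ∀ x ∈ X, ∀ y ∈ X, Before σ x y → Before σ' x y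

theorem Agree.mono {Φ Φ' : Set (List (Item S n))} {X X' : Set (Item S n)} (h : Agree Φ X)
    (hΦ : Φ' ⊆ Φ) (hX : X' ⊆ X) : Agree Φ' X' :=
  fun σ hσ σ' hσ' x hx y hy => h σ (hΦ hσ) σ' (hΦ hσ') x (hX hx) y (hX hy)

theorem agree_empty (Φ : Set (List (Item S n))) : Agree Φ ∅ :=
  fun _ _ _ _ _ hx => hx.elim

theorem Before.trans {σ : List (Item S n)} {x y z : Item S n} (h : Before σ x y)
    (h' : Before σ y z) : Before σ x z := lt_trans h h'

theorem before_irrefl (σ : List (Item S n)) (x : Item S n) : ¬ Before σ x x := lt_irrefl _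

theorem Before.asymm {σ : List (Item S n)} {x y : Item S n} (h : Before σ x y) :
    ¬ Before σ y x := lt_asymm h

theorem IsListing.idxOf_inj {σ : List (Item S n)} (hσ : IsListing σ) {x y : Item S n} :
    σ.idxOf x = σ.idxOf y ↔ x = y := List.idxOf_inj (hσ.2 x)

theorem IsListing.before_or {σ : List (Item S n)} (hσ : IsListing σ) {x y : Item S n}
    (h : x ≠ y) : Before σ x y ∨ Before σ y x :=
  lt_or_gt_of_ne fun h' => h (hσ.idxOf_inj.1 h')

theorem IsListing.pairwise {σ : List (Item S n)} (hσ : IsListing σ) :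
    σ.Pairwise (Before σ) := by
  rw [List.pairwise_iff_getElem]
  intro i j hi hj hij
  simpa [Before, hσ.1.idxOf_getElem] using hij

/-- Comparing all records that are in memory reveals their relative order. -/
theorem Strat.learn {R : Set (List (Item S n)) → Conf S n → ℕ → Prop}
    {Φ : Set (List (Item S n))} {c : Conf S n} {t : ℕ} (X : List (Item S n))
    (hX : ∀ x ∈ X, InMemory p.w c.mem x)
    (h : ∀ Φ' ⊆ Φ, Agree Φ' {x | x ∈ X} → Strat p R Φ' c t) : Strat p R Φ c t := by
  -- The pairs are compared one by one. In the negative branch of a comparison the implication to be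
  -- learnt for this pair is vacuous.
  suffices H : ∀ (ps : List (Item S n × Item S n)),
      (∀ q ∈ ps, InMemory p.w c.mem q.1 ∧ InMemory p.w c.mem q.2) →
      ∀ Φ₁ : Set (List (Item S n)), (∀ Φ' ⊆ Φ₁, (∀ σ ∈ Φ', ∀ σ' ∈ Φ', ∀ q ∈ ps,
        Before σ q.1 q.2 → Before σ' q.1 q.2) → Strat p R Φ' c t) → Strat p R Φ₁ c t by
    refine H (X ×ˢ X) (fun q hq => ?_) Φ fun Φ' hΦ' hq => h Φ' hΦ' ?_
    · rw [List.mem_product] at hq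
      exact ⟨hX _ hq.1, hX _ hq.2⟩
    · intro σ hσ σ' hσ' x hx y hy
      exact hq σ hσ σ' hσ' (x, y) (List.mem_product.2 ⟨hx, hy⟩)
  intro ps
  induction ps with
  | nil => exact fun _ Φ₁ h => h Φ₁ subset_rfl (by simp)
  | cons q ps ih =>
    intro hq Φ₁ h₁
    rw [List.forall_mem_cons] at hq
    refine .compare q.1 q.2 hq.1.1 hq.1.2 (ih hq.2 _ fun Φ' hΦ' h' => ?_)
      (ih hq.2 _ fun Φ' hΦ' h' => ?_)
    · refine h₁ Φ' (hΦ'.trans Set.inter_subset_left) fun σ hσ σ' hσ' => ?_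
      rw [List.forall_mem_cons]
      exact ⟨fun _ => (hΦ' hσ').2, h' σ hσ σ' hσ'⟩
    · refine h₁ Φ' (hΦ'.trans Set.inter_subset_left) fun σ hσ σ' hσ' => ?_
      rw [List.forall_mem_cons]
      exact ⟨fun h => absurd h (hΦ' hσ).2, h' σ hσ σ' hσ'⟩

/-! ### Reading blocks into memory. -/

theorem mem_blockCells {B : ℕ} {d : Disk S n} {b : ℕ} {x : Cell S n} :
    x ∈ blockCells B d b ↔ ∃ j < B, d (b * B + j) = some x := by
  simp [blockCells]

theorem mem_blockCells_div {B : ℕ} (hB : 1 ≤ B) {d : Disk S n} {a : ℕ} {x : Cell S n}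
    (h : d a = some x) : x ∈ blockCells B d (a / B) :=
  mem_blockCells.2 ⟨a % B, Nat.mod_lt _ hB, by rwa [Nat.div_add_mod']⟩

/-- Reading the blocks `bs` while keeping only the cells in `K`. -/
theorem Strat.load {R : Set (List (Item S n)) → Conf S n → ℕ → Prop}
    {Φ : Set (List (Item S n))} {d : Disk S n} (K : Finset (Cell S n)) (hK : K.card ≤ p.M)
    (bs : List ℕ) {mem : Finset (Cell S n)} {t : ℕ}
    (hbs : ∀ x ∈ K, x ∈ mem ∨ ∃ b ∈ bs, x ∈ blockCells p.B d b)
    (h : ∀ mem' : Finset (Cell S n), K ⊆ mem' → Strat p R Φ ⟨mem', d⟩ (t + bs.length)) :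
    Strat p R Φ ⟨mem, d⟩ t := by
  induction bs generalizing mem t with
  | nil => exact h mem fun x hx => by simpa using hbs x hx
  | cons b bs ih =>
    -- After each read the memory is a subset of `K`, so it fits however many blocks are read.
    refine .read b K ((Finset.card_le_card Finset.inter_subset_right).trans hK)
      (ih (fun x hx => ?_) fun mem' hm => ?_)
    · rcases hbs x hx with h' | ⟨b', hb', h'⟩
      · exact .inl (by simp [h', hx])
      · rcases List.mem_cons.1 hb' with rfl | hb'
        · exact .inl (by simp [h', hx])
        · exact .inr ⟨b', hb', h'⟩
    · have := h mem' hm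
      rwa [List.length_cons, Nat.add_comm bs.length, ← Nat.add_assoc] at this

end

/-! ### Moving data to an empty region of the disk -/

/-- The number of blocks of size `B` that `N` cells fill. -/
def numBlocks (B N : ℕ) : ℕ := (N + B - 1) / B

theorem numBlocks_le {B : ℕ} (N : ℕ) : numBlocks B N ≤ N / B + 1 := by
  rcases Nat.eq_zero_or_pos B with rfl | hB
  · simp [numBlocks]
  · rw [numBlocks, ← Nat.add_div_right _ hB]
    exact Nat.div_le_div_right (by omega)

theorem le_numBlocks_mul {B : ℕ} (hB : 1 ≤ B) (N : ℕ) : N ≤ numBlocks B N * B := by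
  have := Nat.lt_div_mul_add (a := N + B - 1) hB
  unfold numBlocks
  omega

section

variable {S n : ℕ} {p : Params}

/-- Whatever is stored in `d` is also stored in `d'`. -/
def Extends (d d' : Disk S n) : Prop := ∀ a x, d a = some x → d' a = some x

theorem Extends.refl (d : Disk S n) : Extends d d := fun _ _ h => h

theorem Extends.trans {d d' d'' : Disk S n} (h : Extends d d') (h' : Extends d' d'') :
    Extends d d'' := fun a x hx => h' a x (h a x hx)

/-- `d` after the first `k` blocks of the list `T` are written from block `F` on. -/
def overlay (B : ℕ) (d : Disk S n) (F : ℕ) (T : List (Cell S n)) (k : ℕ) : Disk S n :=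
  fun a => if F * B ≤ a ∧ a < (F + k) * B then T[a - F * B]? else d a

theorem writeBlock_overlay {B : ℕ} (hB : 1 ≤ B) (d : Disk S n) (F : ℕ) (T : List (Cell S n))
    (k : ℕ) : writeBlock B (overlay B d F T k) (F + k) (fun o => T[k * B + o]?) =
      overlay B d F T (k + 1) := by
  funext a
  unfold writeBlock overlay
  have e1 : (F + k) * B = F * B + k * B := by ring
  have e2 : (F + (k + 1)) * B = F * B + k * B + B := by ring
  have e3 := Nat.div_add_mod' a B
  have e4 := Nat.mod_lt a hB
  by_cases h : a / B = F + k
  · rw [if_pos h, if_pos (by rw [h, e1] at e3; omega)]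
    rw [h, e1] at e3
    have e6 : k * B + a % B = a - F * B := by omega
    simp only [e6]
  · rw [if_neg h]
    have h1 : a < (F + k) * B ∨ (F + (k + 1)) * B ≤ a := by
      rcases lt_or_gt_of_ne h with h | h
      · exact .inl ((Nat.div_lt_iff_lt_mul hB).1 h)
      · exact .inr ((Nat.le_div_iff_mul_le hB).1 h)
    refine if_congr ?_ rfl rfl
    omega

theorem Strat.writeMany (hB : 1 ≤ p.B) {R : Set (List (Item S n)) → Conf S n → ℕ → Prop}
    {Φ : Set (List (Item S n))} {d : Disk S n} {F : ℕ} {T : List (Cell S n)}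
    {mem : Finset (Cell S n)} (m : ℕ) {k t : ℕ}
    (hmem : ∀ j, k * p.B ≤ j → j < (k + m) * p.B → ∀ x, T[j]? = some x → x ∈ mem)
    (h : Strat p R Φ ⟨mem, overlay p.B d F T (k + m)⟩ (t + m)) :
    Strat p R Φ ⟨mem, overlay p.B d F T k⟩ t := by
  induction m generalizing k t with
  | zero => exact h
  | succ m ih =>
    refine .write (F + k) (fun o => T[k * p.B + o]?) (fun j hj x hx => ?_) ?_
    · refine hmem _ (by omega) ?_ x hx
      have : (k + (m + 1)) * p.B = k * p.B + m * p.B + p.B := by ring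
      have := Nat.zero_le (m * p.B)
      omega
    · dsimp only
      rw [writeBlock_overlay hB]
      refine ih (fun j hj hj' => hmem j ?_ ?_) ?_
      · have : (k + 1) * p.B = k * p.B + p.B := by ring
        omega
      · rwa [Nat.add_comm m 1, ← Nat.add_assoc]
      · rwa [Nat.add_assoc, Nat.add_assoc, Nat.add_comm 1 m]

/-- The cells `T` are copied to an empty region of the disk, in chunks of `f` blocks. It costs
one read for every pair of a chunk and a source block that have a cell in common. -/
theorem Strat.gather (hB : 1 ≤ p.B) {R : Set (List (Item S n)) → Conf S n → ℕ → Prop}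
    {Φ : Set (List (Item S n))} {f : ℕ} (hf : 1 ≤ f) (hfM : f * p.B ≤ p.M) {d : Disk S n}
    (hd : FinDisk d) {mem : Finset (Cell S n)} {t : ℕ} (T : List (Cell S n)) (s : ℕ → ℕ)
    (hs : ∀ j (h : j < T.length), d (s j) = some T[j]) {E : ℕ}
    (hE : ((Finset.range T.length).image fun j => (j / (f * p.B), s j / p.B)).card ≤ E)
    (h : ∀ mem' d' F t', FinDisk d' → Extends d d' → (∀ j, d' (F * p.B + j) = T[j]?) →
      t' ≤ t + (E + numBlocks p.B T.length) → Strat p R Φ ⟨mem', d'⟩ t') :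
    Strat p R Φ ⟨mem, d⟩ t := by
  obtain ⟨N, hN⟩ := hd
  set q := numBlocks p.B T.length with hq
  set Z := f * p.B with hZ
  have hZ1 : 1 ≤ Z := Nat.mul_pos hf hB
  have hlen : T.length ≤ q * p.B := le_numBlocks_mul hB _
  -- The disk is empty from address `N`, hence from block `N` on. All source cells lie before that
  -- block and are never overwritten.
  have hNF : N ≤ N * p.B := Nat.le_mul_of_pos_right _ hB
  have hsN : ∀ j, j < T.length → s j < N * p.B := by
    intro j hj
    by_contra! hj'
    have := hs j hj
    rw [hN _ (hNF.trans hj')] at this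
    cases this
  have hov : ∀ k j (h : j < T.length), overlay p.B d N T k (s j) = some T[j] := by
    intro k j hj
    rw [overlay, if_neg (by have := hsN j hj; omega), hs j hj]
  -- The source blocks that contribute to chunk `c` of the output.
  set e : ℕ → Finset ℕ := fun c =>
    ((Finset.range T.length).filter fun j => j / Z = c).image fun j => s j / p.B with he
  -- Induction on the number `r` of remaining chunks, after `c` chunks are done. The minimum
  -- accounts for a last chunk that is not full.
  have hloop : ∀ r c (mem : Finset (Cell S n)), q ≤ (c + r) * f →
      Strat p R Φ ⟨mem, overlay p.B d N T (min (c * f) q)⟩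
        (t + ∑ i ∈ Finset.range c, (e i).card + min (c * f) q) := by
    intro r
    induction r with
    | zero =>
      intro c mem hc
      rw [Nat.add_zero] at hc
      rw [min_eq_right hc]
      have hd' : ∀ a, N * p.B ≤ a → overlay p.B d N T q a = T[a - N * p.B]? := by
        intro a ha
        rw [overlay]
        split_ifs with h1
        · rfl
        · have : (N + q) * p.B = N * p.B + q * p.B := by ring
          rw [hN _ (by omega), eq_comm, List.getElem?_eq_none]
          omega
      refine h mem _ N _ ⟨N * p.B + T.length, fun a ha => ?_⟩ (fun a x hx => ?_) (fun j => ?_) ?_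
      · rw [hd' _ (by omega), List.getElem?_eq_none]
        omega
      · rw [overlay, if_neg, hx]
        rintro ⟨h1, -⟩
        rw [hN _ (by omega)] at hx
        cases hx
      · rw [hd' _ (by omega), Nat.add_sub_cancel_left]
      -- The reads of all chunks together are counted by the pairs of a chunk and a source block.
      · have : ∑ i ∈ Finset.range c, (e i).card ≤ E := by
          refine le_trans ?_ hE
          rw [← Finset.card_sigma]
          refine Finset.card_le_card_of_injOn (fun z => (z.1, z.2)) ?_ ?_
          · rintro ⟨i, b⟩ hz
            simp only [he, Finset.coe_sigma, Finset.coe_image, Set.mem_sigma_iff, Finset.mem_coe,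
              Finset.mem_filter, Finset.mem_range, Set.mem_image] at hz ⊢
            obtain ⟨-, j, ⟨hj, rfl⟩, rfl⟩ := hz
            exact ⟨j, hj, rfl⟩
          · rintro ⟨i, b⟩ - ⟨i', b'⟩ - hz
            simp only [Prod.mk.injEq] at hz
            obtain ⟨rfl, rfl⟩ := hz
            rfl
        omega
    | succ r ih =>
      intro c mem hc
      have hcf : (c + 1) * f = c * f + f := by ring
      refine Strat.load ((T.drop (c * Z)).take Z).toFinset ?_ (e c).toList ?_ fun mem' hm => ?_
      · refine (List.toFinset_card_le _).trans ((List.length_take_le _ _).trans hfM)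
      · intro x hx
        right
        rw [List.mem_toFinset, List.mem_iff_getElem] at hx
        obtain ⟨i, hi, rfl⟩ := hx
        have hi' : i < Z ∧ c * Z + i < T.length := by
          rw [List.length_take, List.length_drop] at hi
          omega
        refine ⟨s (c * Z + i) / p.B, ?_, ?_⟩
        · rw [Finset.mem_toList]
          refine Finset.mem_image.2 ⟨c * Z + i, ?_, rfl⟩
          rw [Finset.mem_filter, Finset.mem_range]
          refine ⟨hi'.2, ?_⟩
          rw [Nat.mul_comm c, Nat.mul_add_div hZ1, Nat.div_eq_of_lt hi'.1, Nat.add_zero]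
        · refine mem_blockCells_div hB ?_
          rw [hov _ _ hi'.2]
          simp
      · obtain ⟨m, hm1, hm2⟩ : ∃ m, min (c * f) q + m = min ((c + 1) * f) q ∧
            (m = 0 ∨ min (c * f) q = c * f ∧ m ≤ f) :=
          ⟨min ((c + 1) * f) q - min (c * f) q, by omega, by omega⟩
        refine Strat.writeMany hB m ?_ ?_
        · intro j hj hj' x hx
          rcases hm2 with rfl | ⟨hm2, hm3⟩
          · rw [Nat.add_zero] at hj'
            omega
          · refine hm ?_
            rw [hm2] at hj hj'
            have e1 : (c * f + m) * p.B = c * f * p.B + m * p.B := by ring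
            have e2 : c * f * p.B = c * Z := by rw [hZ]; ring
            have e3 : m * p.B ≤ Z := Nat.mul_le_mul_right _ hm3
            obtain ⟨hjl, rfl⟩ := List.getElem?_eq_some_iff.1 hx
            rw [List.mem_toFinset, List.mem_iff_getElem]
            refine ⟨j - c * Z, ?_, ?_⟩
            · rw [List.length_take, List.length_drop]
              omega
            · simp only [List.getElem_take, List.getElem_drop]
              congr 1
              omega
        · rw [hm1]
          have := ih (c + 1) mem' (by rw [Nat.add_assoc, Nat.add_comm 1]; exact hc)
          rw [Finset.sum_range_succ] at this
          rw [Finset.length_toList]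
          convert this using 1
          omega
  have := hloop q 0 mem (by rw [Nat.zero_add]; exact Nat.le_mul_of_pos_right _ hf)
  simp only [Nat.zero_mul, Nat.zero_min, Finset.range_zero, Finset.sum_empty, Nat.add_zero] at this
  have h0 : overlay p.B d N T 0 = d := by
    funext a
    rw [overlay, if_neg (by rw [Nat.add_zero]; omega)]
  rwa [h0] at this

/-- Monotone functions `α` and `β` take few pairs of values. -/
theorem card_image_pair_le (J : Finset ℕ) (α β : ℕ → ℕ) (α₀ β₀ k l : ℕ)
    (hα : ∀ i ∈ J, ∀ j ∈ J, i ≤ j → α i ≤ α j) (hβ : ∀ i ∈ J, ∀ j ∈ J, i ≤ j → β i ≤ β j)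
    (hα' : ∀ i ∈ J, α₀ ≤ α i ∧ α i ≤ α₀ + k) (hβ' : ∀ i ∈ J, β₀ ≤ β i ∧ β i ≤ β₀ + l) :
    (J.image fun j => (α j, β j)).card ≤ k + l + 1 := by
  have : (J.image fun j => (α j, β j)).card ≤ (Finset.Icc (α₀ + β₀) (α₀ + β₀ + (k + l))).card := by
    -- The pairs form a chain in the product order, so they are distinguished by the sum of their
    -- coordinates.
    refine Finset.card_le_card_of_injOn (fun z => z.1 + z.2) ?_ ?_
    · intro z hz
      simp only [Finset.coe_image, Set.mem_image, Finset.mem_coe] at hz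
      obtain ⟨j, hj, rfl⟩ := hz
      have := hα' j hj
      have := hβ' j hj
      simp only [Finset.coe_Icc, Set.mem_Icc]
      omega
    · intro z hz z' hz' h
      simp only [Finset.coe_image, Set.mem_image, Finset.mem_coe] at hz hz'
      obtain ⟨i, hi, rfl⟩ := hz
      obtain ⟨j, hj, rfl⟩ := hz'
      simp only at h
      rcases le_total i j with hij | hij
      · have := hα i hi j hj hij
        have := hβ i hi j hj hij
        simp only [Prod.mk.injEq]
        omega
      · have := hα j hj i hi hij
        have := hβ j hj i hi hij
        simp only [Prod.mk.injEq]
        omega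
  refine this.trans ?_
  rw [Nat.card_Icc]
  omega

end

/-! ### Contiguously stored sequences of records -/

section

variable {S n : ℕ} {w : ℕ}

/-- The total size of a sequence of records. -/
def vol (w : ℕ) (l : List (Item S n)) : ℕ := (contiguousCells w l).length

/-- The distance of the record `x` from the beginning of the contiguously stored sequence `l`. -/
def pos (w : ℕ) (l : List (Item S n)) (x : Item S n) : ℕ := vol w (l.take (l.idxOf x))

theorem length_itemCells (x : Item S n) : (itemCells w x).length = itemSize w x := by
  simp [itemCells]

@[simp] theorem contiguousCells_nil : contiguousCells w ([] : List (Item S n)) = [] := rfl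

theorem contiguousCells_cons (x : Item S n) (l : List (Item S n)) :
    contiguousCells w (x :: l) = itemCells w x ++ contiguousCells w l := rfl

theorem contiguousCells_append (l l' : List (Item S n)) :
    contiguousCells w (l ++ l') = contiguousCells w l ++ contiguousCells w l' := by
  simp [contiguousCells]

@[simp] theorem vol_nil : vol w ([] : List (Item S n)) = 0 := rfl

theorem vol_cons (x : Item S n) (l : List (Item S n)) :
    vol w (x :: l) = itemSize w x + vol w l := by
  simp [vol, contiguousCells_cons, length_itemCells]

theorem vol_append (l l' : List (Item S n)) : vol w (l ++ l') = vol w l + vol w l' := by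
  simp [vol, contiguousCells_append]

theorem vol_perm {l l' : List (Item S n)} (h : l.Perm l') : vol w l = vol w l' := by
  induction h with
  | nil => rfl
  | cons x _ ih => rw [vol_cons, vol_cons, ih]
  | swap x y l => simp only [vol_cons]; omega
  | trans _ _ ih ih' => rw [ih, ih']

theorem pos_cons_self (x : Item S n) (l : List (Item S n)) : pos w (x :: l) x = 0 := by
  simp [pos]

theorem pos_cons_ne {x y : Item S n} (h : y ≠ x) (l : List (Item S n)) :
    pos w (y :: l) x = itemSize w y + pos w l x := by
  rw [pos, List.idxOf_cons_ne _ h, List.take_succ_cons, vol_cons, pos]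

theorem getElem?_itemCells {x : Item S n} {k : ℕ} (hk : k < itemSize w x) :
    (itemCells w x)[k]? = some (x, k) := by
  simp [itemCells, hk]

theorem getElem?_pos_add {l : List (Item S n)} {x : Item S n} (hx : x ∈ l) {k : ℕ}
    (hk : k < itemSize w x) : (contiguousCells w l)[pos w l x + k]? = some (x, k) := by
  induction l with
  | nil => cases hx
  | cons y l ih =>
    rw [contiguousCells_cons]
    by_cases h : y = x
    · subst h
      rw [pos_cons_self, Nat.zero_add, List.getElem?_append_left (by rwa [length_itemCells]),
        getElem?_itemCells hk]
    · rw [pos_cons_ne h, List.getElem?_append_right (by rw [length_itemCells]; omega),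
        length_itemCells, Nat.add_assoc, Nat.add_sub_cancel_left]
      exact ih ((List.mem_cons.1 hx).resolve_left (Ne.symm h))

theorem pos_add_le {l : List (Item S n)} {x : Item S n} (hx : x ∈ l) :
    pos w l x + itemSize w x ≤ vol w l := by
  induction l with
  | nil => cases hx
  | cons y l ih =>
    rw [vol_cons]
    by_cases h : y = x
    · subst h
      rw [pos_cons_self]
      omega
    · rw [pos_cons_ne h]
      have := ih ((List.mem_cons.1 hx).resolve_left (Ne.symm h))
      omega

theorem exists_pos_add {l : List (Item S n)} (hl : l.Nodup) {j : ℕ}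
    (hj : j < (contiguousCells w l).length) :
    ∃ x ∈ l, ∃ k < itemSize w x, j = pos w l x + k ∧ (contiguousCells w l)[j] = (x, k) := by
  suffices H : ∃ x ∈ l, ∃ k < itemSize w x, j = pos w l x + k by
    obtain ⟨x, hx, k, hk, h⟩ := H
    refine ⟨x, hx, k, hk, h, ?_⟩
    have := getElem?_pos_add hx hk
    rw [← h, List.getElem?_eq_getElem hj] at this
    exact Option.some.inj this
  induction l generalizing j with
  | nil => simp at hj
  | cons y l ih =>
    rw [contiguousCells_cons, List.length_append, length_itemCells] at hj
    rw [List.nodup_cons] at hl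
    by_cases h : j < itemSize w y
    · exact ⟨y, by simp, j, h, by simp [pos_cons_self]⟩
    · obtain ⟨x, hx, k, hk, e⟩ := ih hl.2 (j := j - itemSize w y) (by omega)
      refine ⟨x, by simp [hx], k, hk, ?_⟩
      rw [pos_cons_ne (by rintro rfl; exact hl.1 hx)]
      omega

theorem pos_add_le_pos {l : List (Item S n)} {x y : Item S n} (hx : x ∈ l)
    (hxy : Before l x y) : pos w l x + itemSize w x ≤ pos w l y := by
  have h1 : l.take (l.idxOf x + 1) <+: l.take (l.idxOf y) :=
    List.take_prefix_take_left hxy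
  obtain ⟨r, hr⟩ := h1
  have hlt := List.idxOf_lt_length_iff.2 hx
  rw [pos, pos, ← hr, vol_append, List.take_succ_eq_append_getElem hlt, vol_append,
    List.getElem_idxOf hlt, vol_cons, vol_nil]
  omega

/-- The record `x` is stored at the address `a`. -/
def ItemAt (w : ℕ) (d : Disk S n) (x : Item S n) (a : ℕ) : Prop :=
  ∀ k < itemSize w x, d (a + k) = some (x, k)

theorem ItemAt.mono {d d' : Disk S n} (hd : Extends d d') {x : Item S n} {a : ℕ}
    (h : ItemAt w d x a) : ItemAt w d' x a := fun k hk => hd _ _ (h k hk)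

theorem StoredAt.itemAt {d : Disk S n} {a : ℕ} {l : List (Item S n)} (h : StoredAt w d a l)
    {x : Item S n} (hx : x ∈ l) : ItemAt w d x (a + pos w l x) := by
  intro k hk
  have h1 := getElem?_pos_add hx hk
  have h2 := (List.getElem?_eq_some_iff.1 h1).1
  rw [Nat.add_assoc, h _ h2, h1]

theorem StoredAt.mono {d d' : Disk S n} (hd : Extends d d') {a : ℕ} {l : List (Item S n)}
    (h : StoredAt w d a l) : StoredAt w d' a l := by
  intro j hj
  have := h j hj
  rw [List.getElem?_eq_getElem hj] at this ⊢
  exact hd _ _ this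

theorem storedAt_of_forall {d : Disk S n} {a : ℕ} {l : List (Item S n)}
    (h : ∀ j, d (a + j) = (contiguousCells w l)[j]?) : StoredAt w d a l := fun j _ => h j

theorem ItemAt.mem_blockCells {B : ℕ} (hB : 1 ≤ B) {d : Disk S n} {x : Item S n} {a : ℕ}
    (h : ItemAt w d x a) {k : ℕ} (hk : k < itemSize w x) :
    (x, k) ∈ blockCells B d ((a + k) / B) := mem_blockCells_div hB (h k hk)

end

section

variable {S n : ℕ} {p : Params}

/-- The records in `τ` are copied, in this order, to an empty region of the disk. They are divided
into classes; within a class, the order in `τ` agrees with that of the blocks on the disk. A class `i` lies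
within `sp i` consecutive cells before, and within `sp' i` consecutive cells of the output. -/
theorem Strat.move {ι : Type*} [DecidableEq ι] (hB : 1 ≤ p.B)
    {R : Set (List (Item S n)) → Conf S n → ℕ → Prop}
    {Φ : Set (List (Item S n))} {f : ℕ} (hf : 1 ≤ f) (hfM : f * p.B ≤ p.M) {d : Disk S n}
    (hd : FinDisk d) {mem : Finset (Cell S n)} {t : ℕ} (τ : List (Item S n)) (hτ : τ.Nodup)
    (src : Item S n → ℕ) (hsrc : ∀ x ∈ τ, ItemAt p.w d x (src x))
    (κ : Item S n → ι) (I : Finset ι) (hκ : ∀ x ∈ τ, κ x ∈ I) (lo lo' sp sp' : ι → ℕ)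
    (hmono : ∀ x ∈ τ, ∀ y ∈ τ, κ x = κ y → Before τ x y → ∀ k < itemSize p.w x,
      (src x + k) / p.B ≤ src y / p.B)
    (hsp : ∀ x ∈ τ, lo (κ x) ≤ src x ∧ src x + itemSize p.w x ≤ lo (κ x) + sp (κ x))
    (hsp' : ∀ x ∈ τ, lo' (κ x) ≤ pos p.w τ x ∧
      pos p.w τ x + itemSize p.w x ≤ lo' (κ x) + sp' (κ x))
    (h : ∀ mem' d' F t', FinDisk d' → Extends d d' →
      (∀ j, d' (F * p.B + j) = (contiguousCells p.w τ)[j]?) →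
      t' ≤ t + (∑ i ∈ I, (sp' i / (f * p.B) + sp i / p.B + 3) + numBlocks p.B (vol p.w τ)) →
      Strat p R Φ ⟨mem', d'⟩ t') :
    Strat p R Φ ⟨mem, d⟩ t := by
  classical
  set T := contiguousCells p.w τ with hT
  -- The source address of the `j`-th output cell. The default `0` is never used, as only `j` below
  -- the length of `T` matter.
  set s : ℕ → ℕ := fun j => ((T[j]?).elim 0 fun x => src x.1 + x.2) with hs
  have hTs : ∀ j (hj : j < T.length), ∃ x ∈ τ, ∃ k < itemSize p.w x, j = pos p.w τ x + k ∧
      T[j] = (x, k) ∧ s j = src x + k := by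
    intro j hj
    obtain ⟨x, hx, k, hk, e1, e2⟩ := exists_pos_add hτ hj
    refine ⟨x, hx, k, hk, e1, e2, ?_⟩
    simp only [hs, List.getElem?_eq_getElem hj]
    rw [show T[j] = (x, k) from e2]
    rfl
  refine Strat.gather hB hf hfM hd T s (fun j hj => ?_) ?_ h
  · obtain ⟨x, hx, k, hk, e1, e2, e3⟩ := hTs j hj
    rw [e2, e3, hsrc x hx k hk]
  · set J : ι → Finset ℕ := fun i => (Finset.range T.length).filter fun j =>
      ∃ x k, T[j]? = some (x, k) ∧ κ x = i with hJ
    have hJ' : ∀ i, ∀ j ∈ J i, ∃ x ∈ τ, ∃ k < itemSize p.w x, κ x = i ∧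
        j = pos p.w τ x + k ∧ s j = src x + k := by
      intro i j hj
      obtain ⟨hj, x, k, h1, h2⟩ := Finset.mem_filter.1 hj
      rw [Finset.mem_range] at hj
      obtain ⟨x', hx', k', hk', e1, e2, e3⟩ := hTs j hj
      rw [List.getElem?_eq_getElem hj, e2] at h1
      cases h1
      exact ⟨x, hx', k, hk', h2, e1, e3⟩
    -- The pairs of chunk and source block are counted class by class; within a class both
    -- coordinates are monotone in `j`.
    have hsub : ((Finset.range T.length).image fun j => (j / (f * p.B), s j / p.B)) ⊆
        I.biUnion fun i => (J i).image fun j => (j / (f * p.B), s j / p.B) := by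
      intro z hz
      obtain ⟨j, hj, rfl⟩ := Finset.mem_image.1 hz
      obtain ⟨x, hx, k, hk, e1, e2, e3⟩ := hTs j (Finset.mem_range.1 hj)
      refine Finset.mem_biUnion.2 ⟨κ x, hκ x hx, Finset.mem_image.2 ⟨j, ?_, rfl⟩⟩
      refine Finset.mem_filter.2 ⟨hj, x, k, ?_, rfl⟩
      rw [List.getElem?_eq_getElem (Finset.mem_range.1 hj), e2]
    refine (Finset.card_le_card hsub).trans (Finset.card_biUnion_le.trans
      (Finset.sum_le_sum fun i _ => ?_))
    have hdiv : ∀ Z, 1 ≤ Z → ∀ l s a, l ≤ a → a < l + s → l / Z ≤ a / Z ∧ a / Z ≤ l / Z + (s / Z + 1) := by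
      intro Z hZ l s a h1 h2
      refine ⟨Nat.div_le_div_right h1, ?_⟩
      have h3 := Nat.lt_div_mul_add (a := l) hZ
      have h4 := Nat.lt_div_mul_add (a := s) hZ
      rw [← Nat.lt_succ_iff, Nat.div_lt_iff_lt_mul hZ]
      have : (l / Z + (s / Z + 1)).succ * Z = l / Z * Z + s / Z * Z + Z + Z := by
        rw [Nat.succ_eq_add_one]; ring
      omega
    -- An interval of `s` cells can begin inside a block, so its block indices spread over at most
    -- `s / Z + 1`. The two extra units and the `+ 1` of the chain bound give the `3` per class.
    have := card_image_pair_le (J i) (fun j => j / (f * p.B)) (fun j => s j / p.B)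
      (lo' i / (f * p.B)) (lo i / p.B) (sp' i / (f * p.B) + 1) (sp i / p.B + 1)
      (fun j _ j' _ hjj => Nat.div_le_div_right hjj) ?_ ?_ ?_
    · omega
    · intro j hj j' hj' hjj
      obtain ⟨x, hx, k, hk, rfl, e1, e2⟩ := hJ' i j hj
      obtain ⟨x', hx', k', hk', e0, e1', e2'⟩ := hJ' _ j' hj'
      rw [e2, e2']
      rcases eq_or_ne x x' with rfl | hne
      · exact Nat.div_le_div_right (by omega)
      · rcases lt_or_gt_of_ne (fun h' => hne ((List.idxOf_inj hx).1 h')) with h' | h'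
        · exact (hmono x hx x' hx' e0.symm h' k hk).trans (Nat.div_le_div_right (by omega))
        · have := pos_add_le_pos (w := p.w) hx' h'
          omega
    · intro j hj
      obtain ⟨x, hx, k, hk, rfl, e1, e2⟩ := hJ' i j hj
      have := hsp' x hx
      exact hdiv _ (Nat.mul_pos hf hB) _ _ _ (by omega) (by omega)
    · intro j hj
      obtain ⟨x, hx, k, hk, rfl, e1, e2⟩ := hJ' i j hj
      have := hsp x hx
      simp only [e2]
      exact hdiv _ hB _ _ _ (by omega) (by omega)

end

/-! ### Multiway merging as an acquisition of knowledge -/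

section

variable {S n : ℕ} {p : Params}

theorem mem_contiguousCells {w : ℕ} {l : List (Item S n)} {x : Item S n} {k : ℕ} :
    (x, k) ∈ contiguousCells w l ↔ x ∈ l ∧ k < itemSize w x := by
  simp only [contiguousCells, itemCells, List.mem_flatMap, List.mem_map, List.mem_range,
    Prod.mk.injEq]
  constructor
  · rintro ⟨y, hy, j, hj, rfl, rfl⟩
    exact ⟨hy, hj⟩
  · rintro ⟨h1, h2⟩
    exact ⟨x, h1, k, h2, rfl, rfl⟩

/-- The records in `U` have total size at most `v` and lie in at most `u` blocks. -/
def UnitAt (p : Params) (d : Disk S n) (u v : ℕ) (U : List (Item S n)) : Prop :=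
  vol p.w U ≤ v ∧ ∃ bs : List ℕ, bs.length ≤ u ∧
    ∀ x ∈ U, ∀ k < itemSize p.w x, ∃ b ∈ bs, (x, k) ∈ blockCells p.B d b

theorem vol_flatten_le {w : ℕ} {v : ℕ} (L : List (List (Item S n))) (h : ∀ l ∈ L, vol w l ≤ v) :
    vol w L.flatten ≤ L.length * v := by
  induction L with
  | nil => simp
  | cons l L ih =>
    rw [List.forall_mem_cons] at h
    rw [List.flatten_cons, vol_append, List.length_cons, Nat.add_mul, Nat.one_mul]
    have := ih h.2
    omega

/-- In the merging of sorted streams, there is a stream whose current unit can be dropped. -/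
theorem exists_stream {Φ : Set (List (Item S n))} {σ₀ : List (Item S n)} (hσ₀ : σ₀ ∈ Φ)
    {D : Set (Item S n)} {st : List (List (Item S n) × List (List (Item S n)))}
    (hsort : ∀ s ∈ st, ∀ σ ∈ Φ, (s.1 ++ s.2.flatten).Pairwise (Before σ))
    (hD : Agree Φ D) (hcD : ∀ s ∈ st, ∀ x ∈ s.1, x ∈ D) (hne : ∃ s ∈ st, s.2 ≠ []) :
    ∃ s ∈ st, s.2 ≠ [] ∧
      ∀ x ∈ s.1, ∀ s' ∈ st, ∀ z ∈ s'.2.flatten, ∀ σ ∈ Φ, Before σ x z := by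
  by_cases hemp : ∃ s ∈ st, s.2 ≠ [] ∧ s.1 = []
  · obtain ⟨s, hs, h1, h2⟩ := hemp
    exact ⟨s, hs, h1, by simp [h2]⟩
  · push Not at hemp
    -- Among the streams with units left, one whose current unit has the smallest last record. The
    -- order of the current records is known, so the choice made by `σ₀` is right for all of `Φ`.
    -- The default `0` does not occur, because these streams have nonempty current units.
    obtain ⟨s, ⟨hs, hs2⟩, hmin⟩ := Set.exists_min_image {s | s ∈ st ∧ s.2 ≠ []}
      (fun s => (s.1.getLast?).elim 0 fun x => σ₀.idxOf x)
      ((List.finite_toSet st).subset fun s hs => hs.1) hne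
    refine ⟨s, hs, hs2, fun x hx s' hs' z hz σ hσ => ?_⟩
    have hs'2 : s'.2 ≠ [] := by rintro h; simp [h] at hz
    have hle := hmin s' ⟨hs', hs'2⟩
    obtain ⟨i, a, hi⟩ := (List.eq_nil_or_concat s.1).resolve_left (hemp s hs hs2)
    obtain ⟨i', a', hi'⟩ := (List.eq_nil_or_concat s'.1).resolve_left (hemp s' hs' hs'2)
    simp only [hi, hi', List.concat_eq_append, List.getLast?_append, List.getLast?_singleton,
      Option.some_or, Option.elim_some] at hle
    have ha : a ∈ s.1 := by simp [hi]
    have ha' : a' ∈ s'.1 := by simp [hi']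
    have h1 : Before σ a' z := (List.pairwise_append.1 (hsort s' hs' σ hσ)).2.2 a' ha' z hz
    have h2 : ¬ Before σ a' a := fun h =>
      absurd (hD σ hσ σ₀ hσ₀ a' (hcD s' hs' a' ha') a (hcD s hs a ha) h) (not_lt.2 hle)
    have h3 : x = a ∨ Before σ x a := by
      have := (List.pairwise_append.1 (hsort s hs σ hσ)).1
      rw [hi, List.concat_eq_append, List.pairwise_append] at this
      rw [hi, List.concat_eq_append, List.mem_append, List.mem_singleton] at hx
      rcases hx with hx | hx
      · exact .inr (this.2.2 x hx a (by simp))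
      · exact .inl hx
    unfold Before at *
    rcases h3 with rfl | h3 <;> omega

/-- The merging of sorted streams of units, with one unit of each stream in memory. -/
theorem Strat.mergeStreams {R : Set (List (Item S n)) → Conf S n → ℕ → Prop} {d : Disk S n}
    {u v : ℕ} (r : ℕ) {Φ : Set (List (Item S n))} {D : Set (Item S n)}
    {mem : Finset (Cell S n)} {t : ℕ} (st : List (List (Item S n) × List (List (Item S n))))
    (hr : (st.map fun s => s.2.length).sum = r) (hM : st.length * v ≤ p.M)
    (hcur : ∀ s ∈ st, vol p.w s.1 ≤ v) (hmem : ∀ s ∈ st, ∀ x ∈ s.1, InMemory p.w mem x)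
    (hunit : ∀ s ∈ st, ∀ U ∈ s.2, UnitAt p d u v U)
    (hsort : ∀ s ∈ st, ∀ σ ∈ Φ, (s.1 ++ s.2.flatten).Pairwise (Before σ))
    (hD : Agree Φ D) (hcD : ∀ s ∈ st, ∀ x ∈ s.1, x ∈ D)
    (hseen : ∀ x ∈ D, (∃ s ∈ st, x ∈ s.1) ∨
      ∀ s ∈ st, ∀ z ∈ s.2.flatten, ∀ σ ∈ Φ, Before σ x z)
    (h : ∀ Φ' ⊆ Φ, ∀ mem' t', t' ≤ t + u * r →
      Agree Φ' (D ∪ {x | ∃ s ∈ st, x ∈ s.2.flatten}) → Strat p R Φ' ⟨mem', d⟩ t') :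
    Strat p R Φ ⟨mem, d⟩ t := by
  induction r generalizing Φ D mem t st with
  | zero =>
    refine h Φ subset_rfl mem t (by omega) (hD.mono subset_rfl ?_)
    rintro x (hx | ⟨s, hs, hx⟩)
    · exact hx
    · rw [List.sum_eq_zero_iff] at hr
      have := hr _ (List.mem_map.2 ⟨s, hs, rfl⟩)
      rw [List.length_eq_zero_iff] at this
      simp [this] at hx
  | succ r ih =>
    rcases Φ.eq_empty_or_nonempty with rfl | ⟨σ₀, hσ₀⟩
    · exact .empty
    have hne : ∃ s ∈ st, s.2 ≠ [] := by
      by_contra! hne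
      rw [List.sum_eq_zero] at hr
      · omega
      · intro k hk
        obtain ⟨s, hs, rfl⟩ := List.mem_map.1 hk
        simp [hne s hs]
    -- The current unit `s1` of this stream precedes all that is still unread, so the next unit `U`
    -- may take its place in memory.
    obtain ⟨⟨s1, s2⟩, hs, hs2, hlow⟩ := exists_stream hσ₀ hsort hD hcD hne
    obtain ⟨U, rest, rfl⟩ := List.exists_cons_of_ne_nil hs2
    obtain ⟨A, A', rfl⟩ := List.append_of_mem hs
    have hU := hunit _ hs U (by simp)
    obtain ⟨hUv, bs, hbs, hUbs⟩ := hU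
    have hmem' : ∀ s, s ∈ A ++ (U, rest) :: A' ↔ s = (U, rest) ∨ s ∈ A ++ A' := by
      intro s
      simp only [List.mem_append, List.mem_cons]
      tauto
    have hold : ∀ s, s ∈ A ++ A' → s ∈ A ++ (s1, U :: rest) :: A' := by
      intro s
      simp only [List.mem_append, List.mem_cons]
      tauto
    have hmem_old : ∀ s, s ∈ A ++ (s1, U :: rest) :: A' → s = (s1, U :: rest) ∨ s ∈ A ++ A' := by
      intro s
      simp only [List.mem_append, List.mem_cons]
      tauto
    have hcur' : ∀ s ∈ A ++ (U, rest) :: A', vol p.w s.1 ≤ v := by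
      intro s hs
      rcases (hmem' s).1 hs with rfl | hs
      · exact hUv
      · exact hcur s (hold s hs)
    -- The current units after the exchange. They fill the memory and are all compared with each
    -- other.
    set X := ((A ++ (U, rest) :: A').map Prod.fst).flatten with hX
    have hXmem : ∀ x, x ∈ X ↔ x ∈ U ∨ ∃ s ∈ A ++ A', x ∈ s.1 := by
      intro x
      rw [hX, List.mem_flatten]
      constructor
      · rintro ⟨l, hl, hx⟩
        obtain ⟨s, hs, rfl⟩ := List.mem_map.1 hl
        rcases (hmem' s).1 hs with rfl | hs
        · exact .inl hx
        · exact .inr ⟨s, hs, hx⟩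
      · rintro (hx | ⟨s, hs, hx⟩)
        · exact ⟨U, List.mem_map.2 ⟨_, (hmem' _).2 (.inl rfl), rfl⟩, hx⟩
        · exact ⟨s.1, List.mem_map.2 ⟨s, (hmem' _).2 (.inr hs), rfl⟩, hx⟩
    have hXv : vol p.w X ≤ p.M := by
      refine (vol_flatten_le (v := v) _ ?_).trans (le_trans ?_ hM)
      · intro l hl
        obtain ⟨s, hs, rfl⟩ := List.mem_map.1 hl
        exact hcur' s hs
      · simp
    have hcase : ∀ x ∈ D, (∃ s ∈ A ++ A', x ∈ s.1) ∨
        ∀ s ∈ A ++ (s1, U :: rest) :: A', ∀ z ∈ s.2.flatten, ∀ σ ∈ Φ, Before σ x z := by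
      intro x hx
      rcases hseen x hx with ⟨s, hs', hxs⟩ | hx'
      · rcases hmem_old s hs' with rfl | hs'
        · exact .inr (hlow x hxs)
        · exact .inl ⟨s, hs', hxs⟩
      · exact .inr hx'
    refine Strat.load (contiguousCells p.w X).toFinset ((List.toFinset_card_le _).trans hXv) bs
      ?_ fun mem' hm => ?_
    · rintro ⟨x, k⟩ hxk
      rw [List.mem_toFinset, mem_contiguousCells] at hxk
      rcases (hXmem x).1 hxk.1 with hx | ⟨s, hs', hx⟩
      · exact .inr (hUbs x hx k hxk.2)
      · exact .inl (hmem s (hold s hs') x hx k hxk.2)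
    · have hXin : ∀ x ∈ X, InMemory p.w mem' x := fun x hx k hk =>
        hm (List.mem_toFinset.2 (mem_contiguousCells.2 ⟨hx, hk⟩))
      refine Strat.learn X hXin fun Φ' hΦ' hagree => ?_
      refine ih (D := D ∪ {x | x ∈ U}) (A ++ (U, rest) :: A') ?_ ?_ hcur' ?_ ?_ ?_ ?_ ?_ ?_ ?_
      · simp only [List.map_append, List.map_cons, List.sum_append, List.sum_cons,
          List.length_cons] at hr ⊢
        omega
      · simpa using hM
      · intro s hs x hx
        refine hXin x ((hXmem x).2 ?_)
        rcases (hmem' s).1 hs with rfl | hs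
        · exact .inl hx
        · exact .inr ⟨s, hs, hx⟩
      · intro s hs
        rcases (hmem' s).1 hs with rfl | hs
        · intro V hV
          exact hunit (s1, U :: rest) (by simp) V (List.mem_cons_of_mem _ hV)
        · exact hunit s (hold s hs)
      · intro s hs σ hσ
        rcases (hmem' s).1 hs with rfl | hs
        · have := hsort (s1, U :: rest) (by simp) σ (hΦ' hσ)
          exact (List.pairwise_append.1 this).2.1
        · exact hsort s (hold s hs) σ (hΦ' hσ)
      -- A known record is either still in memory, and then compared with the new unit, or it
      -- precedes all unread records and so the new unit.
      · have key : ∀ x ∈ D, ∀ y ∈ U, (x ∈ X ∧ y ∈ X) ∨ ∀ σ ∈ Φ', Before σ x y := by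
          intro x hx y hy
          rcases hcase x hx with h1 | h1
          · exact .inl ⟨(hXmem x).2 (.inr h1), (hXmem y).2 (.inl hy)⟩
          · refine .inr fun σ hσ => h1 (s1, U :: rest) (by simp) y ?_ σ (hΦ' hσ)
            simp [hy]
        rintro σ hσ σ' hσ' x (hx | hx) y (hy | hy) hxy
        · exact hD σ (hΦ' hσ) σ' (hΦ' hσ') x hx y hy hxy
        · rcases key x hx y hy with h1 | h1
          · exact hagree σ hσ σ' hσ' x h1.1 y h1.2 hxy
          · exact h1 σ' hσ'
        · rcases key y hy x hx with h1 | h1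
          · exact hagree σ hσ σ' hσ' x h1.2 y h1.1 hxy
          · exact absurd hxy (h1 σ hσ).asymm
        · exact hagree σ hσ σ' hσ' x ((hXmem x).2 (.inl hx)) y ((hXmem y).2 (.inl hy)) hxy
      · intro s hs x hx
        rcases (hmem' s).1 hs with rfl | hs
        · exact .inr hx
        · exact .inl (hcD s (hold s hs) x hx)
      · rintro x (hx | hx)
        · rcases hcase x hx with ⟨s, hs', hxs⟩ | h1
          · exact .inl ⟨s, (hmem' s).2 (.inr hs'), hxs⟩
          · right
            intro s hs z hz σ hσ
            rcases (hmem' s).1 hs with rfl | hs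
            · refine h1 (s1, U :: rest) (by simp) z ?_ σ (hΦ' hσ)
              rw [List.flatten_cons]
              exact List.mem_append_right _ hz
            · exact h1 s (hold s hs) z hz σ (hΦ' hσ)
        · exact .inl ⟨(U, rest), by simp, hx⟩
      · intro Φ'' hΦ'' mem'' t' ht' hag
        refine h Φ'' (hΦ''.trans hΦ') mem'' t' ?_ (hag.mono subset_rfl ?_)
        · rw [Nat.mul_succ]
          omega
        · rintro x (hx | ⟨s, hs, hx⟩)
          · exact .inl (.inl hx)
          · rcases hmem_old s hs with rfl | hs
            · rw [List.flatten_cons, List.mem_append] at hx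
              rcases hx with hx | hx
              · exact .inl (.inr hx)
              · exact .inr ⟨(U, rest), by simp, hx⟩
            · exact .inr ⟨s, (hmem' s).2 (.inr hs), hx⟩

/-- The merging of sorted sequences of units. -/
theorem Strat.mergeUnits {R : Set (List (Item S n)) → Conf S n → ℕ → Prop} {d : Disk S n}
    {u v : ℕ} {Φ : Set (List (Item S n))} {mem : Finset (Cell S n)} {t : ℕ}
    (st : List (List (List (Item S n)))) (hM : st.length * v ≤ p.M)
    (hunit : ∀ s ∈ st, ∀ U ∈ s, UnitAt p d u v U)
    (hsort : ∀ s ∈ st, ∀ σ ∈ Φ, s.flatten.Pairwise (Before σ))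
    (h : ∀ Φ' ⊆ Φ, ∀ mem' t', t' ≤ t + u * (st.map List.length).sum →
      Agree Φ' {x | ∃ s ∈ st, x ∈ s.flatten} → Strat p R Φ' ⟨mem', d⟩ t') :
    Strat p R Φ ⟨mem, d⟩ t := by
  refine Strat.mergeStreams (u := u) (v := v) (st.map List.length).sum (D := ∅)
    (st.map fun s => ([], s)) ?_ ?_ ?_ ?_ ?_ ?_ (agree_empty Φ) ?_ ?_ ?_
  · rw [List.map_map]
    rfl
  · simpa using hM
  all_goals simp only [List.mem_map, forall_exists_index, and_imp, forall_apply_eq_imp_iff₂,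
    Set.mem_empty_iff_false, IsEmpty.forall_iff, implies_true, List.not_mem_nil, vol_nil,
    Nat.zero_le, List.nil_append]
  · exact hunit
  · exact hsort
  · intro Φ' hΦ' mem' t' ht' hag
    refine h Φ' hΦ' mem' t' ht' (hag.mono subset_rfl ?_)
    rintro x ⟨s, hs, hx⟩
    exact .inr ⟨([], s), ⟨s, hs, rfl⟩, hx⟩

theorem exists_chunks {α : Type*} (f m : ℕ) (xs : List α) (h : xs.length ≤ f * m) :
    ∃ cs : List (List α), cs.flatten = xs ∧ cs.length ≤ f ∧ ∀ c ∈ cs, c.length ≤ m := by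
  induction f generalizing xs with
  | zero => exact ⟨[], by simpa [eq_comm] using h, by simp, by simp⟩
  | succ f ih =>
    have hd : (xs.drop m).length ≤ f * m := by
      rw [List.length_drop, Nat.sub_le_iff_le_add, ← Nat.succ_mul]
      exact h
    obtain ⟨cs, h1, h2, h3⟩ := ih (xs.drop m) hd
    refine ⟨xs.take m :: cs, by simp [h1], by simpa using h2, ?_⟩
    rw [List.forall_mem_cons]
    exact ⟨List.length_take_le _ _, h3⟩

/-- The records in `c`, in the order of `σ`. -/
def sortedBy (σ c : List (Item S n)) : List (Item S n) := σ.filter fun x => decide (x ∈ c)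

theorem mem_sortedBy {σ c : List (Item S n)} (hσ : IsListing σ) {x : Item S n} :
    x ∈ sortedBy σ c ↔ x ∈ c := by
  simp [sortedBy, hσ.2 x]

theorem nodup_sortedBy {σ : List (Item S n)} (c : List (Item S n)) (hσ : IsListing σ) :
    (sortedBy σ c).Nodup := hσ.1.filter _

theorem length_sortedBy_le {σ : List (Item S n)} (c : List (Item S n)) (hσ : IsListing σ) :
    (sortedBy σ c).length ≤ c.length := by
  rw [← List.toFinset_card_of_nodup (nodup_sortedBy c hσ)]
  refine le_trans (Finset.card_le_card fun x hx => ?_) (List.toFinset_card_le c)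
  rw [List.mem_toFinset] at hx ⊢
  exact (mem_sortedBy hσ).1 hx

theorem sortedBy_perm {σ c : List (Item S n)} (hσ : IsListing σ) (hc : c.Nodup) :
    (sortedBy σ c).Perm c :=
  (List.perm_ext_iff_of_nodup (nodup_sortedBy c hσ) hc).2 fun _ => mem_sortedBy hσ

/-- Once the order of `c` is known, an arbitrary `σ₀ ∈ Φ` may serve to write down the sorted
sequence. -/
theorem pairwise_sortedBy {Φ : Set (List (Item S n))} {c σ₀ : List (Item S n)}
    (hag : Agree Φ {x | x ∈ c}) (hσ₀ : σ₀ ∈ Φ) (hl : IsListing σ₀) {σ : List (Item S n)}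
    (hσ : σ ∈ Φ) : (sortedBy σ₀ c).Pairwise (Before σ) :=
  (hl.pairwise.filter _).imp_of_mem fun {a b} ha hb hab =>
    hag σ₀ hσ₀ σ hσ a ((mem_sortedBy hl).1 ha) b ((mem_sortedBy hl).1 hb) hab

/-- Mergesort, without moving the records: `f ^ h` records are sorted at the cost of loading each
of them `h` times. -/
theorem Strat.sortKnowledge {R : Set (List (Item S n)) → Conf S n → ℕ → Prop} {d : Disk S n}
    {u v f : ℕ} (hM : f * v ≤ p.M) (h : ℕ) {Φ : Set (List (Item S n))}
    (hΦ : ∀ σ ∈ Φ, IsListing σ) {mem : Finset (Cell S n)} {t : ℕ} (xs : List (Item S n))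
    (hunit : ∀ x ∈ xs, UnitAt p d u v [x]) (hxs : xs.length ≤ f ^ h)
    (hR : ∀ Φ' ⊆ Φ, ∀ mem' t', t' ≤ t + u * (h * xs.length) → Agree Φ' {x | x ∈ xs} →
      Strat p R Φ' ⟨mem', d⟩ t') :
    Strat p R Φ ⟨mem, d⟩ t := by
  induction h generalizing Φ mem t xs R with
  | zero =>
    refine hR Φ subset_rfl mem t (by omega) fun σ _ σ' _ x hx y hy hxy => ?_
    rw [pow_zero] at hxs
    match xs, hxs with
    | [], _ => cases hx
    | [z], _ =>
      rw [Set.mem_ofPred_eq, List.mem_singleton] at hx hy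
      subst hx hy
      exact absurd hxy (before_irrefl _ _)
  | succ h ih =>
    rw [pow_succ, Nat.mul_comm] at hxs
    obtain ⟨cs, rfl, hcf, hcl⟩ := exists_chunks f (f ^ h) xs hxs
    -- The chunks are sorted one after another by the induction hypothesis, and their costs add up.
    have hseq : ∀ (cs : List (List (Item S n))) (Φ : Set (List (Item S n)))
        (_ : ∀ σ ∈ Φ, IsListing σ) (mem : Finset (Cell S n)) (t : ℕ)
        (_ : ∀ c ∈ cs, c.length ≤ f ^ h) (_ : ∀ c ∈ cs, ∀ x ∈ c, UnitAt p d u v [x])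
        (_ : ∀ Φ' ⊆ Φ, ∀ mem' t', t' ≤ t + u * (h * cs.flatten.length) →
          (∀ c ∈ cs, Agree Φ' {x | x ∈ c}) → Strat p R Φ' ⟨mem', d⟩ t'),
        Strat p R Φ ⟨mem, d⟩ t := by
      intro cs
      induction cs with
      | nil => exact fun Φ _ mem t _ _ hR => hR Φ subset_rfl mem t (by omega) (by simp)
      | cons c cs ihc =>
        intro Φ hΦ mem t hcl hun hR
        rw [List.forall_mem_cons] at hcl hun
        refine ih hΦ c hun.1 hcl.1 fun Φ' hΦ' mem' t' ht' hag => ?_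
        refine ihc Φ' (fun σ hσ => hΦ σ (hΦ' hσ)) mem' t' hcl.2 hun.2
          fun Φ'' hΦ'' mem'' t'' ht'' hag' => ?_
        refine hR Φ'' (hΦ''.trans hΦ') mem'' t'' ?_ ?_
        · rw [List.flatten_cons, List.length_append, Nat.mul_add, Nat.mul_add]
          omega
        · rw [List.forall_mem_cons]
          exact ⟨hag.mono hΦ'' subset_rfl, hag'⟩
    refine hseq cs Φ hΦ mem t hcl (fun c hc x hx => hunit x (List.mem_flatten.2 ⟨c, hc, hx⟩))
      fun Φ' hΦ' mem' t' ht' hag => ?_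
    rcases Φ'.eq_empty_or_nonempty with rfl | ⟨σ₀, hσ₀⟩
    · exact .empty
    have hl := hΦ σ₀ (hΦ' hσ₀)
    have hfl : ∀ c : List (Item S n), (c.map fun x => [x]).flatten = c := by
      intro c
      induction c with
      | nil => rfl
      | cons x c ih => rw [List.map_cons, List.flatten_cons, ih, List.singleton_append]
    -- The sorted chunks are merged with single records as units, so every record is loaded once
    -- more.
    refine Strat.mergeUnits (u := u) (v := v) (cs.map fun c => (sortedBy σ₀ c).map fun x => [x])
      ?_ ?_ ?_ fun Φ'' hΦ'' mem'' t'' ht'' hag' => ?_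
    · rw [List.length_map]
      exact (Nat.mul_le_mul_right _ hcf).trans hM
    · simp only [List.mem_map, forall_exists_index, and_imp, forall_apply_eq_imp_iff₂]
      intro c hc x hx
      exact hunit x (List.mem_flatten.2 ⟨c, hc, (mem_sortedBy hl).1 hx⟩)
    · simp only [List.mem_map, forall_exists_index, and_imp, forall_apply_eq_imp_iff₂, hfl]
      intro c hc σ hσ
      exact pairwise_sortedBy (hag c hc) hσ₀ hl hσ
    · refine hR Φ'' (hΦ''.trans hΦ') mem'' t'' ?_ (hag'.mono subset_rfl ?_)
      · have h1 : ((cs.map fun c => (sortedBy σ₀ c).map fun x => [x]).map List.length).sum ≤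
            cs.flatten.length := by
          rw [List.length_flatten, List.map_map]
          refine List.sum_le_sum fun c _ => ?_
          simpa using length_sortedBy_le c hl
        have h2 := Nat.mul_le_mul_left u h1
        rw [Nat.add_mul, Nat.one_mul, Nat.mul_add]
        omega
      · intro x hx
        obtain ⟨c, hc, hxc⟩ := List.mem_flatten.1 hx
        refine ⟨_, List.mem_map.2 ⟨c, hc, rfl⟩, ?_⟩
        rw [hfl]
        exact (mem_sortedBy hl).2 hxc

end

/-! ### Mergesort of the small records -/

section

variable {S n : ℕ} {p : Params}

theorem pairwise_of_before {l : List (Item S n)} {r : Item S n → Item S n → Prop}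
    (h : l.Pairwise r) {x y : Item S n} (hy : y ∈ l) (hxy : Before l x y) : r x y := by
  have h2 := List.idxOf_lt_length_iff.2 hy
  have h1 : l.idxOf x < l.length := lt_trans hxy h2
  have := List.pairwise_iff_getElem.1 h _ _ h1 h2 hxy
  rwa [List.getElem_idxOf, List.getElem_idxOf] at this

theorem before_of_pairwise {l σ : List (Item S n)} (h : l.Pairwise (Before σ)) {x y : Item S n}
    (hx : x ∈ l) (hxy : Before σ x y) : Before l x y := by
  rcases lt_trichotomy (l.idxOf x) (l.idxOf y) with h' | h' | h'
  · exact h'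
  · rw [List.idxOf_inj hx] at h'
    exact absurd (h' ▸ hxy) (before_irrefl _ _)
  · exact absurd hxy (pairwise_of_before h hx h').asymm

theorem itemSize_of_isLeft {w : ℕ} {x : Item S n} (h : x.isLeft) : itemSize w x = 1 := by
  cases x
  · rfl
  · simp at h

theorem vol_eq_length {w : ℕ} {l : List (Item S n)} (h : ∀ x ∈ l, x.isLeft) :
    vol w l = l.length := by
  induction l with
  | nil => rfl
  | cons x l ih =>
    rw [List.forall_mem_cons] at h
    rw [vol_cons, ih h.2, itemSize_of_isLeft h.1, List.length_cons, Nat.add_comm]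

theorem storedAt_append {w : ℕ} {d : Disk S n} {a : ℕ} {l l' : List (Item S n)} :
    StoredAt w d a (l ++ l') ↔ StoredAt w d a l ∧ StoredAt w d (a + vol w l) l' := by
  unfold StoredAt
  rw [contiguousCells_append, List.length_append]
  constructor
  · intro h
    refine ⟨fun j hj => ?_, fun j hj => ?_⟩
    · rw [h j (by omega), List.getElem?_append_left hj]
    · rw [Nat.add_assoc, h _ (by unfold vol; omega), List.getElem?_append_right (by unfold vol; omega)]
      unfold vol
      rw [Nat.add_sub_cancel_left]
  · rintro ⟨h, h'⟩ j hj
    by_cases hj' : j < (contiguousCells w l).length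
    · rw [h j hj', List.getElem?_append_left hj']
    · rw [List.getElem?_append_right (by omega), ← h' _ (by omega)]
      congr 1
      unfold vol
      omega

theorem numBlocks_mono (B : ℕ) {N N' : ℕ} (h : N ≤ N') : numBlocks B N ≤ numBlocks B N' :=
  Nat.div_le_div_right (by omega)

theorem div_le_numBlocks {B : ℕ} (hB : 1 ≤ B) (N : ℕ) : N / B ≤ numBlocks B N :=
  Nat.div_le_div_right (by omega)

theorem numBlocks_add_mul {B : ℕ} (hB : 1 ≤ B) (k N : ℕ) :
    numBlocks B (k * B + N) = k + numBlocks B N := by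
  unfold numBlocks
  rw [← Nat.mul_add_div hB, Nat.mul_comm B k]
  congr 1
  omega

theorem one_le_numBlocks {B N : ℕ} (hB : 1 ≤ B) (hN : 1 ≤ N) : 1 ≤ numBlocks B N :=
  (Nat.le_div_iff_mul_le hB).2 (by omega)

/-- A contiguously stored sequence of small records splits into units of one block each. -/
theorem exists_units {d : Disk S n} (k : ℕ) {F : ℕ} {l : List (Item S n)}
    (hl : ∀ x ∈ l, x.isLeft) (h : StoredAt p.w d (F * p.B) l) (hk : l.length ≤ k * p.B) :
    ∃ us : List (List (Item S n)), us.flatten = l ∧ us.length ≤ k ∧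
      ∀ U ∈ us, UnitAt p d 1 p.B U := by
  induction k generalizing F l with
  | zero => exact ⟨[], by simpa [eq_comm] using hk, by simp, by simp⟩
  | succ k ih =>
    have hl1 : ∀ x ∈ l.take p.B, x.isLeft := fun x hx => hl x (List.mem_of_mem_take hx)
    have hl2 : ∀ x ∈ l.drop p.B, x.isLeft := fun x hx => hl x (List.mem_of_mem_drop hx)
    have hst := h
    rw [← List.take_append_drop p.B l, storedAt_append] at hst
    have hv := vol_eq_length (w := p.w) hl1
    have hstd : StoredAt p.w d ((F + 1) * p.B) (l.drop p.B) := by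
      by_cases hlen : l.length ≤ p.B
      · rw [List.drop_eq_nil_of_le hlen]
        intro j hj
        simp at hj
      · rw [hv, List.length_take, min_eq_left (by omega)] at hst
        rw [Nat.add_mul, Nat.one_mul]
        exact hst.2
    rw [Nat.add_mul, Nat.one_mul] at hk
    obtain ⟨us, h1, h2, h3⟩ := ih hl2 hstd (by rw [List.length_drop]; omega)
    refine ⟨l.take p.B :: us, by simp [h1], by simpa using h2, ?_⟩
    rw [List.forall_mem_cons]
    refine ⟨⟨by rw [hv]; exact List.length_take_le _ _, [F], by simp, fun x hx k hk => ⟨F, by simp, ?_⟩⟩, h3⟩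
    have := hst.1.itemAt hx k hk
    have h4 := pos_add_le (w := p.w) hx
    rw [hv, List.length_take] at h4
    refine mem_blockCells.2 ⟨pos p.w (l.take p.B) x + k, by omega, ?_⟩
    rwa [← Nat.add_assoc]

theorem length_le_sum_numBlocks {α : Type*} {B : ℕ} (hB : 1 ≤ B) (L : List (List α × ℕ))
    (hL : ∀ r ∈ L, r.1 ≠ []) :
    L.length ≤ (L.map fun r => numBlocks B r.1.length).sum := by
  induction L with
  | nil => simp
  | cons r L ih =>
    rw [List.forall_mem_cons] at hL
    have := one_le_numBlocks hB (List.length_pos_iff.2 hL.1)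
    have := ih hL.2
    simp only [List.length_cons, List.map_cons, List.sum_cons]
    omega

theorem sum_toFinset_le {α : Type*} [DecidableEq α] (L : List α) (f : α → ℕ) :
    ∑ a ∈ L.toFinset, f a ≤ (L.map f).sum := by
  induction L with
  | nil => simp
  | cons a L ih =>
    rw [List.toFinset_cons, List.map_cons, List.sum_cons]
    by_cases h : a ∈ L.toFinset
    · rw [Finset.insert_eq_of_mem h]
      omega
    · rw [Finset.sum_insert h]
      omega

/-- A merging step: at most `f` sorted runs of small records are merged. -/
theorem Strat.mergeRuns (hB : 1 ≤ p.B) {R : Set (List (Item S n)) → Conf S n → ℕ → Prop}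
    {f : ℕ} (hf : 1 ≤ f) (hfM : f * p.B ≤ p.M) {Φ : Set (List (Item S n))}
    (hΦ : ∀ σ ∈ Φ, IsListing σ) {d : Disk S n} (hd : FinDisk d) {mem : Finset (Cell S n)} {t : ℕ}
    (xs : List (Item S n)) (hxs : ∀ x ∈ xs, x.isLeft) (hnd : xs.Nodup)
    (L : List (List (Item S n) × ℕ)) (hLx : (L.map Prod.fst).flatten.Perm xs)
    (hLf : L.length ≤ f) (hLne : ∀ r ∈ L, r.1 ≠ [])
    (hLs : ∀ r ∈ L, ∀ σ ∈ Φ, r.1.Pairwise (Before σ))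
    (hLd : ∀ r ∈ L, StoredAt p.w d (r.2 * p.B) r.1)
    (hLq : (L.map fun r => numBlocks p.B r.1.length).sum ≤ numBlocks p.B xs.length)
    (h : ∀ Φ' ⊆ Φ, ∀ mem' d' F' t' ys, FinDisk d' → Extends d d' → ys.Perm xs →
      (∀ σ ∈ Φ', ys.Pairwise (Before σ)) → StoredAt p.w d' (F' * p.B) ys →
      t' ≤ t + 7 * numBlocks p.B xs.length → Strat p R Φ' ⟨mem', d'⟩ t') :
    Strat p R Φ ⟨mem, d⟩ t := by
  classical
  have hLmem : ∀ x, x ∈ xs ↔ ∃ r ∈ L, x ∈ r.1 := by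
    intro x
    rw [← hLx.mem_iff, List.mem_flatten]
    simp
  have hus : ∀ r ∈ L, ∃ us : List (List (Item S n)), us.flatten = r.1 ∧
      us.length ≤ numBlocks p.B r.1.length ∧ ∀ U ∈ us, UnitAt p d 1 p.B U := fun r hr =>
    exists_units _ (fun x hx => hxs x ((hLmem x).2 ⟨r, hr, hx⟩)) (hLd r hr)
      (le_numBlocks_mul hB _)
  choose! us hus1 hus2 hus3 using hus
  -- The merge is first carried out as a pure acquisition of knowledge, with one block of each run
  -- in memory; the records are moved afterwards.
  refine Strat.mergeUnits (u := 1) (v := p.B) (L.map us) ?_ ?_ ?_ fun Φ' hΦ' mem' t' ht' hag => ?_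
  · rw [List.length_map]
    exact (Nat.mul_le_mul_right _ hLf).trans hfM
  · simp only [List.mem_map, forall_exists_index, and_imp, forall_apply_eq_imp_iff₂]
    exact hus3
  · simp only [List.mem_map, forall_exists_index, and_imp, forall_apply_eq_imp_iff₂]
    intro r hr σ hσ
    rw [hus1 r hr]
    exact hLs r hr σ hσ
  rcases Φ'.eq_empty_or_nonempty with rfl | ⟨σ₀, hσ₀⟩
  · exact .empty
  have hl := hΦ σ₀ (hΦ' hσ₀)
  have hagx : Agree Φ' {x | x ∈ xs} := by
    refine hag.mono subset_rfl ?_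
    intro x hx
    obtain ⟨r, hr, hxr⟩ := (hLmem x).1 hx
    exact ⟨us r, List.mem_map.2 ⟨r, hr, rfl⟩, by rwa [hus1 r hr]⟩
  have hyp := sortedBy_perm hl hnd
  set ys := sortedBy σ₀ xs with hys
  have hymem : ∀ x, x ∈ ys ↔ x ∈ xs := fun x => mem_sortedBy hl
  have hyσ : ∀ σ ∈ Φ', ys.Pairwise (Before σ) := fun σ hσ => pairwise_sortedBy hagx hσ₀ hl hσ
  have hyl : vol p.w ys = xs.length := by
    rw [vol_eq_length fun x hx => hxs x ((hymem x).1 hx), hyp.length_eq]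
  have hκ : ∀ x ∈ xs, ∃ r ∈ L, x ∈ r.1 := fun x hx => (hLmem x).1 hx
  choose! κ hκ1 hκ2 using hκ
  have hLvol : ∀ r ∈ L, vol p.w r.1 = r.1.length := fun r hr =>
    vol_eq_length fun x hx => hxs x ((hLmem x).2 ⟨r, hr, hx⟩)
  -- Each run is a class: it is contiguous on the disk and its order agrees with the merged order.
  refine Strat.move hB hf hfM hd ys (nodup_sortedBy xs hl)
    (fun x => (κ x).2 * p.B + pos p.w (κ x).1 x) (fun x hx => ?_) κ L.toFinset (fun x hx => ?_)
    (fun r => r.2 * p.B) (fun _ => 0) (fun r => r.1.length) (fun _ => xs.length) ?_ ?_ ?_ ?_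
  · have hx' := (hymem x).1 hx
    exact (hLd _ (hκ1 x hx')).itemAt (hκ2 x hx')
  · exact List.mem_toFinset.2 (hκ1 x ((hymem x).1 hx))
  · intro x hx y hy hxy hb
    have hx' := (hymem x).1 hx
    have hxr := hκ2 x hx'
    have h1 : Before σ₀ x y := pairwise_of_before (hyσ σ₀ hσ₀) hy hb
    have h2 := before_of_pairwise (hLs _ (hκ1 x hx') σ₀ (hΦ' hσ₀)) hxr h1
    have := pos_add_le_pos (w := p.w) hxr h2
    rw [← hxy]
    exact fun k hk => Nat.div_le_div_right (by omega)
  · intro x hx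
    have hx' := (hymem x).1 hx
    have := pos_add_le (w := p.w) (hκ2 x hx')
    rw [hLvol _ (hκ1 x hx')] at this
    omega
  · intro x hx
    have := pos_add_le (w := p.w) hx
    omega
  · intro mem'' d' F t'' hd' hext hst ht''
    refine h Φ' hΦ' mem'' d' F t'' ys hd' hext hyp hyσ (storedAt_of_forall hst) ?_
    set N := xs.length with hN
    set q := numBlocks p.B N with hq
    have h1 : (List.map List.length (L.map us)).sum ≤ q := by
      rw [List.map_map]
      refine le_trans (List.sum_le_sum ?_) hLq
      intro r hr
      exact hus2 r hr
    -- With `q` blocks in all, the copying reads at most `5 q` blocks and writes `q`; the `q` reads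
    -- of the merge bring the cost to `7 q`.
    have h2 : ∑ i ∈ L.toFinset, (N / (f * p.B) + i.1.length / p.B + 3) ≤
        q + q + 3 * q := by
      refine (sum_toFinset_le L _).trans ?_
      rw [List.sum_map_add, List.sum_map_add, List.map_const', List.map_const',
        List.sum_replicate, List.sum_replicate, smul_eq_mul, smul_eq_mul]
      -- Here the output chunks of `f` blocks matter: there are at most `f` runs, so the chunk
      -- boundaries cost only about one read per output block.
      have e1 : L.length * (N / (f * p.B)) ≤ q := by
        refine le_trans ?_ (div_le_numBlocks hB N)
        rw [Nat.le_div_iff_mul_le hB]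
        calc L.length * (N / (f * p.B)) * p.B ≤ f * (N / (f * p.B)) * p.B := by gcongr
          _ = N / (f * p.B) * (f * p.B) := by ring
          _ ≤ N := Nat.div_mul_le_self _ _
      have e2 : (L.map fun r => r.1.length / p.B).sum ≤ q :=
        (List.sum_le_sum fun r _ => div_le_numBlocks hB _).trans hLq
      have e3 := (length_le_sum_numBlocks hB L hLne).trans hLq
      omega
    rw [hyl] at ht''
    omega

/-- Mergesort of small records that are stored contiguously. -/
theorem Strat.sortSmall (hB : 1 ≤ p.B) {f : ℕ} (hf : 1 ≤ f) (hfM : f * p.B ≤ p.M) (k : ℕ)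
    {R : Set (List (Item S n)) → Conf S n → ℕ → Prop} {Φ : Set (List (Item S n))}
    (hΦ : ∀ σ ∈ Φ, IsListing σ) {d : Disk S n} (hd : FinDisk d) {mem : Finset (Cell S n)} {t : ℕ}
    (xs : List (Item S n)) (hxs : ∀ x ∈ xs, x.isLeft) (hnd : xs.Nodup) {F : ℕ}
    (hst : StoredAt p.w d (F * p.B) xs) (hk : xs.length ≤ f ^ k * p.B)
    (h : ∀ Φ' ⊆ Φ, ∀ mem' d' F' t' ys, FinDisk d' → Extends d d' → ys.Perm xs →
      (∀ σ ∈ Φ', ys.Pairwise (Before σ)) → StoredAt p.w d' (F' * p.B) ys →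
      t' ≤ t + 7 * (k + 1) * numBlocks p.B xs.length → Strat p R Φ' ⟨mem', d'⟩ t') :
    Strat p R Φ ⟨mem, d⟩ t := by
  induction k generalizing R Φ d mem t xs F with
  | zero =>
    rcases Nat.eq_zero_or_pos xs.length with h0 | h0
    · rw [List.length_eq_zero_iff] at h0
      subst h0
      exact h Φ subset_rfl mem d F t [] hd (Extends.refl d) (List.Perm.refl _) (by simp) hst
        (by omega)
    · rw [pow_zero] at hk
      obtain ⟨us, h1, h2, h3⟩ := exists_units 1 hxs hst hk
      have hq : 1 ≤ numBlocks p.B xs.length := one_le_numBlocks hB h0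
      have hvol := vol_eq_length (w := p.w) hxs
      -- The records fit into one block: one read reveals their order, and copying them costs at
      -- most `1 + 1 + 3` reads and the writing, in total at most `7` times the number of blocks.
      refine Strat.load (contiguousCells p.w xs).toFinset ?_ [F] ?_ fun mem' hm => ?_
      · refine (List.toFinset_card_le _).trans ?_
        have : vol p.w xs ≤ p.B := by omega
        exact this.trans ((Nat.le_mul_of_pos_left _ hf).trans hfM)
      · rintro ⟨x, j⟩ hx
        rw [List.mem_toFinset, mem_contiguousCells] at hx
        refine .inr ⟨F, by simp, ?_⟩
        have := hst.itemAt hx.1 j hx.2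
        have h4 := pos_add_le (w := p.w) hx.1
        refine mem_blockCells.2 ⟨pos p.w xs x + j, by omega, ?_⟩
        rwa [← Nat.add_assoc]
      · refine Strat.learn xs (fun x hx j hj => hm (List.mem_toFinset.2
          (mem_contiguousCells.2 ⟨hx, hj⟩))) fun Φ' hΦ' hag => ?_
        rcases Φ'.eq_empty_or_nonempty with rfl | ⟨σ₀, hσ₀⟩
        · exact .empty
        have hl := hΦ σ₀ (hΦ' hσ₀)
        have hyp := sortedBy_perm hl hnd
        have hymem : ∀ x, x ∈ sortedBy σ₀ xs ↔ x ∈ xs := fun x => mem_sortedBy hl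
        have hyv := (vol_perm (w := p.w) hyp).trans hvol
        have hdiv : ∀ x ∈ xs, ∀ j < itemSize p.w x,
            (F * p.B + pos p.w xs x + j) / p.B = F := by
          intro x hx j hj
          have := pos_add_le (w := p.w) hx
          rw [Nat.add_assoc, Nat.mul_comm, Nat.mul_add_div hB, Nat.div_eq_of_lt (by omega),
            Nat.add_zero]
        refine Strat.move hB hf hfM hd (sortedBy σ₀ xs) (nodup_sortedBy xs hl)
          (fun x => F * p.B + pos p.w xs x) (fun x hx => hst.itemAt ((hymem x).1 hx))
          (fun _ => ()) {()} (by simp) (fun _ => F * p.B) (fun _ => 0) (fun _ => xs.length)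
          (fun _ => xs.length) ?_ ?_ ?_ fun mem'' d' F' t'' hd' hext hst' ht'' => ?_
        · intro x hx y hy _ _ j hj
          have hy' := (hymem y).1 hy
          rw [hdiv x ((hymem x).1 hx) j hj]
          exact (hdiv y hy' 0 (by simp [itemSize_of_isLeft (hxs y hy')])).ge
        · intro x hx
          have := pos_add_le (w := p.w) ((hymem x).1 hx)
          omega
        · intro x hx
          have := pos_add_le (w := p.w) hx
          omega
        · refine h Φ' hΦ' mem'' d' F' t'' _ hd' hext hyp
            (fun σ hσ => pairwise_sortedBy hag hσ₀ hl hσ) (storedAt_of_forall hst') ?_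
          rw [hyv, Finset.sum_singleton] at ht''
          have e1 : xs.length / p.B ≤ 1 := by
            rw [← Nat.lt_succ_iff, Nat.div_lt_iff_lt_mul hB]
            omega
          have e2 : xs.length / (f * p.B) ≤ 1 :=
            (Nat.div_le_div_left (Nat.le_mul_of_pos_left _ hf) hB).trans e1
          simp only [List.length_singleton] at ht''
          omega
  | succ k ih =>
    -- The sequence is cut into at most `r` pieces of `f ^ k` blocks, and each is turned into a
    -- sorted run `(records, first block)`.
    have hseq : ∀ (r : ℕ) (R : Set (List (Item S n)) → Conf S n → ℕ → Prop)
        (Φ : Set (List (Item S n))) (_ : ∀ σ ∈ Φ, IsListing σ) (d : Disk S n) (_ : FinDisk d)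
        (mem : Finset (Cell S n)) (t : ℕ) (xs : List (Item S n)) (_ : ∀ x ∈ xs, x.isLeft)
        (_ : xs.Nodup) (F : ℕ) (_ : StoredAt p.w d (F * p.B) xs)
        (_ : xs.length ≤ r * (f ^ k * p.B))
        (_ : ∀ Φ' ⊆ Φ, ∀ (mem' : Finset (Cell S n)) (d' : Disk S n) (t' : ℕ)
          (L : List (List (Item S n) × ℕ)), FinDisk d' → Extends d d' →
          (L.map Prod.fst).flatten.Perm xs → L.length ≤ r → (∀ s ∈ L, s.1 ≠ []) →
          (∀ s ∈ L, ∀ σ ∈ Φ', s.1.Pairwise (Before σ)) →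
          (∀ s ∈ L, StoredAt p.w d' (s.2 * p.B) s.1) →
          (L.map fun s => numBlocks p.B s.1.length).sum ≤ numBlocks p.B xs.length →
          t' ≤ t + 7 * (k + 1) * numBlocks p.B xs.length → Strat p R Φ' ⟨mem', d'⟩ t'),
        Strat p R Φ ⟨mem, d⟩ t := by
      intro r
      induction r with
      | zero =>
        intro R Φ _ d hd mem t xs _ _ F _ hlen h
        rw [Nat.zero_mul, Nat.le_zero, List.length_eq_zero_iff] at hlen
        subst hlen
        exact h Φ subset_rfl mem d t [] hd (Extends.refl d) (List.Perm.refl _) (by simp) (by simp)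
          (by simp) (by simp) (by simp) (by omega)
      | succ r ihr =>
        intro R Φ hΦ d hd mem t xs hxs hnd F hst hlen h
        rcases Nat.eq_zero_or_pos xs.length with h0 | h0
        · rw [List.length_eq_zero_iff] at h0
          subst h0
          exact h Φ subset_rfl mem d t [] hd (Extends.refl d) (List.Perm.refl _) (by simp) (by simp)
            (by simp) (by simp) (by simp) (by omega)
        set m := f ^ k * p.B with hm
        have hm1 : 1 ≤ m := Nat.mul_pos (pow_pos hf k) hB
        have hx1 : ∀ x ∈ xs.take m, x.isLeft := fun x hx => hxs x (List.mem_of_mem_take hx)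
        have hx2 : ∀ x ∈ xs.drop m, x.isLeft := fun x hx => hxs x (List.mem_of_mem_drop hx)
        have hst' := hst
        rw [← List.take_append_drop m xs, storedAt_append] at hst'
        -- The cut is at a block boundary unless the rest is empty, so rounding up to whole blocks
        -- loses nothing.
        have hq : numBlocks p.B (xs.take m).length + numBlocks p.B (xs.drop m).length ≤
            numBlocks p.B xs.length := by
          rw [List.length_take, List.length_drop]
          by_cases hle : xs.length ≤ m
          · rw [min_eq_right hle, Nat.sub_eq_zero_of_le hle]
            have : numBlocks p.B 0 = 0 := Nat.div_eq_of_lt (by omega)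
            omega
          · have e1 := numBlocks_add_mul hB (f ^ k) (xs.length - m)
            have e2 := numBlocks_add_mul hB (f ^ k) 0
            have : numBlocks p.B 0 = 0 := Nat.div_eq_of_lt (by omega)
            rw [← hm] at e1 e2
            rw [Nat.add_sub_cancel' (by omega)] at e1
            rw [min_eq_left (by omega)]
            rw [Nat.add_zero] at e2
            omega
        have hst2 : StoredAt p.w d ((F + f ^ k) * p.B) (xs.drop m) := by
          by_cases hle : xs.length ≤ m
          · rw [List.drop_eq_nil_of_le hle]
            intro j hj
            simp at hj
          · have e := hst'.2
            rw [vol_eq_length hx1, List.length_take, min_eq_left (by omega)] at e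
            rwa [Nat.add_mul]
        refine ih hΦ hd (xs.take m) hx1 (hnd.sublist (List.take_sublist _ _)) hst'.1
          (List.length_take_le _ _) fun Φ' hΦ' mem' d' F' t' ys hd' hext hyp hys hyst ht' => ?_
        refine ihr R Φ' (fun σ hσ => hΦ σ (hΦ' hσ)) d' hd' mem' t' (xs.drop m) hx2
          (hnd.sublist (List.drop_sublist _ _)) (F + f ^ k) (hst2.mono hext) ?_
          fun Φ'' hΦ'' mem'' d'' t'' L hd'' hext' hLp hLr hLne hLs hLst hLq ht'' => ?_
        · rw [List.length_drop]
          rw [Nat.add_mul] at hlen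
          omega
        · refine h Φ'' (hΦ''.trans hΦ') mem'' d'' t'' ((ys, F') :: L) hd'' (hext.trans hext') ?_
            (by simpa using hLr) ?_ ?_ ?_ ?_ ?_
          · have := hyp.append hLp
            rwa [List.take_append_drop] at this
          · rw [List.forall_mem_cons]
            refine ⟨?_, hLne⟩
            rintro hy
            have := hyp.length_eq
            rw [List.length_take, show ys = [] from hy, List.length_nil] at this
            omega
          · rw [List.forall_mem_cons]
            exact ⟨fun σ hσ => hys σ (hΦ'' hσ), hLs⟩
          · rw [List.forall_mem_cons]
            exact ⟨hyst.mono hext', hLst⟩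
          · rw [List.map_cons, List.sum_cons]
            simp only [hyp.length_eq]
            omega
          · have := Nat.mul_le_mul_left (7 * (k + 1)) hq
            rw [Nat.mul_add] at this
            omega
    refine hseq f R Φ hΦ d hd mem t xs hxs hnd F hst (by rwa [← Nat.mul_assoc, ← pow_succ'])
      fun Φ' hΦ' mem' d' t' L hd' hext hLp hLr hLne hLs hLst hLq ht' => ?_
    refine Strat.mergeRuns hB hf hfM (fun σ hσ => hΦ σ (hΦ' hσ)) hd' xs hxs hnd L hLp hLr hLne hLs
      hLst hLq fun Φ'' hΦ'' mem'' d'' F'' t'' ys hd'' hext' hyp hys hyst ht'' => ?_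
    refine h Φ'' (hΦ''.trans hΦ') mem'' d'' F'' t'' ys hd'' (hext.trans hext') hyp hys hyst ?_
    have : 7 * (k + 1 + 1) * numBlocks p.B xs.length = 7 * (k + 1) * numBlocks p.B xs.length +
      7 * numBlocks p.B xs.length := by ring
    omega

end

/-! ### Relabelled and shifted simulation of an algorithm -/

section

variable {S n : ℕ} {p : Params}

/-- The cells, when the records are relabelled by `e`. -/
def relabelCell (e : Equiv.Perm (Item S n)) (c : Cell S n) : Cell S n := (e c.1, c.2)

theorem relabelCell_injective (e : Equiv.Perm (Item S n)) :
    Function.Injective (relabelCell e) := by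
  rintro ⟨x, k⟩ ⟨y, j⟩ h
  simpa [relabelCell] using h

theorem idxOf_map_of_injective {α β : Type*} [BEq α] [LawfulBEq α] [BEq β] [LawfulBEq β]
    {f : α → β} (hf : Function.Injective f) (l : List α) (x : α) :
    (l.map f).idxOf (f x) = l.idxOf x := by
  induction l with
  | nil => rfl
  | cons y l ih =>
    by_cases h : y = x
    · subst h
      simp
    · rw [List.map_cons, List.idxOf_cons_ne _ h, List.idxOf_cons_ne _ (fun h' => h (hf h')), ih]

theorem before_map_apply {e : Equiv.Perm (Item S n)} {σ : List (Item S n)} {x y : Item S n} :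
    Before (σ.map e) (e x) (e y) ↔ Before σ x y := by
  unfold Before
  rw [idxOf_map_of_injective e.injective, idxOf_map_of_injective e.injective]

theorem before_map {e : Equiv.Perm (Item S n)} {σ : List (Item S n)} {x y : Item S n} :
    Before (σ.map e) x y ↔ Before σ (e.symm x) (e.symm y) := by
  conv_lhs => rw [← e.apply_symm_apply x, ← e.apply_symm_apply y]
  exact before_map_apply

theorem IsListing.map {σ : List (Item S n)} (hσ : IsListing σ) (e : Equiv.Perm (Item S n)) :
    IsListing (σ.map e) :=
  ⟨hσ.1.map e.injective, fun x => List.mem_map.2 ⟨e.symm x, hσ.2 _, e.apply_symm_apply x⟩⟩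

theorem itemSize_congr {w : ℕ} {x y : Item S n} (h : x.isLeft = y.isLeft) :
    itemSize w x = itemSize w y := by
  cases x <;> cases y <;> simp_all [itemSize]

theorem contiguousCells_map {w : ℕ} {e : Equiv.Perm (Item S n)}
    (he : ∀ x, (e x).isLeft = x.isLeft) (l : List (Item S n)) :
    contiguousCells w (l.map e) = (contiguousCells w l).map (relabelCell e) := by
  induction l with
  | nil => rfl
  | cons x l ih =>
    rw [List.map_cons, contiguousCells_cons, contiguousCells_cons, List.map_append, ih, itemCells,
      itemCells, itemSize_congr (he x), List.map_map]
    rfl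

theorem blockCells_relabel {B F : ℕ} {e : Equiv.Perm (Item S n)} {d d₁ : Disk S n}
    (hd : ∀ j, d₁ (F * B + j) = (d j).map (relabelCell e)) (b : ℕ) :
    blockCells B d₁ (F + b) = (blockCells B d b).image (relabelCell e) := by
  ext x
  rw [mem_blockCells, Finset.mem_image]
  constructor
  · rintro ⟨j, hj, h⟩
    rw [Nat.add_mul, Nat.add_assoc, hd, Option.map_eq_some_iff] at h
    obtain ⟨y, hy, rfl⟩ := h
    exact ⟨y, mem_blockCells.2 ⟨j, hj, hy⟩, rfl⟩
  · rintro ⟨y, hy, rfl⟩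
    obtain ⟨j, hj, h⟩ := mem_blockCells.1 hy
    exact ⟨j, hj, by rw [Nat.add_mul, Nat.add_assoc, hd, h, Option.map_some]⟩

theorem writeBlock_relabel {B F : ℕ} (hB : 1 ≤ B) {e : Equiv.Perm (Item S n)} {d d₁ : Disk S n}
    (hd : ∀ j, d₁ (F * B + j) = (d j).map (relabelCell e)) (b : ℕ)
    (f : ℕ → Option (Cell S n)) (j : ℕ) :
    writeBlock B d₁ (F + b) (fun o => (f o).map (relabelCell e)) (F * B + j) =
      (writeBlock B d b f j).map (relabelCell e) := by
  unfold writeBlock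
  rw [Nat.mul_comm F B, Nat.mul_add_div hB, Nat.mul_add_mod, Nat.mul_comm B F]
  by_cases h : j / B = b
  · rw [if_pos (by rw [h]), if_pos h]
  · rw [if_neg (by omega), if_neg h, hd]

theorem inMemory_relabel {w : ℕ} {e : Equiv.Perm (Item S n)} (he : ∀ x, (e x).isLeft = x.isLeft)
    {mem : Finset (Cell S n)} {x : Item S n} (h : InMemory w mem x) :
    InMemory w (mem.image (relabelCell e)) (e x) := by
  intro j hj
  rw [itemSize_congr (he x)] at hj
  exact Finset.mem_image.2 ⟨(x, j), h j hj, rfl⟩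

/-- An algorithm can be run on relabelled data in another region of the disk. -/
theorem Strat.simulate (hB : 1 ≤ p.B) {Post : List (Item S n) → ℕ → ℕ → Disk S n → Prop}
    {e : Equiv.Perm (Item S n)} (he : ∀ x, (e x).isLeft = x.isLeft) (F : ℕ) (A : Alg S n)
    {Φ : Set (List (Item S n))} {c : Conf S n} {d₁ : Disk S n} {t : ℕ}
    (h : ∀ σ ∈ Φ, ∃ t' a d, Runs p (σ.map e.symm) A c t' a d ∧ Post σ (t + t') a d)
    (hd : ∀ j, d₁ (F * p.B + j) = (c.disk j).map (relabelCell e)) :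
    Strat p (fun Φ' c' t' => ∃ a d, (∀ j, c'.disk (F * p.B + j) = (d j).map (relabelCell e)) ∧
      ∀ σ ∈ Φ', Post σ t' a d) Φ ⟨c.mem.image (relabelCell e), d₁⟩ t := by
  induction A generalizing Φ c d₁ t with
  | halt a =>
    refine .done ⟨a, c.disk, hd, fun σ hσ => ?_⟩
    obtain ⟨t', a', d, hr, hp⟩ := h σ hσ
    cases hr
    exact hp
  | read b K A ih =>
    -- Legality of a step does not depend on the order, so it is read off from the run on any
    -- surviving order; if there is none, the branch is abandoned.
    rcases Φ.eq_empty_or_nonempty with rfl | ⟨σ₀, hσ₀⟩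
    · exact .empty
    have himg : (c.mem.image (relabelCell e) ∪ blockCells p.B d₁ (F + b)) ∩
        K.image (relabelCell e) =
        ((c.mem ∪ blockCells p.B c.disk b) ∩ K).image (relabelCell e) := by
      rw [blockCells_relabel hd, ← Finset.image_union,
        Finset.image_inter _ _ (relabelCell_injective e)]
    refine .read (F + b) (K.image (relabelCell e)) ?_ ?_
    · dsimp only
      rw [himg, Finset.card_image_of_injective _ (relabelCell_injective e)]
      obtain ⟨t', a, d, hr, hp⟩ := h σ₀ hσ₀
      cases hr with
      | read hmem _ => exact hmem
    · dsimp only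
      rw [himg]
      refine ih (c := ⟨(c.mem ∪ blockCells p.B c.disk b) ∩ K, c.disk⟩) (fun σ hσ => ?_) hd
      obtain ⟨t', a, d, hr, hp⟩ := h σ hσ
      cases hr with
      | read _ hr => exact ⟨_, a, d, hr, by rwa [Nat.add_assoc, Nat.add_comm 1]⟩
  | write b f A ih =>
    rcases Φ.eq_empty_or_nonempty with rfl | ⟨σ₀, hσ₀⟩
    · exact .empty
    refine .write (F + b) (fun o => (f o).map (relabelCell e)) ?_ ?_
    · intro j hj x hx
      obtain ⟨t', a, d, hr, hp⟩ := h σ₀ hσ₀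
      obtain ⟨y, hy, rfl⟩ := Option.map_eq_some_iff.1 hx
      cases hr with
      | write hmem _ => exact Finset.mem_image_of_mem _ (hmem j hj y hy)
    · refine ih (c := ⟨c.mem, writeBlock p.B c.disk b f⟩) (fun σ hσ => ?_)
        (writeBlock_relabel hB hd b f)
      obtain ⟨t', a, d, hr, hp⟩ := h σ hσ
      cases hr with
      | write _ hr => exact ⟨_, a, d, hr, by rwa [Nat.add_assoc, Nat.add_comm 1]⟩
  | compare x y A A' ih ih' =>
    rcases Φ.eq_empty_or_nonempty with rfl | ⟨σ₀, hσ₀⟩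
    · exact .empty
    have hxy : InMemory p.w c.mem x ∧ InMemory p.w c.mem y := by
      obtain ⟨t', a, d, hr, hp⟩ := h σ₀ hσ₀
      cases hr with
      | compare_lt hx hy _ _ => exact ⟨hx, hy⟩
      | compare_not_lt hx hy _ _ => exact ⟨hx, hy⟩
    have hb : ∀ σ : List (Item S n), Before (σ.map e.symm) x y ↔ Before σ (e x) (e y) := by
      intro σ
      rw [before_map, Equiv.symm_symm]
    refine .compare (e x) (e y) (inMemory_relabel he hxy.1) (inMemory_relabel he hxy.2)
      (ih (fun σ hσ => ?_) hd) (ih' (fun σ hσ => ?_) hd)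
    · obtain ⟨t', a, d, hr, hp⟩ := h σ hσ.1
      cases hr with
      | compare_lt _ _ _ hr => exact ⟨t', a, d, hr, hp⟩
      | compare_not_lt _ _ hlt _ => exact absurd ((hb σ).2 hσ.2) hlt
    · obtain ⟨t', a, d, hr, hp⟩ := h σ hσ.1
      cases hr with
      | compare_lt _ _ hlt _ => exact absurd ((hb σ).1 hlt) hσ.2
      | compare_not_lt _ _ _ hr => exact ⟨t', a, d, hr, hp⟩

theorem itemSize_pos {w : ℕ} (hw : 1 ≤ w) (x : Item S n) : 0 < itemSize w x := by
  cases x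
  · exact Nat.one_pos
  · exact hw

/-- As `w ≥ 1`, every record has a first cell, which names it. -/
theorem contiguousCells_injective {w : ℕ} (hw : 1 ≤ w) {l l' : List (Item S n)}
    (h : contiguousCells w l = contiguousCells w l') : l = l' := by
  induction l generalizing l' with
  | nil =>
    cases l' with
    | nil => rfl
    | cons y l' =>
      have := congrArg List.length h
      have := itemSize_pos hw y
      rw [contiguousCells_cons, List.length_append, length_itemCells] at *
      simp at *
      omega
  | cons x l ih =>
    cases l' with
    | nil =>
      have := congrArg List.length h
      have := itemSize_pos hw x
      rw [contiguousCells_cons, List.length_append, length_itemCells] at *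
      simp at *
      omega
    | cons y l' =>
      have hxy : x = y := by
        have := congrArg (·[0]?) h
        simp only [contiguousCells_cons] at this
        rw [List.getElem?_append_left (by rw [length_itemCells]; exact itemSize_pos hw x),
          List.getElem?_append_left (by rw [length_itemCells]; exact itemSize_pos hw y),
          getElem?_itemCells (itemSize_pos hw x), getElem?_itemCells (itemSize_pos hw y)] at this
        simpa using this
      subst hxy
      rw [contiguousCells_cons, contiguousCells_cons] at h
      rw [ih (List.append_cancel_left h)]

theorem IsListing.perm {l l' : List (Item S n)} (h : IsListing l) (h' : IsListing l') :
    l.Perm l' :=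
  (List.perm_ext_iff_of_nodup h.1 h'.1).2 fun x => ⟨fun _ => h'.2 x, fun _ => h.2 x⟩

/-- This makes a leaf of a sorting tree determine the order, and lets all orders that reach one leaf
of a PLE tree share one output. -/
theorem StoredAt.unique {w : ℕ} (hw : 1 ≤ w) {d : Disk S n} {a : ℕ} {l l' : List (Item S n)}
    (hl : IsListing l) (hl' : IsListing l') (h : StoredAt w d a l) (h' : StoredAt w d a l') :
    l = l' := by
  have hlen : (contiguousCells w l).length = (contiguousCells w l').length :=
    vol_perm (hl.perm hl')
  refine contiguousCells_injective hw (List.ext_getElem? fun j => ?_)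
  by_cases hj : j < (contiguousCells w l).length
  · rw [← h j hj, ← h' j (hlen ▸ hj)]
  · rw [List.getElem?_eq_none (by omega), List.getElem?_eq_none (by omega)]

theorem IsListing.length {l : List (Item S n)} (h : IsListing l) : l.length = S + n := by
  rw [← List.toFinset_card_of_nodup h.1]
  have : l.toFinset = Finset.univ := by
    ext x
    simp [h.2 x]
  rw [this, Finset.card_univ, Fintype.card_sum, Fintype.card_fin, Fintype.card_fin]

/-- The PLE algorithm expects small record `i` in place `i`. Lists with the same pattern of small
and large are matched place by place. -/
theorem exists_relabelling {l l' : List (Item S n)} (h : IsListing l) (h' : IsListing l')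
    (hll : l.map (fun x => x.isLeft) = l'.map (fun x => x.isLeft)) :
    ∃ e : Equiv.Perm (Item S n), l.map e = l' ∧ ∀ x, (e x).isLeft = x.isLeft := by
  have hlen : l.length = l'.length := by rw [h.length, h'.length]
  let e : Equiv.Perm (Item S n) := (h.1.getEquivOfForallMemList l h.2).symm.trans
    ((finCongr hlen).trans (h'.1.getEquivOfForallMemList l' h'.2))
  have he : ∀ i (hi : i < l.length), e l[i] = l'[i] := by
    intro i hi
    have : (h.1.getEquivOfForallMemList l h.2).symm l[i] = ⟨i, hi⟩ := by
      rw [Equiv.symm_apply_eq]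
      rfl
    simp only [e, Equiv.trans_apply, this]
    rfl
  refine ⟨e, ?_, fun x => ?_⟩
  · refine List.ext_getElem (by simpa using hlen) fun i hi hi' => ?_
    rw [List.getElem_map]
    exact he i _
  · obtain ⟨i, hi, rfl⟩ := List.mem_iff_getElem.1 (h.2 x)
    rw [he i hi]
    have := congrArg (·[i]?) hll
    simpa [hi, hlen ▸ hi] using this.symm

theorem isListing_pleLayout : IsListing (pleLayout S n) := by
  refine ⟨?_, ?_⟩
  · refine List.Nodup.append ((List.nodup_finRange S).map Sum.inl_injective)
      ((List.nodup_finRange n).map Sum.inr_injective) ?_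
    intro x hx hy
    obtain ⟨i, _, rfl⟩ := List.mem_map.1 hx
    obtain ⟨j, _, h⟩ := List.mem_map.1 hy
    cases h
  · rintro (i | j) <;> simp [pleLayout]

theorem idxOf_pleLayout_inl (i : Fin S) : (pleLayout S n).idxOf (.inl i) = i := by
  rw [pleLayout, List.idxOf_append_of_mem (by simp),
    idxOf_map_of_injective Sum.inl_injective, List.idxOf_finRange]

theorem pos_pleLayout_inl {w : ℕ} (i : Fin S) : pos w (pleLayout S n) (.inl i) = i := by
  rw [pos, idxOf_pleLayout_inl, pleLayout, List.take_append_of_le_length (by simp), vol_eq_length]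
  · simp
  · intro x hx
    obtain ⟨j, _, rfl⟩ := List.mem_map.1 (List.mem_of_mem_take hx)
    rfl

theorem IsPLEOutput.map {σ out : List (Item S n)} {e : Equiv.Perm (Item S n)}
    (he : ∀ x, (e x).isLeft = x.isLeft) (h : IsPLEOutput (σ.map e.symm) out) :
    IsPLEOutput σ (out.map e) := by
  refine ⟨h.1.map e, ?_⟩
  rw [List.pairwise_map]
  refine h.2.imp fun {x y} hxy => ?_
  have hb : ∀ x y : Item S n, Before (σ.map e.symm) x y ↔ Before σ (e x) (e y) := by
    intro x y
    rw [before_map, Equiv.symm_symm]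
  have hR : ∀ x, (e x).isRight = x.isRight := by
    intro x
    have := he x
    cases h : e x <;> cases x <;> simp_all
  rcases hxy with hxy | ⟨h1, h2, h3⟩
  · exact .inl ((hb x y).1 hxy)
  · refine .inr ⟨by rwa [hR], by rwa [hR], fun i => ?_⟩
    obtain ⟨z, hz⟩ := e.surjective (.inl i)
    have hzl : z.isLeft := by rw [← he, hz]; rfl
    obtain ⟨i', rfl⟩ := Sum.isLeft_iff.1 hzl
    rw [← hz]
    have := h3 i'
    rwa [hb, hb, hb, hb] at this

end

/-! ### Stripes -/

/-- Hence stripe sizes depend only on the pattern of small and large records, which relabelling and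
PLE outputs preserve. -/
theorem map_length_splitOnP {α β : Type*} (P : α → Bool) (Q : β → Bool) (l : List α)
    (l' : List β) (h : l.map P = l'.map Q) :
    (l.splitOnP P).map List.length = (l'.splitOnP Q).map List.length := by
  induction l generalizing l' with
  | nil =>
    rw [List.map_nil, eq_comm, List.map_eq_nil_iff] at h
    rw [h]
    rfl
  | cons x l ih =>
    cases l' with
    | nil => simp at h
    | cons y l' =>
      rw [List.map_cons, List.map_cons, List.cons.injEq] at h
      have := ih l' h.2
      rw [List.splitOnP_cons_eq_if_modifyHead, List.splitOnP_cons_eq_if_modifyHead, h.1]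
      split_ifs
      · simp [this]
      · obtain ⟨c, cs, hc⟩ := List.exists_cons_of_ne_nil (List.splitOnP_ne_nil P l)
        obtain ⟨c', cs', hc'⟩ := List.exists_cons_of_ne_nil (List.splitOnP_ne_nil Q l')
        rw [hc, hc'] at this ⊢
        simpa using this

theorem mem_of_mem_splitOnP {α : Type*} {P : α → Bool} {l c : List α} (hc : c ∈ l.splitOnP P)
    {x : α} (hx : x ∈ c) : x ∈ l ∧ P x = false := by
  induction l generalizing c with
  | nil =>
    simp only [List.splitOnP_nil, List.mem_singleton] at hc
    simp [hc] at hx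
  | cons a l ih =>
    rw [List.splitOnP_cons_eq_if_modifyHead] at hc
    split_ifs at hc with h
    · rcases List.mem_cons.1 hc with rfl | hc
      · cases hx
      · exact ⟨List.mem_cons_of_mem _ (ih hc hx).1, (ih hc hx).2⟩
    · obtain ⟨b, bs, hb⟩ := List.exists_cons_of_ne_nil (List.splitOnP_ne_nil P l)
      rw [hb, List.modifyHead_cons, List.mem_cons] at hc
      rcases hc with rfl | hc
      · rcases List.mem_cons.1 hx with rfl | hx
        · exact ⟨by simp, by simpa using h⟩
        · have := ih (c := b) (by simp [hb]) hx
          exact ⟨List.mem_cons_of_mem _ this.1, this.2⟩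
      · have := ih (c := c) (by simp [hb, hc]) hx
        exact ⟨List.mem_cons_of_mem _ this.1, this.2⟩

theorem mem_head_splitOnP {α : Type*} {P : α → Bool} {r : α → α → Prop} {l : List α}
    (hr : l.Pairwise r) {c : List α} {cs : List (List α)} (hc : l.splitOnP P = c :: cs) {y : α}
    (hy : y ∈ l) : y ∈ c ∨ P y ∨ ∃ i ∈ l, P i ∧ r i y := by
  induction l generalizing c cs with
  | nil => cases hy
  | cons b l ih =>
    rw [List.splitOnP_cons_eq_if_modifyHead] at hc
    rw [List.pairwise_cons] at hr
    split_ifs at hc with h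
    · rcases List.mem_cons.1 hy with rfl | hy
      · exact .inr (.inl h)
      · exact .inr (.inr ⟨b, by simp, h, hr.1 y hy⟩)
    · obtain ⟨c', cs', hc'⟩ := List.exists_cons_of_ne_nil (List.splitOnP_ne_nil P l)
      rw [hc', List.modifyHead_cons, List.cons.injEq] at hc
      obtain ⟨rfl, rfl⟩ := hc
      rcases List.mem_cons.1 hy with rfl | hy
      · exact .inl (by simp)
      · rcases ih hr.2 hc' hy with h' | h' | ⟨i, h1, h2, h3⟩
        · exact .inl (List.mem_cons_of_mem _ h')
        · exact .inr (.inl h')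
        · exact .inr (.inr ⟨i, List.mem_cons_of_mem _ h1, h2, h3⟩)

/-- Two elements in different pieces are separated by an element satisfying `P`. Applied to a PLE
output, a small record settles the order of large ones in different stripes. -/
theorem pairwise_splitOnP {α : Type*} {P : α → Bool} {r : α → α → Prop} {l : List α}
    (hr : l.Pairwise r) : l.Pairwise fun x y => (∃ c ∈ l.splitOnP P, x ∈ c ∧ y ∈ c) ∨
      P x ∨ P y ∨ ∃ i, P i ∧ r x i ∧ r i y := by
  induction l with
  | nil => exact List.Pairwise.nil
  | cons a l ih =>
    have hr' := List.pairwise_cons.1 hr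
    have hsub : ∀ c ∈ l.splitOnP P, ∃ c' ∈ (a :: l).splitOnP P, ∀ x ∈ c, x ∈ c' := by
      intro c hc
      rw [List.splitOnP_cons_eq_if_modifyHead]
      split_ifs with h
      · exact ⟨c, by simp [hc], fun _ h => h⟩
      · obtain ⟨b, bs, hb⟩ := List.exists_cons_of_ne_nil (List.splitOnP_ne_nil P l)
        rw [hb] at hc ⊢
        rw [List.modifyHead_cons]
        rcases List.mem_cons.1 hc with rfl | hc
        · exact ⟨a :: c, by simp, fun x hx => List.mem_cons_of_mem _ hx⟩
        · exact ⟨c, by simp [hc], fun _ h => h⟩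
    rw [List.pairwise_cons]
    refine ⟨fun y hy => ?_, (ih hr'.2).imp fun {x y} h => ?_⟩
    · by_cases h : P a
      · exact .inr (.inl h)
      · obtain ⟨b, bs, hb⟩ := List.exists_cons_of_ne_nil (List.splitOnP_ne_nil P l)
        rcases mem_head_splitOnP hr'.2 hb hy with h' | h' | ⟨i, h1, h2, h3⟩
        · refine .inl ⟨a :: b, ?_, by simp, List.mem_cons_of_mem _ h'⟩
          rw [List.splitOnP_cons_eq_if_modifyHead, if_neg h, hb]
          simp
        · exact .inr (.inr (.inl h'))
        · exact .inr (.inr (.inr ⟨i, h2, hr'.1 i h1, h3⟩))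
    · rcases h with ⟨c, hc, hx, hy⟩ | h
      · obtain ⟨c', hc', h'⟩ := hsub c hc
        exact .inl ⟨c', hc', h' x hx, h' y hy⟩
      · exact .inr h

section

variable {S n : ℕ}

theorem stripeSizes_congr {σ σ' : List (Item S n)}
    (h : σ.map (fun x => x.isLeft) = σ'.map (fun x => x.isLeft)) :
    stripeSizes σ = stripeSizes σ' := by
  unfold stripeSizes
  rw [map_length_splitOnP _ _ _ _ h]

theorem stripeSizes_map {σ : List (Item S n)} {e : Equiv.Perm (Item S n)}
    (he : ∀ x, (e x).isLeft = x.isLeft) : stripeSizes (σ.map e) = stripeSizes σ := by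
  refine stripeSizes_congr ?_
  rw [List.map_map]
  exact List.map_congr_left fun x _ => he x

theorem sum_map_splitOnP (σ : List (Item S n)) (g : ℕ → ℕ) (hg : g 0 = 0) :
    ((σ.splitOnP fun x => x.isLeft).map fun c => g c.length).sum = ((stripeSizes σ).map g).sum := by
  unfold stripeSizes
  induction (σ.splitOnP fun x => x.isLeft) with
  | nil => rfl
  | cons c cs ih =>
    rw [List.map_cons, List.map_cons, List.sum_cons, ih, List.filter_cons]
    split_ifs with h
    · simp
    · simp only [ne_eq, decide_not, Bool.not_eq_true', decide_eq_false_iff_not, not_not] at h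
      rw [h, hg, Nat.zero_add]

instance (σ : List (Item S n)) (x y : Item S n) : Decidable (Before σ x y) :=
  inferInstanceAs (Decidable (_ < _))

theorem card_before {σ : List (Item S n)} (hσ : IsListing σ) (x : Item S n) :
    (Finset.univ.filter fun y => Before σ y x).card = σ.idxOf x := by
  rw [show (Finset.univ.filter fun y => Before σ y x) = (σ.take (σ.idxOf x)).toFinset from ?_]
  · rw [List.toFinset_card_of_nodup (hσ.1.sublist (List.take_sublist _ _)), List.length_take,
      min_eq_left (List.idxOf_le_length)]
  · ext y
    rw [List.mem_toFinset, Finset.mem_filter, List.mem_take_iff_idxOf_lt (hσ.2 y)]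
    simp [Before]

theorem IsPLEOutput.before_of {σ out : List (Item S n)} (h : IsPLEOutput σ out)
    {x y : Item S n} (hx : x.isLeft ∨ y.isLeft) (hb : Before out x y) : Before σ x y := by
  rcases pairwise_of_before h.2 (h.1.2 y) hb with h' | h'
  · exact h'
  · have := h'.1
    have := h'.2.1
    cases x <;> cases y <;> simp_all

/-- A small record has the same predecessors in the output as in `σ`, hence the same index. So the
stripes of the output have the sizes of those of `σ`. -/
theorem IsPLEOutput.map_isLeft {σ out : List (Item S n)} (hσ : IsListing σ)
    (h : IsPLEOutput σ out) : out.map (fun x => x.isLeft) = σ.map (fun x => x.isLeft) := by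
  have hiff : ∀ (i : Fin S) (x : Item S n), Before out x (.inl i) ↔ Before σ x (.inl i) := by
    intro i x
    refine ⟨fun hb => h.before_of (.inr rfl) hb, fun hb => ?_⟩
    have hne : x ≠ .inl i := by rintro rfl; exact before_irrefl _ _ hb
    rcases h.1.before_or hne with h' | h'
    · exact h'
    · exact absurd hb (h.before_of (.inl rfl) h').asymm
  have hidx : ∀ i : Fin S, out.idxOf (.inl i) = σ.idxOf (.inl i) := by
    intro i
    rw [← card_before h.1, ← card_before hσ]
    simp only [hiff]
  have hone : ∀ {l l' : List (Item S n)}, IsListing l → IsListing l' →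
      (∀ i : Fin S, l.idxOf (.inl i) = l'.idxOf (.inl i)) → ∀ k (hk : k < l.length)
      (hk' : k < l'.length), l[k].isLeft → l'[k].isLeft := by
    intro l l' hl hl' hll k hk hk' hkl
    obtain ⟨i, hi⟩ := Sum.isLeft_iff.1 hkl
    have h1 : l.idxOf (.inl i) = k := by rw [← hi, hl.1.idxOf_getElem]
    rw [hll i] at h1
    have h2 := List.getElem_idxOf (List.idxOf_lt_length_iff.2 (hl'.2 (.inl i)))
    simp only [h1] at h2
    rw [h2]
    rfl
  refine List.ext_getElem ?_ fun k hk hk' => ?_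
  · rw [List.length_map, List.length_map, h.1.length, hσ.length]
  · rw [List.getElem_map, List.getElem_map, Bool.eq_iff_iff]
    rw [List.length_map] at hk hk'
    exact ⟨hone h.1 hσ hidx k hk hk', hone hσ h.1 (fun i => (hidx i).symm) k hk' hk⟩

theorem eq_of_agree {Φ : Set (List (Item S n))} (hΦ : ∀ σ ∈ Φ, IsListing σ)
    (h : Agree Φ Set.univ) {σ σ' : List (Item S n)} (hσ : σ ∈ Φ) (hσ' : σ' ∈ Φ) : σ = σ' := by
  have hl := hΦ σ hσ
  have hl' := hΦ σ' hσ'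
  refine List.Perm.eq_of_pairwise (le := Before σ') ?_ ?_ hl'.pairwise (hl.perm hl')
  · exact fun a b _ _ h h' => absurd h' h.asymm
  · exact hl.pairwise.imp fun {x y} hxy => h σ hσ σ' hσ' x trivial y trivial hxy

end

/-! ### The sorting algorithm -/

section

variable {S n : ℕ} {p : Params}

/-- An interval of at most `w` cells meets at most `w / B + 2` blocks, wherever it begins. -/
theorem ItemAt.unitAt (hB : 1 ≤ p.B) (hBw : p.B ≤ p.w) {d : Disk S n} {x : Item S n} {a : ℕ}
    (h : ItemAt p.w d x a) : UnitAt p d (p.w / p.B + 2) p.w [x] := by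
  have hx : itemSize p.w x ≤ p.w := by
    cases x
    · exact hB.trans hBw
    · exact le_rfl
  refine ⟨by simpa [vol_cons] using hx, (List.range (p.w / p.B + 2)).map (a / p.B + ·), by simp,
    ?_⟩
  intro y hy k hk
  rw [List.mem_singleton] at hy
  subst hy
  refine ⟨(a + k) / p.B, ?_, h.mem_blockCells hB hk⟩
  rw [List.mem_map]
  have h1 : a / p.B ≤ (a + k) / p.B := Nat.div_le_div_right (by omega)
  refine ⟨(a + k) / p.B - a / p.B, ?_, by omega⟩
  have h2 : (a + k) / p.B < a / p.B + (p.w / p.B + 2) := by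
    rw [Nat.div_lt_iff_lt_mul hB]
    have := Nat.lt_div_mul_add (a := a) hB
    have := Nat.lt_div_mul_add (a := p.w) hB
    have e : (a / p.B + (p.w / p.B + 2)) * p.B =
      a / p.B * p.B + p.w / p.B * p.B + p.B + p.B := by ring
    omega
  rw [List.mem_range]
  omega

theorem vol_listing {w : ℕ} {l : List (Item S n)} (hl : IsListing l) : vol w l = S + n * w := by
  rw [vol_perm (hl.perm isListing_pleLayout), pleLayout, vol_append, vol_eq_length]
  · have : ∀ m : List (Fin n), vol w (m.map (Sum.inr : Fin n → Item S n)) = m.length * w := by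
      intro m
      induction m with
      | nil => simp
      | cons x m ih =>
        rw [List.map_cons, vol_cons, ih, List.length_cons]
        simp only [itemSize]
        ring
    rw [this]
    simp
  · intro x hx
    obtain ⟨j, _, rfl⟩ := List.mem_map.1 hx
    rfl

/-- The final copying of the records, when their order is known. -/
theorem Strat.finish (hB : 1 ≤ p.B) (hBw : p.B ≤ p.w) (hM : p.B ≤ p.M)
    {R : Set (List (Item S n)) → Conf S n → ℕ → Prop} {Φ : Set (List (Item S n))}
    {d : Disk S n} (hd : FinDisk d) {mem : Finset (Cell S n)} {t a : ℕ} {o τ : List (Item S n)}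
    (ho : IsListing o) (hτ : IsListing τ) (hst : StoredAt p.w d a o)
    (hsm : ∀ i j : Fin S, Before τ (.inl i) (.inl j) → Before o (.inl i) (.inl j))
    (h : ∀ mem' d' a' t', StoredAt p.w d' a' τ →
      t' ≤ t + (8 * ((S + n * p.w) / p.B) + 4) → Strat p R Φ ⟨mem', d'⟩ t') :
    Strat p R Φ ⟨mem, d⟩ t := by
  have hvo := vol_listing (w := p.w) ho
  have hvτ := vol_listing (w := p.w) hτ
  set V := S + n * p.w with hV
  -- All small records form the class `none`, as they are already in sorted order; every large
  -- record is a class by itself.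
  refine Strat.move hB le_rfl (by rwa [Nat.one_mul]) hd τ hτ.1 (fun x => a + pos p.w o x)
    (fun x _ => hst.itemAt (ho.2 x)) (fun x : Item S n => x.getRight?) Finset.univ (by simp)
    (fun i => i.elim a fun j => a + pos p.w o (.inr j))
    (fun i => i.elim 0 fun j => pos p.w τ (.inr j))
    (fun i => i.elim V fun _ => p.w) (fun i => i.elim V fun _ => p.w) ?_ ?_ ?_
    fun mem' d' F t' _ _ hst' ht' => h mem' d' _ t' (storedAt_of_forall hst') ?_
  · rintro (i | i) hx (j | j) hy hij hb k hk
    · have := pos_add_le_pos (w := p.w) (ho.2 (.inl i)) (hsm i j hb)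
      exact Nat.div_le_div_right (by omega)
    · cases hij
    · cases hij
    · obtain rfl : i = j := by simpa using hij
      exact absurd hb (before_irrefl _ _)
  · rintro (i | i) -
    · have := pos_add_le (w := p.w) (ho.2 (.inl i))
      simp only [Sum.getRight?_inl, Option.elim_none]
      omega
    · simp only [Sum.getRight?_inr, Option.elim_some, itemSize]
      omega
  · rintro (i | i) -
    · have := pos_add_le (w := p.w) (hτ.2 (.inl i))
      simp only [Sum.getRight?_inl, Option.elim_none]
      omega
    · simp only [Sum.getRight?_inr, Option.elim_some, itemSize]
      omega
  · rw [hvτ, Nat.one_mul] at ht'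
    rw [Fintype.sum_option] at ht'
    simp only [Option.elim_none, Option.elim_some, Finset.sum_const, Finset.card_univ,
      Fintype.card_fin, smul_eq_mul] at ht'
    have h1 := numBlocks_le (B := p.B) V
    -- With `n ≤ n * (w / B)`, which needs `B ≤ w`, the large classes cost at most `5 (V / B)`
    -- reads. The small class adds `2 (V / B) + 3`, the writing `V / B + 1`.
    have h2 : n * (p.w / p.B) ≤ V / p.B := by
      rw [Nat.le_div_iff_mul_le hB, Nat.mul_assoc]
      have := Nat.mul_le_mul_left n (Nat.div_mul_le_self p.w p.B)
      omega
    have h3 : n ≤ n * (p.w / p.B) :=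
      Nat.le_mul_of_pos_right _ (Nat.div_pos hBw hB)
    have h4 : n * (p.w / p.B + p.w / p.B + 3) = n * (p.w / p.B) + n * (p.w / p.B) + 3 * n := by
      ring
    omega

/-- From any initial order, one can store the small records in sorted order, followed by the large
ones. -/
theorem Strat.prepare (hB : 1 ≤ p.B) {f k : ℕ} (hf : 1 ≤ f) (hfM : f * p.B ≤ p.M)
    (hk : S ≤ f ^ k * p.B) {R : Set (List (Item S n)) → Conf S n → ℕ → Prop}
    {Φ : Set (List (Item S n))} (hΦ : ∀ σ ∈ Φ, IsListing σ) {l : List (Item S n)}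
    (hl : IsListing l)
    (h : ∀ Φ' ⊆ Φ, ∀ mem' d' F t' (e : Equiv.Perm (Item S n)), FinDisk d' →
      (∀ x, (e x).isLeft = x.isLeft) → (∀ σ ∈ Φ', SmallSorted (σ.map e.symm)) →
      (∀ j, d' (F * p.B + j) = (contiguousCells p.w ((pleLayout S n).map e))[j]?) →
      t' ≤ 8 * ((S + n * p.w) / p.B) + 11 + 7 * (k + 1) * numBlocks p.B S →
      Strat p R Φ' ⟨mem', d'⟩ t') :
    Strat p R Φ (start p.w l) 0 := by
  have hBM : 1 * p.B ≤ p.M := (Nat.mul_le_mul_right _ hf).trans hfM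
  have hvl := vol_listing (w := p.w) hl
  set V := S + n * p.w with hV
  set xs := l.filter fun x => x.isLeft with hxs
  set zs := l.filter fun x => !x.isLeft with hzs
  have hxl : ∀ x ∈ xs, x.isLeft := fun x hx => (List.mem_filter.1 hx).2
  have hzl : ∀ x ∈ zs, x.isLeft = false := fun x hx => by simpa using (List.mem_filter.1 hx).2
  have hxnd : xs.Nodup := hl.1.filter _
  have hxlen : xs.length = S := by
    have h1 : (pleLayout S n).filter (fun x => x.isLeft) = (List.finRange S).map Sum.inl := by
      rw [pleLayout, List.filter_append, List.filter_eq_self.2, List.filter_eq_nil_iff.2,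
        List.append_nil] <;> simp
    rw [hxs, ((hl.perm isListing_pleLayout).filter _).length_eq, h1]
    simp
  have hst0 : StoredAt p.w (start p.w l : Conf S n).disk 0 l := by
    intro j hj
    rw [Nat.zero_add]
    rfl
  have hd0 : FinDisk (start p.w l : Conf S n).disk :=
    ⟨(contiguousCells p.w l).length, fun a ha => List.getElem?_eq_none ha⟩
  have hitem0 : ∀ x, ItemAt p.w (start p.w l : Conf S n).disk x (pos p.w l x) := by
    intro x
    have := hst0.itemAt (hl.2 x)
    rwa [Nat.zero_add] at this
  have hfil : ∀ (q : Item S n → Bool) (x y : Item S n), y ∈ l.filter q →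
      Before (l.filter q) x y → pos p.w l x + itemSize p.w x ≤ pos p.w l y := fun q x y hy hb =>
    pos_add_le_pos (hl.2 x) (pairwise_of_before (hl.pairwise.filter q) hy hb)
  have hxv : vol p.w xs = S := by rw [vol_eq_length hxl, hxlen]
  -- The small records are extracted in their initial order, so a single class suffices.
  refine Strat.move hB le_rfl hBM hd0 xs hxnd (pos p.w l) (fun x _ => hitem0 x)
    (fun _ => ()) {()} (by simp) (fun _ => 0) (fun _ => 0) (fun _ => V) (fun _ => V) ?_ ?_ ?_
    fun mem₁ d₁ F₁ t₁ hd₁ hext₁ hst₁ ht₁ => ?_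
  · intro x hx y hy _ hb k hk
    have := hfil _ x y hy hb
    exact Nat.div_le_div_right (by omega)
  · intro x hx
    have := pos_add_le (w := p.w) (hl.2 x)
    omega
  · intro x hx
    have := pos_add_le (w := p.w) hx
    omega
  refine Strat.sortSmall hB hf hfM k hΦ hd₁ xs hxl hxnd (storedAt_of_forall hst₁)
    (by rwa [hxlen]) fun Φ' hΦ' mem₂ d₂ F₂ t₂ ys hd₂ hext₂ hyp hys hst₂ ht₂ => ?_
  have hyl : ∀ y ∈ ys, y.isLeft := fun y hy => hxl y (hyp.mem_iff.1 hy)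
  have hτ : IsListing (ys ++ zs) := by
    refine ⟨List.Nodup.append (hyp.nodup_iff.2 hxnd) (hl.1.filter _) ?_, fun x => ?_⟩
    · intro x hx hx'
      have h1 := hyl x hx
      rw [hzl x hx'] at h1
      cases h1
    · rw [List.mem_append, hyp.mem_iff, hxs, hzs, List.mem_filter, List.mem_filter]
      cases x <;> simp [hl.2]
  have hpos1 : ∀ x ∈ ys, ∀ y, Before (ys ++ zs) x y → y ∈ ys → Before ys x y := by
    intro x hx y hb hy
    unfold Before at hb ⊢
    rwa [List.idxOf_append_of_mem hx, List.idxOf_append_of_mem hy] at hb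
  have hvτ : vol p.w (ys ++ zs) = V := vol_listing hτ
  have hvy : vol p.w ys = S := by rw [vol_perm hyp, hxv]
  -- The large records are still at their initial addresses, since nothing was overwritten. There
  -- are two classes: the sorted small records and the large ones in initial order.
  refine Strat.move hB le_rfl hBM hd₂ (ys ++ zs) hτ.1
    (fun x => if x.isLeft then F₂ * p.B + pos p.w ys x else pos p.w l x) (fun x hx => ?_)
    (fun x : Item S n => x.isLeft) Finset.univ (by simp)
    (fun b => if b then F₂ * p.B else 0) (fun _ => 0) (fun _ => V) (fun _ => V) ?_ ?_ ?_
    fun mem₃ d₃ F₃ t₃ hd₃ hext₃ hst₃ ht₃ => ?_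
  · rcases List.mem_append.1 hx with hx | hx
    · rw [if_pos (hyl x hx)]
      exact hst₂.itemAt hx
    · rw [if_neg (by simp [hzl x hx])]
      exact (hitem0 x).mono (hext₁.trans hext₂)
  · intro x hx y hy hxy hb k hk
    rcases List.mem_append.1 hx with hx | hx
    · have hyy : y ∈ ys := by
        refine (List.mem_append.1 hy).resolve_right fun hy => ?_
        rw [hyl x hx, hzl y hy] at hxy
        cases hxy
      rw [if_pos (hyl x hx), if_pos (hyl y hyy)]
      have := pos_add_le_pos (w := p.w) hx (hpos1 x hx y hb hyy)
      exact Nat.div_le_div_right (by omega)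
    · have hyz : y ∈ zs := by
        refine (List.mem_append.1 hy).resolve_left fun hy => ?_
        rw [hyl y hy, hzl x hx] at hxy
        cases hxy
      rw [if_neg (by simp [hzl x hx]), if_neg (by simp [hzl y hyz])]
      have hb' : Before zs x y := by
        have hnot : ∀ z ∈ zs, z ∉ ys := fun z hz hz' => by
          have := hyl z hz'
          rw [hzl z hz] at this
          cases this
        unfold Before at hb ⊢
        rw [List.idxOf_append_of_notMem (hnot x hx), List.idxOf_append_of_notMem (hnot y hyz)] at hb
        omega
      have := hfil _ x y hyz hb'
      exact Nat.div_le_div_right (by omega)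
  · intro x hx
    rcases List.mem_append.1 hx with hx | hx
    · have := pos_add_le (w := p.w) hx
      rw [if_pos (hyl x hx), hyl x hx, if_pos rfl]
      omega
    · have := pos_add_le (w := p.w) (hl.2 x)
      rw [if_neg (by simp [hzl x hx]), hzl x hx, if_neg (by simp)]
      omega
  · intro x hx
    have := pos_add_le (w := p.w) hx
    omega
  · have hmapL : ∀ (l : List (Item S n)) (b : Bool), (∀ x ∈ l, x.isLeft = b) →
        l.map (fun x => x.isLeft) = List.replicate l.length b := by
      intro l b hb
      rw [List.eq_replicate_iff, List.length_map]
      refine ⟨rfl, fun c hc => ?_⟩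
      obtain ⟨x, hx, rfl⟩ := List.mem_map.1 hc
      exact hb x hx
    -- Both lists consist of `S` small records followed by `n` large ones.
    obtain ⟨e, he, hel⟩ := exists_relabelling (isListing_pleLayout (S := S) (n := n)) hτ (by
      have e1 : ys.length = S := by rw [hyp.length_eq, hxlen]
      have e2 : zs.length = n := by
        have := hτ.length
        rw [List.length_append] at this
        omega
      rw [List.map_append, hmapL ys true hyl, hmapL zs false hzl, e1, e2, pleLayout,
        List.map_append, hmapL _ true (by simp), hmapL _ false (by simp)]
      simp)
    refine h Φ' hΦ' mem₃ d₃ F₃ t₃ e hd₃ hel (fun σ hσ i j hij => ?_) (by rwa [he]) ?_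
    · rw [before_map, Equiv.symm_symm]
      have hmem : ∀ i : Fin S, e (.inl i) ∈ ys := by
        intro i
        refine (List.mem_append.1 (hτ.2 (e (.inl i)))).resolve_right fun hz => ?_
        have := hzl _ hz
        rw [hel] at this
        cases this
      have hb : Before (pleLayout S n) (.inl i) (.inl j) := by
        unfold Before
        rw [idxOf_pleLayout_inl, idxOf_pleLayout_inl]
        exact hij
      rw [← before_map_apply (e := e), he] at hb
      exact pairwise_of_before (hys σ hσ) (hmem j) (hpos1 _ (hmem i) _ hb (hmem j))
    · rw [hvτ, Nat.one_mul] at ht₃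
      rw [Fintype.sum_bool] at ht₃
      rw [Finset.sum_singleton, hxv, Nat.one_mul] at ht₁
      rw [hxlen] at ht₂
      have h1 := numBlocks_le (B := p.B) V
      have h2 := numBlocks_mono p.B (show S ≤ V by omega)
      omega

/-- The large records are sorted within their stripes. -/
theorem Strat.sortStripes (hB : 1 ≤ p.B) (hBw : p.B ≤ p.w) {f : ℕ} (hfM : f * p.w ≤ p.M)
    {g : ℕ → ℕ} (hg : ∀ m, m ≤ f ^ g m) {R : Set (List (Item S n)) → Conf S n → ℕ → Prop}
    {Φ : Set (List (Item S n))} (hΦ : ∀ σ ∈ Φ, IsListing σ) {d : Disk S n}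
    {mem : Finset (Cell S n)} {t a : ℕ} {o : List (Item S n)} (hst : StoredAt p.w d a o)
    (ho : ∀ σ ∈ Φ, IsPLEOutput σ o)
    (h : ∀ Φ' ⊆ Φ, ∀ mem' t', Agree Φ' Set.univ →
      t' ≤ t + ((stripeSizes o).map fun m => (p.w / p.B + 2) * (g m * m)).sum →
      Strat p R Φ' ⟨mem', d⟩ t') :
    Strat p R Φ ⟨mem, d⟩ t := by
  have hseq : ∀ (cs : List (List (Item S n))) (Φ : Set (List (Item S n)))
      (_ : ∀ σ ∈ Φ, IsListing σ) (mem : Finset (Cell S n)) (t : ℕ)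
      (_ : ∀ c ∈ cs, ∀ x ∈ c, x ∈ o)
      (_ : ∀ Φ' ⊆ Φ, ∀ mem' t', (∀ c ∈ cs, Agree Φ' {x | x ∈ c}) →
        t' ≤ t + (cs.map fun c => (p.w / p.B + 2) * (g c.length * c.length)).sum →
        Strat p R Φ' ⟨mem', d⟩ t'), Strat p R Φ ⟨mem, d⟩ t := by
    intro cs
    induction cs with
    | nil => exact fun Φ _ mem t _ hR => hR Φ subset_rfl mem t (by simp) (by simp)
    | cons c cs ih =>
      intro Φ hΦ mem t hcs hR
      rw [List.forall_mem_cons] at hcs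
      refine Strat.sortKnowledge hfM (g c.length) hΦ c
        (fun x hx => (hst.itemAt (hcs.1 x hx)).unitAt hB hBw) (hg _)
        fun Φ' hΦ' mem' t' ht' hag => ?_
      refine ih Φ' (fun σ hσ => hΦ σ (hΦ' hσ)) mem' t' hcs.2 fun Φ'' hΦ'' mem'' t'' hag' ht'' => ?_
      refine hR Φ'' (hΦ''.trans hΦ') mem'' t'' ?_ ?_
      · rw [List.forall_mem_cons]
        exact ⟨hag.mono hΦ'' subset_rfl, hag'⟩
      · rw [List.map_cons, List.sum_cons]
        omega
  refine hseq (o.splitOnP fun x => x.isLeft) Φ hΦ mem t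
    (fun c hc x hx => (mem_of_mem_splitOnP hc hx).1) fun Φ' hΦ' mem' t' hag ht' => ?_
  refine h Φ' hΦ' mem' t' ?_ ?_
  · rintro σ hσ σ' hσ' x - y - hxy
    have ho1 := (ho σ (hΦ' hσ))
    have ho2 := (ho σ' (hΦ' hσ'))
    have hol := ho1.1
    have hne : x ≠ y := by rintro rfl; exact before_irrefl _ _ hxy
    -- Records that lie in different pieces, or of which one is small, are already ordered correctly
    -- by the PLE output.
    have key : ∀ x y, Before o x y → (∃ c ∈ o.splitOnP fun x => x.isLeft, x ∈ c ∧ y ∈ c) ∨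
        ∀ τ ∈ Φ', Before τ x y := by
      intro x y hb
      rcases pairwise_of_before (pairwise_splitOnP (P := fun x => x.isLeft) hol.pairwise)
        (hol.2 y) hb with h1 | h1 | h1 | ⟨i, h1, h2, h3⟩
      · exact .inl h1
      · exact .inr fun τ hτ => (ho τ (hΦ' hτ)).before_of (.inl h1) hb
      · exact .inr fun τ hτ => (ho τ (hΦ' hτ)).before_of (.inr h1) hb
      · exact .inr fun τ hτ => ((ho τ (hΦ' hτ)).before_of (.inr h1) h2).trans
          ((ho τ (hΦ' hτ)).before_of (.inl h1) h3)
    rcases hol.before_or hne with hb | hb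
    · rcases key x y hb with ⟨c, hc, hx, hy⟩ | h1
      · exact hag c hc σ hσ σ' hσ' x hx y hy hxy
      · exact h1 σ' hσ'
    · rcases key y x hb with ⟨c, hc, hy, hx⟩ | h1
      · exact hag c hc σ hσ σ' hσ' x hx y hy hxy
      · exact absurd hxy (h1 σ hσ).asymm
  · rwa [sum_map_splitOnP o (fun m => (p.w / p.B + 2) * (g m * m)) (by simp)] at ht'

theorem start_pleLayout_relabel {w B F : ℕ} {e : Equiv.Perm (Item S n)}
    (he : ∀ x, (e x).isLeft = x.isLeft) {d : Disk S n}
    (hd : ∀ j, d (F * B + j) = (contiguousCells w ((pleLayout S n).map e))[j]?) (j : ℕ) :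
    d (F * B + j) = ((start w (pleLayout S n)).disk j).map (relabelCell e) := by
  rw [hd, contiguousCells_map he, List.getElem?_map]
  rfl

/-- The sorting algorithm: mergesort of the small records, the given solution of PLE on the
relabelled records, and mergesort within the stripes. -/
theorem exists_sorting_alg (hB : 1 ≤ p.B) (hBw : p.B ≤ p.w) {fB fL k : ℕ} (hfB : 1 ≤ fB)
    (hfBM : fB * p.B ≤ p.M) (hfLM : fL * p.w ≤ p.M) {g : ℕ → ℕ} (hg : ∀ m, m ≤ fL ^ g m)
    (hk : S ≤ fB ^ k * p.B) {P : Alg S n} (hP : SolvesPLE p P) {l : List (Item S n)}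
    (hl : IsListing l) :
    ∃ A : Alg S n, ∀ σ, IsListing σ → ∃ t a d, Runs p σ A (start p.w l) t a d ∧
      StoredAt p.w d a σ ∧ ∃ σ' tP aP dP, IsListing σ' ∧ SmallSorted σ' ∧
        stripeSizes σ' = stripeSizes σ ∧ Runs p σ' P (start p.w (pleLayout S n)) tP aP dP ∧
        t ≤ tP + (16 * ((S + n * p.w) / p.B) + 16 + 7 * (k + 1) * numBlocks p.B S) +
          ((stripeSizes σ).map fun m => (p.w / p.B + 2) * (g m * m)).sum := by
  have hw : 1 ≤ p.w := hB.trans hBw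
  have hBM : p.B ≤ p.M := (Nat.le_mul_of_pos_left _ hfB).trans hfBM
  have key := Strat.exists_alg (p := p) (Φ := {σ : List (Item S n) | IsListing σ})
    (c := start p.w l) (t := 0)
    (Post := fun σ t a d => StoredAt p.w d a σ ∧ ∃ σ' tP aP dP, IsListing σ' ∧ SmallSorted σ' ∧
        stripeSizes σ' = stripeSizes σ ∧ Runs p σ' P (start p.w (pleLayout S n)) tP aP dP ∧
        t ≤ tP + (16 * ((S + n * p.w) / p.B) + 16 + 7 * (k + 1) * numBlocks p.B S) +
          ((stripeSizes σ).map fun m => (p.w / p.B + 2) * (g m * m)).sum) ?_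
  · obtain ⟨A, hA⟩ := key
    refine ⟨A, fun σ hσ => ?_⟩
    obtain ⟨t, a, d, h1, h2⟩ := hA σ hσ
    rw [Nat.zero_add] at h2
    exact ⟨t, a, d, h1, h2⟩
  refine Strat.prepare hB hfB hfBM hk (fun σ hσ => hσ) hl
    fun Φ hΦ mem d F t e hd he hsm hdF ht => ?_
  -- A read that keeps nothing empties the memory, which is where the simulated algorithm has to
  -- start. With the `11` of the preparation and the `4` of the final copying this gives the
  -- additive `16`.
  refine Strat.read 0 ∅ (by simp) ?_
  simp only [Finset.inter_empty]
  have hsim := Strat.simulate hB he F P (Φ := Φ) (c := start p.w (pleLayout S n)) (d₁ := d)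
    (t := t + 1) (Post := fun σ t' a d => ∃ tP out, t' = t + 1 + tP ∧
      Runs p (σ.map e.symm) P (start p.w (pleLayout S n)) tP a d ∧
      IsPLEOutput (σ.map e.symm) out ∧ StoredAt p.w d a out) (fun σ hσ => by
        obtain ⟨tP, a, d, h1, out, h2, h3⟩ := hP (σ.map e.symm) (IsListing.map (hΦ hσ) e.symm) (hsm σ hσ)
        exact ⟨tP, a, d, h1, tP, out, rfl, h1, h2, h3⟩) (start_pleLayout_relabel he hdF)
  rw [show (start p.w (pleLayout S n)).mem = ∅ from rfl, Finset.image_empty] at hsim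
  refine (hsim.finDisk hB hd).subset.bind ?_
  rintro Φ' ⟨mem', d'⟩ t' ⟨⟨⟨a, dP, hdP, hpost⟩, hfin⟩, hΦ'⟩
  rcases Φ'.eq_empty_or_nonempty with rfl | ⟨σ₀, hσ₀⟩
  · exact .empty
  obtain ⟨tP, out, ht', hrun, hout, hstP⟩ := hpost σ₀ hσ₀
  have hlist : ∀ σ ∈ Φ', IsListing σ := fun σ hσ => hΦ (hΦ' hσ)
  -- Correctness gives an output for each order separately; stored in the same place, these outputs
  -- coincide.
  have hoσ : ∀ σ ∈ Φ', IsPLEOutput σ (out.map e) := by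
    intro σ hσ
    obtain ⟨tP', out', _, _, h1, h2⟩ := hpost σ hσ
    rw [← hstP.unique hw hout.1 h1.1 h2] at h1
    exact h1.map he
  have hst : StoredAt p.w d' (F * p.B + a) (out.map e) := by
    intro j hj
    rw [contiguousCells_map he, List.length_map] at hj
    rw [contiguousCells_map he, List.getElem?_map, ← hstP j hj, Nat.add_assoc]
    exact hdP (a + j)
  refine Strat.sortStripes hB hBw hfLM hg hlist hst hoσ fun Φ'' hΦ'' mem'' t'' hag ht'' => ?_
  rcases Φ''.eq_empty_or_nonempty with rfl | ⟨σ₁, hσ₁⟩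
  · exact .empty
  have hσ₁l := hlist σ₁ (hΦ'' hσ₁)
  have ho₁ := hoσ σ₁ (hΦ'' hσ₁)
  refine Strat.finish hB hBw hBM hfin ho₁.1 hσ₁l hst (fun i j hij => ?_)
    fun mem₃ d₃ a₃ t₃ hst₃ ht₃ => .done ⟨a₃, fun σ hσ => ?_⟩
  · have hne : (Sum.inl i : Item S n) ≠ .inl j := by
      intro h
      rw [h] at hij
      exact before_irrefl _ _ hij
    rcases ho₁.1.before_or hne with h1 | h1
    · exact h1
    · exact absurd hij (ho₁.before_of (.inl rfl) h1).asymm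
  · obtain rfl := eq_of_agree (fun σ hσ => hlist σ (hΦ'' hσ)) hag hσ hσ₁
    obtain ⟨tP', out', ht'', hrun', hout', hstP'⟩ := hpost σ (hΦ'' hσ)
    refine ⟨hst₃, σ.map e.symm, tP', a, dP, hσ₁l.map _, hsm σ (hΦ' (hΦ'' hσ)), ?_, hrun', ?_⟩
    · refine stripeSizes_map fun x => ?_
      rw [← he, e.apply_symm_apply]
    · rw [stripeSizes_congr (ho₁.map_isLeft hσ₁l)] at *
      omega

/-- Some sorting algorithm exists. -/
theorem exists_solvesSort (hB : 1 ≤ p.B) (hBw : p.B ≤ p.w) (hM : 2 * p.w ≤ p.M)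
    {l : List (Item S n)} (hl : IsListing l) : ∃ A : Alg S n, SolvesSort p l A := by
  have hst0 : StoredAt p.w (start p.w l : Conf S n).disk 0 l := by
    intro j hj
    rw [Nat.zero_add]
    rfl
  have hd0 : FinDisk (start p.w l : Conf S n).disk :=
    ⟨(contiguousCells p.w l).length, fun a ha => List.getElem?_eq_none ha⟩
  have key := Strat.exists_alg (p := p) (Φ := {σ : List (Item S n) | IsListing σ})
    (c := start p.w l) (t := 0) (Post := fun σ t a d => StoredAt p.w d a σ) ?_
  · obtain ⟨A, hA⟩ := key
    exact ⟨A, fun σ hσ => hA σ hσ⟩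
  -- Binary merging with `2 w ≤ M`; the crude number of rounds is harmless, since only existence
  -- matters.
  refine Strat.sortKnowledge hM l.length (fun σ hσ => hσ) l
    (fun x hx => (hst0.itemAt hx).unitAt hB hBw) Nat.lt_two_pow_self.le
    fun Φ hΦ mem t ht hag => ?_
  rcases Φ.eq_empty_or_nonempty with rfl | ⟨σ₀, hσ₀⟩
  · exact .empty
  have hag' : Agree Φ Set.univ := hag.mono subset_rfl fun x _ => hl.2 x
  have hl₀ : IsListing σ₀ := hΦ hσ₀
  refine Strat.move hB le_rfl (by omega) hd0 σ₀ hl₀.1 (fun x => 0 + pos p.w l x)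
    (fun x _ => hst0.itemAt (hl.2 x)) id Finset.univ (by simp) (fun x => 0 + pos p.w l x)
    (fun x => pos p.w σ₀ x) (itemSize p.w) (itemSize p.w) ?_ (fun x _ => ⟨le_rfl, le_rfl⟩)
    (fun x _ => ⟨le_rfl, le_rfl⟩) fun mem' d' F t' _ _ hst' _ => .done ⟨F * p.B, fun σ hσ => ?_⟩
  · rintro x - y - rfl hb
    exact absurd hb (before_irrefl _ _)
  · rw [eq_of_agree (fun σ hσ => hΦ hσ) hag' hσ hσ₀]
    exact storedAt_of_forall hst'

end

/-! ### Lower bounds: volume arguments -/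

section

variable {S n : ℕ} {p : Params}

theorem card_div_eq_le {B : ℕ} (hB : 1 ≤ B) (b : ℕ) (Y : Finset ℕ) (hY : ∀ y ∈ Y, y / B = b) :
    Y.card ≤ B := by
  have : Y ⊆ Finset.Ico (b * B) (b * B + B) := by
    intro y hy
    have h1 := hY y hy
    have h2 := Nat.div_add_mod' y B
    have h3 := Nat.mod_lt y hB
    rw [h1] at h2
    rw [Finset.mem_Ico]
    omega
  refine (Finset.card_le_card this).trans ?_
  rw [Nat.card_Ico]
  omega

/-- A block transfer changes at most one block of the disk. -/
theorem Runs.card_changed (hB : 1 ≤ p.B) {σ : List (Item S n)} {A : Alg S n} {c : Conf S n}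
    {t a : ℕ} {d : Disk S n} (h : Runs p σ A c t a d) (Y : Finset ℕ)
    (hY : ∀ y ∈ Y, d y ≠ c.disk y) : Y.card ≤ t * p.B := by
  classical
  induction h generalizing Y with
  | halt a c =>
    rw [Finset.eq_empty_of_forall_notMem (s := Y) fun y hy => hY y hy rfl]
    simp
  | read hmem _ ih =>
    have := ih Y hY
    rw [Nat.add_mul]
    omega
  | @write b f A c t a d hmem _ ih =>
    have h1 := ih (Y.filter fun y => y / p.B ≠ b) fun y hy => by
      rw [Finset.mem_filter] at hy
      simpa [writeBlock, hy.2] using hY y hy.1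
    have h2 := card_div_eq_le hB b (Y.filter fun y => ¬ y / p.B ≠ b) fun y hy => by
      rw [Finset.mem_filter, not_not] at hy
      exact hy.2
    rw [← Finset.card_filter_add_card_filter_not (s := Y) (p := fun y => y / p.B ≠ b), Nat.add_mul]
    omega
  | compare_lt _ _ _ _ ih => exact ih Y hY
  | compare_not_lt _ _ _ _ ih => exact ih Y hY

theorem card_blockCells_le (B : ℕ) (d : Disk S n) (b : ℕ) : (blockCells B d b).card ≤ B := by
  refine Finset.card_biUnion_le.trans ?_
  refine (Finset.sum_le_sum (g := fun _ => 1) fun j _ => ?_).trans (by simp)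
  cases d (b * B + j) <;> simp

/-- A run depends only on the comparisons among the records that come into memory, and at most
`B` cells come into memory with each block transfer. -/
theorem Runs.exists_visited {σ : List (Item S n)} {A : Alg S n} {c : Conf S n}
    {t a : ℕ} {d : Disk S n} (h : Runs p σ A c t a d) :
    ∃ V : Finset (Cell S n), c.mem ⊆ V ∧ V.card ≤ c.mem.card + t * p.B ∧
      ∀ σ', (∀ x y, InMemory p.w V x → InMemory p.w V y → (Before σ x y ↔ Before σ' x y)) →
        Runs p σ' A c t a d := by
  induction h with
  | halt a c => exact ⟨c.mem, subset_rfl, by omega, fun _ _ => .halt a c⟩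
  | @read b K A c t a d hmem _ ih =>
    obtain ⟨V, h1, h2, h3⟩ := ih
    dsimp only at h1 h2
    set m' := (c.mem ∪ blockCells p.B c.disk b) ∩ K with hm'
    -- Adding the old memory to `V` adds only discarded cells. New memory and discarded cells
    -- together amount to at most `B` more than the old memory.
    have h5 : (V ∪ c.mem).card ≤ V.card + (c.mem \ m').card := by
      rw [← Finset.union_sdiff_self_eq_union]
      refine (Finset.card_union_le _ _).trans (Nat.add_le_add_left (Finset.card_le_card ?_) _)
      exact Finset.sdiff_subset_sdiff subset_rfl h1
    have h6 : m'.card + (c.mem \ m').card ≤ c.mem.card + p.B := by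
      rw [← Finset.card_union_of_disjoint Finset.disjoint_sdiff, Finset.union_sdiff_self_eq_union]
      have : m' ∪ c.mem ⊆ c.mem ∪ blockCells p.B c.disk b :=
        Finset.union_subset Finset.inter_subset_left Finset.subset_union_left
      exact (Finset.card_le_card this).trans ((Finset.card_union_le _ _).trans
        (Nat.add_le_add_left (card_blockCells_le _ _ _) _))
    refine ⟨V ∪ c.mem, Finset.subset_union_right, ?_, fun σ' hσ' => .read hmem (h3 σ' ?_)⟩
    · rw [Nat.add_mul]
      omega
    · exact fun x y hx hy => hσ' x y (fun j hj => Finset.mem_union_left _ (hx j hj))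
        fun j hj => Finset.mem_union_left _ (hy j hj)
  | write hmem _ ih =>
    obtain ⟨V, h1, h2, h3⟩ := ih
    refine ⟨V, h1, ?_, fun σ' hσ' => .write hmem (h3 σ' hσ')⟩
    rw [Nat.add_mul]
    dsimp only at h2
    omega
  | compare_lt hx hy hlt _ ih =>
    obtain ⟨V, h1, h2, h3⟩ := ih
    refine ⟨V, h1, h2, fun σ' hσ' => .compare_lt hx hy ((hσ' _ _ ?_ ?_).1 hlt) (h3 σ' hσ')⟩
    · exact fun j hj => h1 (hx j hj)
    · exact fun j hj => h1 (hy j hj)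
  | compare_not_lt hx hy hlt _ ih =>
    obtain ⟨V, h1, h2, h3⟩ := ih
    refine ⟨V, h1, h2, fun σ' hσ' =>
      .compare_not_lt hx hy (fun h => hlt ((hσ' _ _ ?_ ?_).2 h)) (h3 σ' hσ')⟩
    · exact fun j hj => h1 (hx j hj)
    · exact fun j hj => h1 (hy j hj)

/-- A sorting algorithm has to read the entire input. -/
theorem SolvesSort.volume_le (hw : 1 ≤ p.w) (hSn : 2 ≤ S + n) {l : List (Item S n)}
    {A : Alg S n} (hA : SolvesSort p l A) {σ : List (Item S n)} (hσ : IsListing σ) {t a : ℕ}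
    {d : Disk S n} (h : Runs p σ A (start p.w l) t a d) : S + n * p.w ≤ t * p.B := by
  obtain ⟨V, -, h2, h3⟩ := h.exists_visited
  have h2' : V.card ≤ t * p.B := by simpa [start] using h2
  have hall : ∀ x, InMemory p.w V x := by
    by_contra! hx
    obtain ⟨x, hx⟩ := hx
    have hlen := hσ.length
    have hxl := List.idxOf_lt_length_iff.2 (hσ.2 x)
    -- A neighbour of `x` in `σ`. Exchanging the two changes no comparison that does not involve
    -- `x`, so the run cannot notice it, although the output would have to change.
    obtain ⟨z, hzx, hz⟩ : ∃ z, z ≠ x ∧ (σ.idxOf z = σ.idxOf x + 1 ∨ σ.idxOf z + 1 = σ.idxOf x) := by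
      have hget : ∀ k (hk : k < σ.length), k ≠ σ.idxOf x → ∃ z, z ≠ x ∧ σ.idxOf z = k := by
        intro k hk hne
        have := hσ.1.idxOf_getElem k hk
        refine ⟨σ[k], ?_, this⟩
        intro h'
        rw [h'] at this
        exact hne this.symm
      by_cases hlt : σ.idxOf x + 1 < σ.length
      · obtain ⟨z, hz1, hz2⟩ := hget _ hlt (by omega)
        exact ⟨z, hz1, .inl hz2⟩
      · obtain ⟨z, hz1, hz2⟩ := hget (σ.idxOf x - 1) (by omega) (by omega)
        exact ⟨z, hz1, .inr (by omega)⟩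
    set e := Equiv.swap x z with he
    have hrun : Runs p (σ.map e) A (start p.w l) t a d := by
      refine h3 _ fun u v hu hv => ?_
      have hux : u ≠ x := by rintro rfl; exact hx hu
      have hvx : v ≠ x := by rintro rfl; exact hx hv
      rw [before_map, he, Equiv.symm_swap]
      have hidx : ∀ u, u ≠ x → u ≠ z → σ.idxOf u ≠ σ.idxOf x ∧ σ.idxOf u ≠ σ.idxOf z :=
        fun u h1 h2 => ⟨fun h => h1 (hσ.idxOf_inj.1 h), fun h => h2 (hσ.idxOf_inj.1 h)⟩
      unfold Before
      by_cases huz : u = z <;> by_cases hvz : v = z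
      · subst huz hvz
        simp
      · subst huz
        have := hidx v hvx hvz
        rw [Equiv.swap_apply_right, Equiv.swap_apply_of_ne_of_ne hvx hvz]
        omega
      · subst hvz
        have := hidx u hux huz
        rw [Equiv.swap_apply_right, Equiv.swap_apply_of_ne_of_ne hux huz]
        omega
      · rw [Equiv.swap_apply_of_ne_of_ne hux huz, Equiv.swap_apply_of_ne_of_ne hvx hvz]
    obtain ⟨t₁, a₁, d₁, hr₁, hs₁⟩ := hA σ hσ
    obtain ⟨t₂, a₂, d₂, hr₂, hs₂⟩ := hA _ (hσ.map e)
    obtain ⟨-, rfl, rfl⟩ := hr₁.unique h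
    obtain ⟨-, rfl, rfl⟩ := hr₂.unique hrun
    have heq := hs₁.unique hw hσ (hσ.map e) hs₂
    have h4 := before_map_apply (e := e) (σ := σ) (x := x) (y := z)
    rw [← heq, he, Equiv.swap_apply_left, Equiv.swap_apply_right] at h4
    unfold Before at h4
    omega
  refine le_trans ?_ h2'
  have hsub : (contiguousCells p.w σ).toFinset ⊆ V := by
    rintro ⟨x, k⟩ hx
    rw [List.mem_toFinset, mem_contiguousCells] at hx
    exact hall x k hx.2
  refine le_trans (le_of_eq ?_) (Finset.card_le_card hsub)
  rw [List.toFinset_card_of_nodup, ← vol_listing (w := p.w) hσ, vol]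
  rw [contiguousCells, List.nodup_flatMap]
  refine ⟨fun x _ => ?_, hσ.1.imp fun {x y} hxy => ?_⟩
  · exact List.nodup_range.map fun i j h => by simpa using h
  · rintro ⟨z, k⟩ h1 h2
    obtain ⟨i, _, hi⟩ := List.mem_map.1 h1
    obtain ⟨j, _, hj⟩ := List.mem_map.1 h2
    simp only [Prod.mk.injEq] at hi hj
    exact hxy (hi.1.trans hj.1.symm)

/-- If some large record precedes all small ones, then PLE has to move all small records. -/
theorem SolvesPLE.smalls_le (hB : 1 ≤ p.B) (hw : 1 ≤ p.w) {P : Alg S n} (hP : SolvesPLE p P)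
    {σ : List (Item S n)} (hσ : IsListing σ) (hsm : SmallSorted σ) {x : Item S n}
    (hx : σ.idxOf x = 0) (hxr : x.isLeft = false) {t a : ℕ} {d : Disk S n}
    (h : Runs p σ P (start p.w (pleLayout S n)) t a d) : S ≤ t * p.B := by
  obtain ⟨t', a', d', hr, out, hout, hst⟩ := hP σ hσ hsm
  obtain ⟨rfl, rfl, rfl⟩ := hr.unique h
  -- In the output, the large record `x` and the `i` smaller small records precede `.inl i`.
  -- Initially this record is at address `i`, so its output address did not hold it before.
  have hlow : ∀ i : Fin S, (i : ℕ) + 1 ≤ pos p.w out (.inl i) := by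
    intro i
    have h1 : ∀ y, Before σ y (.inl i) → Before out y (.inl i) := by
      intro y hy
      rcases hout.1.before_or (x := y) (y := .inl i) (by rintro rfl; exact before_irrefl _ _ hy)
        with h' | h'
      · exact h'
      · exact absurd hy (hout.before_of (.inl rfl) h').asymm
    have hsub : insert x ((Finset.Iio i).map ⟨Sum.inl, Sum.inl_injective⟩) ⊆
        (out.take (out.idxOf (.inl i))).toFinset := by
      intro y hy
      rw [List.mem_toFinset, List.mem_take_iff_idxOf_lt (hout.1.2 y)]
      rw [Finset.mem_insert, Finset.mem_map] at hy
      refine h1 y ?_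
      rcases hy with rfl | ⟨j, hj, rfl⟩
      · rcases hσ.before_or (x := y) (y := .inl i) (by rintro rfl; cases hxr) with h' | h'
        · exact h'
        · unfold Before at h'
          omega
      · exact hsm j i (by simpa using hj)
    have hcard := Finset.card_le_card hsub
    rw [Finset.card_insert_of_notMem, Finset.card_map, Fin.card_Iio] at hcard
    · refine (hcard.trans (List.toFinset_card_le _)).trans ?_
      unfold pos
      generalize out.take (out.idxOf (.inl i)) = m
      induction m with
      | nil => simp
      | cons y m ih =>
        have := itemSize_pos hw y
        rw [vol_cons, List.length_cons]
        omega
    · rw [Finset.mem_map]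
      rintro ⟨j, _, rfl⟩
      cases hxr
  have hinj : Function.Injective fun i : Fin S => a' + pos p.w out (.inl i) := by
    intro i j hij
    have h1 := hst.itemAt (hout.1.2 (.inl i)) 0 Nat.one_pos
    have h2 := hst.itemAt (hout.1.2 (.inl j)) 0 Nat.one_pos
    simp only at hij
    rw [hij, h2] at h1
    simpa using h1.symm
  have hbeg : StoredAt p.w (start p.w (pleLayout S n) : Conf S n).disk 0 (pleLayout S n) := by
    intro j hj
    rw [Nat.zero_add]
    rfl
  have := h.card_changed hB (Finset.univ.map ⟨_, hinj⟩) fun y hy => by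
    rw [Finset.mem_map] at hy
    obtain ⟨i, _, rfl⟩ := hy
    have h1 := hst.itemAt (hout.1.2 (.inl i)) 0 Nat.one_pos
    simp only [Function.Embedding.coeFn_mk]
    rw [Nat.add_zero] at h1
    rw [h1]
    intro h2
    obtain ⟨hlt, h3⟩ := List.getElem?_eq_some_iff.1 h2.symm
    obtain ⟨z, hz, k, hk, e1, e2⟩ := exists_pos_add isListing_pleLayout.1 hlt
    rw [e2] at h3
    cases h3
    rw [pos_pleLayout_inl] at e1
    have := hlow i
    omega
  simpa using this

end

/-! ### Lower bounds: counting arguments -/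

section

variable {S n : ℕ} {p : Params}

/-- Pigeonhole. Fixing the value of `key` reveals information at the price of a factor `s.card` in
the number of surviving orders. -/
theorem exists_large_class {α β : Type*} [DecidableEq β] {Φ : Finset α} (hΦ : Φ.Nonempty)
    (key : α → β) (s : Finset β) (hkey : ∀ σ ∈ Φ, key σ ∈ s) :
    ∃ v, Φ.card ≤ s.card * (Φ.filter fun σ => key σ = v).card := by
  obtain ⟨σ₀, hσ₀⟩ := hΦ
  obtain ⟨v, _, hv⟩ := Finset.exists_max_image s (fun v => (Φ.filter fun σ => key σ = v).card)
    ⟨_, hkey σ₀ hσ₀⟩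
  refine ⟨v, ?_⟩
  rw [Nat.mul_comm]
  exact Finset.card_le_mul_card_image_of_maps_to hkey _ hv

/-- The number of records in `X` that come before `x` in `σ`. -/
def rankIn (X : Finset (Item S n)) (σ : List (Item S n)) (x : Item S n) : ℕ :=
  (X.filter fun y => Before σ y x).card

theorem rankIn_lt_of_before {X : Finset (Item S n)} {σ : List (Item S n)} {x y : Item S n}
    (hx : x ∈ X) (h : Before σ x y) : rankIn X σ x < rankIn X σ y := by
  refine Finset.card_lt_card ⟨fun z hz => ?_, fun hsub => ?_⟩
  · rw [Finset.mem_filter] at hz ⊢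
    exact ⟨hz.1, hz.2.trans h⟩
  · exact before_irrefl σ x (Finset.mem_filter.1 (hsub (Finset.mem_filter.2 ⟨hx, h⟩))).2

theorem before_iff_rankIn_lt {X : Finset (Item S n)} {σ : List (Item S n)} (hσ : IsListing σ)
    {x y : Item S n} (hx : x ∈ X) (hy : y ∈ X) :
    Before σ x y ↔ rankIn X σ x < rankIn X σ y := by
  refine ⟨rankIn_lt_of_before hx, fun h => ?_⟩
  rcases hσ.before_or (x := x) (y := y) (by rintro rfl; exact lt_irrefl _ h) with h' | h'
  · exact h'
  · exact absurd h (rankIn_lt_of_before hy h').asymm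

theorem rankIn_lt_card {X : Finset (Item S n)} {σ : List (Item S n)} {x : Item S n} (hx : x ∈ X) :
    rankIn X σ x < X.card :=
  Finset.card_lt_card (Finset.filter_ssubset.2 ⟨x, hx, before_irrefl σ x⟩)

theorem rankIn_injOn {X : Finset (Item S n)} {σ : List (Item S n)} (hσ : IsListing σ) :
    Set.InjOn (rankIn X σ) X := by
  intro x hx y hy h
  by_contra hne
  rcases hσ.before_or hne with h' | h'
  · exact absurd h (rankIn_lt_of_before hx h').ne
  · exact absurd h.symm (rankIn_lt_of_before hy h').ne

theorem image_rankIn {X : Finset (Item S n)} {σ : List (Item S n)} (hσ : IsListing σ) :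
    X.image (rankIn X σ) = Finset.range X.card := by
  refine Finset.eq_of_subset_of_card_le (fun k hk => ?_) ?_
  · obtain ⟨x, hx, rfl⟩ := Finset.mem_image.1 hk
    exact Finset.mem_range.2 (rankIn_lt_card hx)
  · rw [Finset.card_image_of_injOn (rankIn_injOn hσ), Finset.card_range]

/-- The ranks of the records in `G` are determined by their order and the set of their ranks. -/
theorem rankIn_eq_of_image_eq {X G : Finset (Item S n)} (hGX : G ⊆ X) {σ σ' : List (Item S n)}
    (hσ : IsListing σ) (hσ' : IsListing σ')
    (hG : ∀ x ∈ G, ∀ y ∈ G, (Before σ x y ↔ Before σ' x y))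
    (himg : G.image (rankIn X σ) = G.image (rankIn X σ')) {x : Item S n} (hx : x ∈ G) :
    rankIn X σ x = rankIn X σ' x := by
  -- The place of the rank of `x` within the rank set of `G` is the number of records of `G` before
  -- `x`, which is the same for both orders.
  have hcount : ∀ τ : List (Item S n), IsListing τ →
      ((G.image (rankIn X τ)).filter fun k => k < rankIn X τ x).card =
        (G.filter fun y => Before τ y x).card := by
    intro τ hτ
    rw [Finset.filter_image, Finset.card_image_of_injOn]
    · congr 1
      refine Finset.filter_congr fun y hy => ?_
      exact (before_iff_rankIn_lt hτ (hGX hy) (hGX hx)).symm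
    · exact (rankIn_injOn hτ).mono fun y hy => hGX (Finset.mem_filter.1 hy).1
  have h1 := hcount σ hσ
  have h2 := hcount σ' hσ'
  rw [← himg, ← Finset.filter_congr fun y hy => hG y hy x hx, ← h1] at h2
  have hlt : ∀ a b, a < b → a ∈ G.image (rankIn X σ) →
      ((G.image (rankIn X σ)).filter fun k => k < a).card <
        ((G.image (rankIn X σ)).filter fun k => k < b).card := by
    intro a b hab ha
    refine Finset.card_lt_card ⟨fun k hk => ?_, fun hsub => ?_⟩
    · rw [Finset.mem_filter] at hk ⊢
      exact ⟨hk.1, hk.2.trans hab⟩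
    · exact lt_irrefl a (Finset.mem_filter.1 (hsub (Finset.mem_filter.2 ⟨ha, hab⟩))).2
  rcases lt_trichotomy (rankIn X σ x) (rankIn X σ' x) with h | h | h
  · have := hlt _ _ h (Finset.mem_image_of_mem _ hx)
    omega
  · exact h
  · have := hlt _ _ h (himg ▸ Finset.mem_image_of_mem _ hx)
    omega

/-- The order of `G₀ ∪ G₁ ∪ G₂` is determined by the orders of the three sets, and the ranks of
the records in `G₁` and of those in `G₂`. -/
theorem before_iff_of_images {G₀ G₁ G₂ : Finset (Item S n)} {σ σ' : List (Item S n)}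
    (hσ : IsListing σ) (hσ' : IsListing σ')
    (hd : Disjoint G₀ (G₁ ∪ G₂))
    (h₀ : ∀ x ∈ G₀, ∀ y ∈ G₀, (Before σ x y ↔ Before σ' x y))
    (h₁ : ∀ x ∈ G₁, ∀ y ∈ G₁, (Before σ x y ↔ Before σ' x y))
    (h₂ : ∀ x ∈ G₂, ∀ y ∈ G₂, (Before σ x y ↔ Before σ' x y))
    (i₁ : G₁.image (rankIn (G₀ ∪ (G₁ ∪ G₂)) σ) = G₁.image (rankIn (G₀ ∪ (G₁ ∪ G₂)) σ'))
    (i₂ : G₂.image (rankIn (G₀ ∪ (G₁ ∪ G₂)) σ) = G₂.image (rankIn (G₀ ∪ (G₁ ∪ G₂)) σ'))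
    {x y : Item S n} (hx : x ∈ G₀ ∪ (G₁ ∪ G₂)) (hy : y ∈ G₀ ∪ (G₁ ∪ G₂)) :
    Before σ x y ↔ Before σ' x y := by
  set X := G₀ ∪ (G₁ ∪ G₂) with hX
  -- The ranks of `G₀` are those left over by `G₁` and `G₂`, so only the small sets have to be
  -- revealed.
  have hG₀ : ∀ τ : List (Item S n), IsListing τ → G₀.image (rankIn X τ) =
      Finset.range X.card \ (G₁.image (rankIn X τ) ∪ G₂.image (rankIn X τ)) := by
    intro τ hτ
    rw [← image_rankIn hτ, ← Finset.image_union, ← Finset.image_sdiff_of_injOn (rankIn_injOn hτ)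
      Finset.subset_union_right, hX, Finset.union_sdiff_cancel_right hd]
  have i₀ : G₀.image (rankIn X σ) = G₀.image (rankIn X σ') := by
    rw [hG₀ σ hσ, hG₀ σ' hσ', i₁, i₂]
  have hr : ∀ z ∈ X, rankIn X σ z = rankIn X σ' z := by
    intro z hz
    rcases Finset.mem_union.1 hz with hz | hz
    · exact rankIn_eq_of_image_eq Finset.subset_union_left hσ hσ' h₀ i₀ hz
    · rcases Finset.mem_union.1 hz with hz | hz
      · exact rankIn_eq_of_image_eq (Finset.subset_union_left.trans Finset.subset_union_right)
          hσ hσ' h₁ i₁ hz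
      · exact rankIn_eq_of_image_eq (Finset.subset_union_right.trans Finset.subset_union_right)
          hσ hσ' h₂ i₂ hz
  rw [before_iff_rankIn_lt hσ hx hy, before_iff_rankIn_lt hσ' hx hy, hr x hx, hr y hy]

/-- The sets of at most `B` of the numbers below `N`. -/
def smallSets (N B : ℕ) : Finset (Finset ℕ) :=
  (Finset.range N).powerset.filter fun s => s.card ≤ B

/-- If the orders of `G₀`, `G₁` and `G₂` are known, where `G₁ ∪ G₂` has at most `B` elements, then
the order of `G₀ ∪ G₁ ∪ G₂` is determined up to the choice of two small sets. -/
theorem exists_class_merge {Φ : Finset (List (Item S n))} (hne : Φ.Nonempty)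
    (hl : ∀ σ ∈ Φ, IsListing σ) {G₀ G₁ G₂ : Finset (Item S n)} (hd : Disjoint G₀ (G₁ ∪ G₂))
    {N B : ℕ} (hN : (G₀ ∪ (G₁ ∪ G₂)).card ≤ N) (hB : (G₁ ∪ G₂).card ≤ B)
    (h₀ : Agree (Φ : Set (List (Item S n))) G₀) (h₁ : Agree (Φ : Set (List (Item S n))) G₁)
    (h₂ : Agree (Φ : Set (List (Item S n))) G₂) :
    ∃ Φ' ⊆ Φ, Φ.card ≤ (smallSets N B).card ^ 2 * Φ'.card ∧
      Agree (Φ' : Set (List (Item S n))) ↑(G₀ ∪ (G₁ ∪ G₂)) := by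
  set X := G₀ ∪ (G₁ ∪ G₂) with hX
  have hkey : ∀ G ⊆ G₁ ∪ G₂, ∀ σ ∈ Φ, G.image (rankIn X σ) ∈ smallSets N B := by
    intro G hG σ hσ
    refine Finset.mem_filter.2 ⟨Finset.mem_powerset.2 fun k hk => ?_,
      Finset.card_image_le.trans ((Finset.card_le_card hG).trans hB)⟩
    obtain ⟨x, hx, rfl⟩ := Finset.mem_image.1 hk
    exact Finset.mem_range.2 ((rankIn_lt_card (Finset.mem_union_right _ (hG hx))).trans_le hN)
  obtain ⟨v, hv⟩ := exists_large_class hne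
    (fun σ => (G₁.image (rankIn X σ), G₂.image (rankIn X σ)))
    (smallSets N B ×ˢ smallSets N B) fun σ hσ => Finset.mem_product.2
      ⟨hkey _ Finset.subset_union_left σ hσ, hkey _ Finset.subset_union_right σ hσ⟩
  refine ⟨Φ.filter fun σ => (G₁.image (rankIn X σ), G₂.image (rankIn X σ)) = v,
    Finset.filter_subset _ _, by rwa [Finset.card_product, ← pow_two] at hv, ?_⟩
  intro σ hσ σ' hσ' x hx y hy hxy
  rw [Finset.mem_coe, Finset.mem_filter] at hσ hσ'
  obtain ⟨hσ, e⟩ := hσ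
  obtain ⟨hσ', e'⟩ := hσ'
  rw [← e', Prod.mk.injEq] at e
  have hiff : ∀ G : Finset (Item S n), Agree (Φ : Set (List (Item S n))) G →
      ∀ x ∈ G, ∀ y ∈ G, (Before σ x y ↔ Before σ' x y) := fun G hG x hx y hy =>
    ⟨hG σ hσ σ' hσ' x hx y hy, hG σ' hσ' σ hσ x hx y hy⟩
  exact (before_iff_of_images (hl σ hσ) (hl σ' hσ') hd (hiff _ h₀) (hiff _ h₁) (hiff _ h₂)
    e.1 e.2 hx hy).1 hxy

/-- Revealing the order of the records in `G`. -/
theorem exists_class_order {Φ : Finset (List (Item S n))} (hne : Φ.Nonempty)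
    (hl : ∀ σ ∈ Φ, IsListing σ) (G : Finset (Item S n)) {B : ℕ} (hG : G.card ≤ B) :
    ∃ Φ' ⊆ Φ, Φ.card ≤ B ^ G.card * Φ'.card ∧ Agree (Φ' : Set (List (Item S n))) ↑G := by
  obtain ⟨v, hv⟩ := exists_large_class hne
    (fun σ (x : Item S n) => if x ∈ G then rankIn G σ x else 0)
    (Fintype.piFinset fun x => if x ∈ G then Finset.range B else {0}) fun σ hσ => by
      rw [Fintype.mem_piFinset]
      intro x
      split_ifs with hx
      · exact Finset.mem_range.2 ((rankIn_lt_card hx).trans_le hG)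
      · simp
  refine ⟨Φ.filter fun σ => (fun x => if x ∈ G then rankIn G σ x else 0) = v,
    Finset.filter_subset _ _, ?_, ?_⟩
  · convert hv using 2
    rw [Fintype.card_piFinset, ← Finset.prod_const]
    rw [← Finset.prod_subset (Finset.subset_univ G)]
    · exact Finset.prod_congr rfl fun x hx => by rw [if_pos hx, Finset.card_range]
    · intro x _ hx
      rw [if_neg hx, Finset.card_singleton]
  · intro σ hσ σ' hσ' x hx y hy hxy
    rw [Finset.mem_coe, Finset.mem_filter] at hσ hσ'
    have hr : ∀ z ∈ G, rankIn G σ z = rankIn G σ' z := by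
      intro z hz
      have := congrFun (hσ.2.trans hσ'.2.symm) z
      simpa [hz] using this
    rw [Finset.mem_coe] at hx hy
    rw [before_iff_rankIn_lt (hl σ hσ.1) hx hy, hr x hx, hr y hy] at hxy
    exact (before_iff_rankIn_lt (hl σ' hσ'.1) hx hy).2 hxy

end

/-! ### Counting bounds for the runs of a sorting algorithm. -/

section

variable {S n : ℕ} {p : Params}

theorem card_smallSets_pos (N B : ℕ) : 0 < (smallSets N B).card :=
  Finset.card_pos.2 ⟨∅, by simp [smallSets]⟩

/-- This ends the counting inductions: at a leaf the output is fixed, and it is the order itself. -/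
theorem card_le_one_of_storedAt (hw : 1 ≤ p.w) {Φ : Finset (List (Item S n))}
    (hl : ∀ σ ∈ Φ, IsListing σ) {a : ℕ} {d : Disk S n} (h : ∀ σ ∈ Φ, StoredAt p.w d a σ) :
    Φ.card ≤ 1 :=
  Finset.card_le_one.2 fun σ hσ σ' hσ' => (h σ hσ).unique hw (hl σ hσ) (hl σ' hσ') (h σ' hσ')

/-- The counting bound for the order of the small records: each block transfer merges at most `B`
new records into the order of those in memory, and only when a block is read for the first time,
the order of the small records in it is new as well. -/
theorem card_le_of_small (hB : 1 ≤ p.B) (hw : 1 ≤ p.w) {A : Alg S n} {c : Conf S n} {t : ℕ}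
    {Φ : Finset (List (Item S n))} {T : Finset ℕ} (hl : ∀ σ ∈ Φ, IsListing σ)
    (hrun : ∀ σ ∈ Φ, ∃ t' a d, t' ≤ t ∧ Runs p σ A c t' a d ∧ StoredAt p.w d a σ)
    (hmem : c.mem.card ≤ p.M)
    (hin : Agree (Φ : Set (List (Item S n))) {x | InMemory p.w c.mem x})
    (hlarge : Agree (Φ : Set (List (Item S n))) {x | x.isLeft = false})
    (hfresh : ∀ a, a / p.B ∉ T → ∀ (i : Fin S) k, c.disk a = some (.inl i, k) → a = i)
    (hT : ∀ b ∈ T, Agree (Φ : Set (List (Item S n)))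
      {x | x.isLeft ∧ (x, 0) ∈ blockCells p.B c.disk b}) :
    Φ.card ≤ ((smallSets (p.M + p.B) p.B).card ^ 2) ^ t *
      p.B ^ (Finset.univ.filter fun i : Fin S => (i : ℕ) / p.B ∉ T).card := by
  classical
  set q := (smallSets (p.M + p.B) p.B).card ^ 2 with hq
  have hq1 : 1 ≤ q := Nat.one_le_pow _ _ (card_smallSets_pos _ _)
  induction A generalizing c t Φ T with
  | halt a =>
    refine (card_le_one_of_storedAt hw hl (a := a) (d := c.disk) fun σ hσ => ?_).trans
      (Nat.mul_pos (pow_pos hq1 _) (pow_pos hB _))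
    obtain ⟨t', a', d', -, hr, hs⟩ := hrun σ hσ
    cases hr
    exact hs
  | read b K A ih =>
    rcases Φ.eq_empty_or_nonempty with rfl | hne
    · simp
    set blk := blockCells p.B c.disk b with hblk
    obtain ⟨σ₀, hσ₀⟩ := hne
    have ht : 1 ≤ t ∧ ((c.mem ∪ blk) ∩ K).card ≤ p.M := by
      obtain ⟨t', a', d', ht', hr, hs⟩ := hrun σ₀ hσ₀
      cases hr with
      | read hm _ => exact ⟨by omega, hm⟩
    set G₀ : Finset (Item S n) := Finset.univ.filter fun x => InMemory p.w c.mem x with hG₀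
    set N : Finset (Item S n) := Finset.univ.filter fun x =>
      InMemory p.w (c.mem ∪ blk) x ∧ ¬ InMemory p.w c.mem x with hN
    set G₁ := N.filter fun x => x.isLeft with hG₁
    set G₂ := N.filter fun x => ¬ x.isLeft with hG₂
    have hG₁₂ : G₁ ∪ G₂ = N := Finset.filter_union_filter_not_eq _ _
    have hNB : N.card ≤ p.B := by
      have : N ⊆ blk.image Prod.fst := by
        intro x hx
        obtain ⟨h1, h2⟩ := (Finset.mem_filter.1 hx).2
        unfold InMemory at h2
        push Not at h2
        obtain ⟨j, hj, h2⟩ := h2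
        exact Finset.mem_image.2 ⟨(x, j), (Finset.mem_union.1 (h1 j hj)).resolve_left h2, rfl⟩
      exact (Finset.card_le_card this).trans (Finset.card_image_le.trans (card_blockCells_le _ _ _))
    have hG₀M : G₀.card ≤ p.M := by
      refine le_trans (Finset.card_le_card_of_injOn (fun x => (x, 0)) (fun x hx => ?_) ?_) hmem
      · exact (Finset.mem_filter.1 hx).2 0 (itemSize_pos hw x)
      · intro x _ y _ h
        simpa using h
    have hG₁blk : ∀ x ∈ G₁, (x, 0) ∈ blk := by
      intro x hx
      obtain ⟨hx, hxl⟩ := Finset.mem_filter.1 hx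
      obtain ⟨h1, h2⟩ := (Finset.mem_filter.1 hx).2
      have hs := itemSize_of_isLeft (w := p.w) hxl
      refine (Finset.mem_union.1 (h1 0 (by omega))).resolve_left fun h => h2 fun j hj => ?_
      obtain rfl : j = 0 := by omega
      exact h
    -- If `b` was accessed before, the order of its small records is known. Otherwise it still holds
    -- small records at their initial addresses, and revealing their order is paid for by dropping
    -- them from the exponent of `B`.
    obtain ⟨Φ₁, hΦ₁, m, hcard₁, hm, hag₁⟩ : ∃ Φ₁ ⊆ Φ, ∃ m, Φ.card ≤ p.B ^ m * Φ₁.card ∧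
        m + (Finset.univ.filter fun i : Fin S => (i : ℕ) / p.B ∉ insert b T).card ≤
          (Finset.univ.filter fun i : Fin S => (i : ℕ) / p.B ∉ T).card ∧
        Agree (Φ₁ : Set (List (Item S n))) G₁ := by
      by_cases hb : b ∈ T
      · refine ⟨Φ, subset_rfl, 0, by simp, ?_, (hT b hb).mono subset_rfl fun x hx => ?_⟩
        · rw [Finset.insert_eq_of_mem hb, Nat.zero_add]
        · exact ⟨(Finset.mem_filter.1 hx).2, hG₁blk x hx⟩
      · obtain ⟨Φ₁, h1, h2, h3⟩ := exists_class_order ⟨σ₀, hσ₀⟩ hl G₁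
          ((Finset.card_le_card (Finset.filter_subset _ _)).trans hNB)
        refine ⟨Φ₁, h1, _, h2, ?_, h3⟩
        rw [← Finset.card_map ⟨Sum.inl, Sum.inl_injective⟩ (s := Finset.univ.filter
          fun i : Fin S => (i : ℕ) / p.B ∉ insert b T),
          ← Finset.card_map ⟨Sum.inl, Sum.inl_injective⟩ (s := Finset.univ.filter
          fun i : Fin S => (i : ℕ) / p.B ∉ T), ← Finset.card_union_of_disjoint]
        · refine Finset.card_le_card (Finset.union_subset (fun x hx => ?_) ?_)
          · obtain ⟨i, rfl⟩ := Sum.isLeft_iff.1 (Finset.mem_filter.1 hx).2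
            obtain ⟨j, hj, h4⟩ := mem_blockCells.1 (hG₁blk _ hx)
            have hdiv : (b * p.B + j) / p.B = b := by
              rw [Nat.mul_comm, Nat.mul_add_div hB, Nat.div_eq_of_lt hj, Nat.add_zero]
            have := hfresh _ (by rwa [hdiv]) i 0 h4
            refine Finset.mem_map.2 ⟨i, ?_, rfl⟩
            rw [Finset.mem_filter]
            exact ⟨Finset.mem_univ _, by rwa [← this, hdiv]⟩
          · refine Finset.map_subset_map.2 fun i hi => ?_
            rw [Finset.mem_filter, Finset.mem_insert] at hi
            rw [Finset.mem_filter]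
            tauto
        · rw [Finset.disjoint_left]
          intro x hx hx'
          obtain ⟨i, hi, rfl⟩ := Finset.mem_map.1 hx'
          obtain ⟨j, hj, h4⟩ := mem_blockCells.1 (hG₁blk _ hx)
          have hdiv : (b * p.B + j) / p.B = b := by
            rw [Nat.mul_comm, Nat.mul_add_div hB, Nat.div_eq_of_lt hj, Nat.add_zero]
          have := hfresh _ (by rwa [hdiv]) i 0 h4
          rw [Finset.mem_filter, Finset.mem_insert, ← this, hdiv] at hi
          tauto
    have hne₁ : Φ₁.Nonempty := by
      rw [← Finset.card_pos]
      by_contra h0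
      have : Φ₁.card = 0 := by omega
      rw [this, Nat.mul_zero] at hcard₁
      have := Finset.card_pos.2 ⟨σ₀, hσ₀⟩
      omega
    have hsub₁ : (Φ₁ : Set (List (Item S n))) ⊆ Φ := Finset.coe_subset.2 hΦ₁
    -- The newly completed records, small ones `G₁` and large ones `G₂`, are merged into those in
    -- memory. The large ones have a known order, so two sets of at most `B` ranks decide
    -- everything.
    obtain ⟨Φ₂, hΦ₂, hcard₂, hag₂⟩ := exists_class_merge hne₁ (fun σ hσ => hl σ (hΦ₁ hσ))
      (G₀ := G₀) (G₁ := G₁) (G₂ := G₂) (N := p.M + p.B) (B := p.B) (by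
        rw [hG₁₂, Finset.disjoint_left]
        intro x hx hx'
        exact (Finset.mem_filter.1 hx').2.2 (Finset.mem_filter.1 hx).2)
      ((Finset.card_union_le _ _).trans (by rw [hG₁₂]; omega)) (by rwa [hG₁₂])
      (hin.mono hsub₁ fun x hx => (Finset.mem_filter.1 hx).2) hag₁
      (hlarge.mono hsub₁ fun x hx => by simpa using (Finset.mem_filter.1 hx).2)
    rw [hG₁₂] at hag₂
    have hsub₂ : (Φ₂ : Set (List (Item S n))) ⊆ Φ := (Finset.coe_subset.2 hΦ₂).trans hsub₁
    have hX : ∀ x, InMemory p.w (c.mem ∪ blk) x → x ∈ (G₀ ∪ N : Finset (Item S n)) := by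
      intro x hx
      rw [Finset.mem_union, Finset.mem_filter, Finset.mem_filter]
      by_cases h : InMemory p.w c.mem x
      · exact .inl ⟨Finset.mem_univ _, h⟩
      · exact .inr ⟨Finset.mem_univ _, hx, h⟩
    have := ih (c := ⟨(c.mem ∪ blk) ∩ K, c.disk⟩) (t := t - 1) (Φ := Φ₂) (T := insert b T)
      (fun σ hσ => hl σ (hΦ₁ (hΦ₂ hσ))) (fun σ hσ => by
        obtain ⟨t', a', d', ht', hr, hs⟩ := hrun σ (hΦ₁ (hΦ₂ hσ))
        cases hr with
        | read _ hr => exact ⟨_, a', d', by omega, hr, hs⟩) ht.2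
      (hag₂.mono subset_rfl fun x hx => hX x fun j hj => (Finset.mem_inter.1 (hx j hj)).1)
      (hlarge.mono hsub₂ subset_rfl)
      (fun a ha => hfresh a fun h => ha (Finset.mem_insert_of_mem h)) (fun b' hb' => by
        rcases Finset.mem_insert.1 hb' with rfl | hb'
        · refine hag₂.mono subset_rfl fun x hx => hX x fun j hj => ?_
          rw [itemSize_of_isLeft hx.1] at hj
          obtain rfl : j = 0 := by omega
          exact Finset.mem_union_right _ hx.2
        · exact (hT b' hb').mono hsub₂ subset_rfl)
    generalize (Finset.univ.filter fun i : Fin S => (i : ℕ) / p.B ∉ insert b T).card = r at hm this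
    calc Φ.card ≤ p.B ^ m * (q * (q ^ (t - 1) * p.B ^ r)) :=
          hcard₁.trans (Nat.mul_le_mul_left _ (hcard₂.trans (Nat.mul_le_mul_left _ this)))
      _ = q ^ (t - 1 + 1) * p.B ^ (m + r) := by rw [pow_succ, pow_add]; ring
      _ ≤ _ := by
        rw [Nat.sub_add_cancel ht.1]
        exact Nat.mul_le_mul_left _ (Nat.pow_le_pow_right hB hm)
  | write b f A ih =>
    rcases Φ.eq_empty_or_nonempty with rfl | hne
    · simp
    obtain ⟨σ₀, hσ₀⟩ := hne
    have ht : 1 ≤ t ∧ ∀ j < p.B, ∀ x, f j = some x → x ∈ c.mem := by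
      obtain ⟨t', a', d', ht', hr, hs⟩ := hrun σ₀ hσ₀
      cases hr with
      | write hm _ => exact ⟨by omega, hm⟩
    have hdiv : ∀ b' j, j < p.B → (b' * p.B + j) / p.B = b' := fun b' j hj => by
      rw [Nat.mul_comm, Nat.mul_add_div hB, Nat.div_eq_of_lt hj, Nat.add_zero]
    have := ih (c := ⟨c.mem, writeBlock p.B c.disk b f⟩) (t := t - 1) (Φ := Φ) (T := insert b T)
      hl (fun σ hσ => by
        obtain ⟨t', a', d', ht', hr, hs⟩ := hrun σ hσ
        cases hr with
        | write _ hr => exact ⟨_, a', d', by omega, hr, hs⟩) hmem hin hlarge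
      (fun a ha i k h => by
        rw [Finset.mem_insert, not_or] at ha
        simp only [writeBlock, if_neg ha.1] at h
        exact hfresh a ha.2 i k h) (fun b' hb' => by
        by_cases hbb : b' = b
        · subst hbb
          -- What is written comes from memory, where the order is known; so a write makes the block
          -- known at no loss.
          refine hin.mono subset_rfl fun x hx j hj => ?_
          rw [itemSize_of_isLeft hx.1] at hj
          obtain rfl : j = 0 := by omega
          obtain ⟨i, hi, h⟩ := mem_blockCells.1 hx.2
          simp only [writeBlock, hdiv b' i hi, if_pos] at h
          exact ht.2 _ (Nat.mod_lt _ hB) _ h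
        · refine (hT b' ((Finset.mem_insert.1 hb').resolve_left hbb)).mono subset_rfl fun x hx => ?_
          refine ⟨hx.1, ?_⟩
          obtain ⟨i, hi, h⟩ := mem_blockCells.1 hx.2
          simp only [writeBlock, hdiv b' i hi, if_neg hbb] at h
          exact mem_blockCells.2 ⟨i, hi, h⟩)
    refine this.trans (Nat.mul_le_mul (Nat.pow_le_pow_right hq1 (Nat.sub_le _ _))
      (Nat.pow_le_pow_right hB (Finset.card_le_card fun i hi => ?_)))
    rw [Finset.mem_filter, Finset.mem_insert] at hi
    rw [Finset.mem_filter]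
    tauto
  | compare x y A A' ih ih' =>
    rcases Φ.eq_empty_or_nonempty with rfl | hne
    · simp
    obtain ⟨σ₀, hσ₀⟩ := hne
    have hxy : InMemory p.w c.mem x ∧ InMemory p.w c.mem y := by
      obtain ⟨t', a', d', ht', hr, hs⟩ := hrun σ₀ hσ₀
      cases hr with
      | compare_lt hx hy _ _ => exact ⟨hx, hy⟩
      | compare_not_lt hx hy _ _ => exact ⟨hx, hy⟩
    -- The order in memory is already known, so all surviving orders take the same branch and the
    -- comparison costs nothing.
    by_cases hb : Before σ₀ x y
    · refine ih hl (fun σ hσ => ?_) hmem hin hlarge hfresh hT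
      have hbσ := hin σ₀ hσ₀ σ hσ x hxy.1 y hxy.2 hb
      obtain ⟨t', a', d', ht', hr, hs⟩ := hrun σ hσ
      cases hr with
      | compare_lt _ _ _ hr => exact ⟨t', a', d', ht', hr, hs⟩
      | compare_not_lt _ _ hlt _ => exact absurd hbσ hlt
    · refine ih' hl (fun σ hσ => ?_) hmem hin hlarge hfresh hT
      have hbσ : ¬ Before σ x y := fun h => hb (hin σ hσ σ₀ hσ₀ x hxy.1 y hxy.2 h)
      obtain ⟨t', a', d', ht', hr, hs⟩ := hrun σ hσ
      cases hr with
      | compare_lt _ _ hlt _ => exact absurd hlt hbσ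
      | compare_not_lt _ _ _ hr => exact ⟨t', a', d', ht', hr, hs⟩

/-- The number of cells of the large record `u` in memory. -/
def cellsIn (w : ℕ) (mem : Finset (Cell S n)) (u : Fin n) : ℕ :=
  ((Finset.range w).filter fun j => ((.inr u, j) : Cell S n) ∈ mem).card

/-- The potential of a memory state, when the order of the large records in `R` is known. -/
def potential (w : ℕ) (mem : Finset (Cell S n)) (R : Finset (Fin n)) : ℕ :=
  ∑ u, if u ∈ R then w else 2 * cellsIn w mem u

theorem sum_cellsIn_le (w : ℕ) (mem : Finset (Cell S n)) : ∑ u, cellsIn w mem u ≤ mem.card := by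
  unfold cellsIn
  rw [← Finset.card_sigma]
  refine Finset.card_le_card_of_injOn (fun z => (.inr z.1, z.2)) ?_ ?_
  · rintro ⟨u, j⟩ hz
    rw [Finset.mem_coe, Finset.mem_sigma, Finset.mem_filter] at hz
    exact hz.2.2
  · rintro ⟨u, j⟩ - ⟨u', j'⟩ - h
    simp only [Prod.mk.injEq, Sum.inr.injEq] at h
    obtain ⟨rfl, rfl⟩ := h
    rfl

/-- A record of unknown order counts `2 w` when it is completely in memory, and `w` once it is
known. The released `w` pays for one insertion, because the cardinality appears with exponent `w`.
-/
theorem potential_insert {w : ℕ} {mem : Finset (Cell S n)} {R : Finset (Fin n)} {u : Fin n}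
    (hu : u ∉ R) (hm : InMemory w mem (.inr u)) :
    potential w mem (insert u R) + w = potential w mem R := by
  have hc : cellsIn w mem u = w := by
    unfold cellsIn
    rw [Finset.filter_true_of_mem, Finset.card_range]
    exact fun j hj => hm j (Finset.mem_range.1 hj)
  unfold potential
  rw [← Finset.add_sum_erase _ _ (Finset.mem_univ u), ← Finset.add_sum_erase _ _ (Finset.mem_univ u),
    if_pos (Finset.mem_insert_self _ _), if_neg hu, hc]
  have : ∑ x ∈ Finset.univ.erase u, (if x ∈ insert u R then w else 2 * cellsIn w mem x) =
      ∑ x ∈ Finset.univ.erase u, (if x ∈ R then w else 2 * cellsIn w mem x) := by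
    refine Finset.sum_congr rfl fun x hx => ?_
    have := Finset.ne_of_mem_erase hx
    simp [this]
  rw [this]
  ring

/-- The predecessors of `u` in `R` are an initial segment of the known order on `R`, so their number
determines them. -/
theorem agree_insert {Φ : Finset (List (Item S n))} (hl : ∀ σ ∈ Φ, IsListing σ)
    {R : Finset (Fin n)} {u : Fin n} (hu : u ∉ R)
    (hR : Agree (Φ : Set (List (Item S n))) (Sum.inr '' R)) {v : ℕ}
    (hv : ∀ σ ∈ Φ, (R.filter fun r => Before σ (.inr r) (.inr u)).card = v) :
    Agree (Φ : Set (List (Item S n))) (Sum.inr '' (insert u R : Finset (Fin n))) := by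
  have key : ∀ σ ∈ Φ, ∀ σ' ∈ Φ, ∀ r ∈ R, Before σ (.inr r) (.inr u) →
      Before σ' (.inr r) (.inr u) := by
    intro σ hσ σ' hσ' r hr hb
    by_contra hnb
    have hub : Before σ' (.inr u) (.inr r) :=
      ((hl σ' hσ').before_or (by rintro h; cases h; exact hu hr)).resolve_left hnb
    refine (Finset.card_lt_card (s := R.filter fun r => Before σ' (.inr r) (.inr u))
      (t := R.filter fun r => Before σ (.inr r) (.inr u)) ⟨fun q hq => ?_, fun hsub => ?_⟩).ne ?_
    · rw [Finset.mem_filter] at hq ⊢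
      have h1 := hR σ' hσ' σ hσ _ ⟨q, hq.1, rfl⟩ _ ⟨r, hr, rfl⟩ (hq.2.trans hub)
      exact ⟨hq.1, h1.trans hb⟩
    · exact hnb (Finset.mem_filter.1 (hsub (Finset.mem_filter.2 ⟨hr, hb⟩))).2
    · rw [hv σ hσ, hv σ' hσ']
  rintro σ hσ σ' hσ' _ ⟨x, hx, rfl⟩ _ ⟨y, hy, rfl⟩ hxy
  rw [Finset.coe_insert] at hx hy
  rcases hx with rfl | hx <;> rcases hy with rfl | hy
  · exact absurd hxy (before_irrefl _ _)
  · rcases (hl σ' hσ').before_or (x := .inr x) (y := .inr y)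
      (by rintro h; cases h; exact before_irrefl _ _ hxy) with h | h
    · exact h
    · exact absurd hxy (key σ' hσ' σ hσ y hy h).asymm
  · exact key σ hσ σ' hσ' x hx hxy
  · exact hR σ hσ σ' hσ' _ ⟨x, hx, rfl⟩ _ ⟨y, hy, rfl⟩ hxy

/-- Inserting `u` into `R` has `R.card + 1` outcomes, and this is at most `F`: each record in `R`
has at least half of its cells in memory, so `R.card * w ≤ 2 * M`. The lost factor `F ^ w` is the
decrease of the potential. -/
theorem card_pow_le_of_insert {w M F E : ℕ} {mem : Finset (Cell S n)} (hmem : mem.card ≤ M)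
    (hF : ∀ r, r * w ≤ 2 * M → r + 1 ≤ F) {R : Finset (Fin n)} {u : Fin n}
    (hm : InMemory w mem (.inr u)) (hRc : ∀ x ∈ R, w ≤ 2 * cellsIn w mem x)
    {Φ : Finset (List (Item S n))} (hl : ∀ σ ∈ Φ, IsListing σ)
    (hR : Agree (Φ : Set (List (Item S n))) (Sum.inr '' R))
    (h : ∀ Φ' ⊆ Φ, Agree (Φ' : Set (List (Item S n))) (Sum.inr '' (insert u R : Finset (Fin n))) →
      Φ'.card ^ w ≤ F ^ (E + potential w mem (insert u R))) :
    Φ.card ^ w ≤ F ^ (E + potential w mem R) := by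
  by_cases hu : u ∈ R
  · rw [Finset.insert_eq_of_mem hu] at h
    exact h Φ subset_rfl hR
  rcases Φ.eq_empty_or_nonempty with rfl | hne
  · have := h ∅ subset_rfl (by intro σ hσ; simp at hσ)
    refine this.trans (Nat.pow_le_pow_right (hF 0 (by omega)) ?_)
    have := potential_insert hu hm
    omega
  obtain ⟨v, hv⟩ := exists_large_class hne
    (fun σ => (R.filter fun r => Before σ (.inr r) (.inr u)).card) (Finset.range (R.card + 1))
    fun σ _ => Finset.mem_range.2 (Nat.lt_succ_of_le (Finset.card_filter_le _ _))
  rw [Finset.card_range] at hv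
  have hΦ' := h (Φ.filter fun σ => (R.filter fun r => Before σ (.inr r) (.inr u)).card = v)
    (Finset.filter_subset _ _) (agree_insert (fun σ hσ => hl σ (Finset.mem_filter.1 hσ).1) hu
      (hR.mono (Finset.coe_subset.2 (Finset.filter_subset _ _)) subset_rfl)
      fun σ hσ => (Finset.mem_filter.1 hσ).2)
  have hRF : R.card + 1 ≤ F := by
    refine hF _ ?_
    have h1 : ∑ x ∈ R, w ≤ ∑ x ∈ R, 2 * cellsIn w mem x := Finset.sum_le_sum hRc
    have h2 : ∑ x ∈ R, cellsIn w mem x ≤ ∑ x, cellsIn w mem x :=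
      Finset.sum_le_sum_of_subset (Finset.subset_univ R)
    have h3 := sum_cellsIn_le w mem
    rw [Finset.sum_const, smul_eq_mul, ← Finset.mul_sum] at h1
    omega
  calc Φ.card ^ w ≤ (F * _) ^ w := Nat.pow_le_pow_left (hv.trans (Nat.mul_le_mul_right _ hRF)) _
    _ = F ^ w * _ ^ w := mul_pow _ _ _
    _ ≤ F ^ w * F ^ (E + potential w mem (insert u R)) := Nat.mul_le_mul_left _ hΦ'
    _ = F ^ (E + potential w mem R) := by
      rw [← pow_add, ← potential_insert hu hm]
      congr 1
      ring

/-- The counting bound for the order of the large records: `w` cells have to be brought into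
memory before a record can be inserted into the order of the at most `2 M / w` records that are
represented in memory by at least half of their cells. -/
theorem card_pow_le_of_large (hw : 1 ≤ p.w) {F : ℕ}
    (hF : ∀ r, r * p.w ≤ 2 * p.M → r + 1 ≤ F) {A : Alg S n} {c : Conf S n} {t : ℕ}
    {Φ : Finset (List (Item S n))} {R : Finset (Fin n)} (hl : ∀ σ ∈ Φ, IsListing σ)
    (hrun : ∀ σ ∈ Φ, ∃ t' a d, t' ≤ t ∧ Runs p σ A c t' a d ∧ StoredAt p.w d a σ)
    (hmem : c.mem.card ≤ p.M)
    (hS : ∀ σ ∈ Φ, ∀ σ' ∈ Φ, ∀ x y, (x.isLeft ∨ y.isLeft) → Before σ x y → Before σ' x y)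
    (hR : Agree (Φ : Set (List (Item S n))) (Sum.inr '' R))
    (hRc : ∀ x ∈ R, p.w ≤ 2 * cellsIn p.w c.mem x) :
    Φ.card ^ p.w ≤ F ^ (2 * (t * p.B) + potential p.w c.mem R) := by
  have hF1 : 1 ≤ F := hF 0 (by omega)
  induction A generalizing c t Φ R with
  | halt a =>
    refine le_trans (Nat.pow_le_pow_left (card_le_one_of_storedAt hw hl (a := a) (d := c.disk)
      fun σ hσ => ?_) _) ?_
    · obtain ⟨t', a', d', -, hr, hs⟩ := hrun σ hσ
      cases hr
      exact hs
    · rw [one_pow]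
      exact Nat.one_le_pow _ _ hF1
  | read b K A ih =>
    rcases Φ.eq_empty_or_nonempty with rfl | ⟨σ₀, hσ₀⟩
    · rw [Finset.card_empty, zero_pow (by omega)]
      exact Nat.zero_le _
    set blk := blockCells p.B c.disk b with hblk
    have ht : 1 ≤ t ∧ ((c.mem ∪ blk) ∩ K).card ≤ p.M := by
      obtain ⟨t', a', d', ht', hr, hs⟩ := hrun σ₀ hσ₀
      cases hr with
      | read hm _ => exact ⟨by omega, hm⟩
    set mem' := (c.mem ∪ blk) ∩ K with hmem'
    -- A record is forgotten when fewer than half of its cells remain. It then counts less than the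
    -- `w` it counted before, so forgetting does not raise the potential.
    set R' := R.filter fun x => p.w ≤ 2 * cellsIn p.w mem' x with hR'
    have := ih (c := ⟨mem', c.disk⟩) (t := t - 1) (R := R') hl (fun σ hσ => by
        obtain ⟨t', a', d', ht', hr, hs⟩ := hrun σ hσ
        cases hr with
        | read _ hr => exact ⟨_, a', d', by omega, hr, hs⟩) ht.2 hS
      (hR.mono subset_rfl (Set.image_mono (Finset.coe_subset.2 (Finset.filter_subset _ _))))
      fun x hx => (Finset.mem_filter.1 hx).2
    refine this.trans (Nat.pow_le_pow_right hF1 ?_)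
    have hcell : ∀ u, cellsIn p.w mem' u ≤ cellsIn p.w c.mem u + cellsIn p.w blk u := by
      intro u
      unfold cellsIn
      refine le_trans (Finset.card_le_card fun j hj => ?_) (Finset.card_union_le _ _)
      rw [Finset.mem_filter] at hj
      rw [Finset.mem_union, Finset.mem_filter, Finset.mem_filter]
      have := Finset.mem_union.1 (Finset.mem_inter.1 hj.2).1
      tauto
    -- Each cell of the block raises the potential by at most `2`, hence the `2 * (t * B)` in the
    -- exponent.
    have hpot : potential p.w mem' R' ≤ potential p.w c.mem R + 2 * ∑ u, cellsIn p.w blk u := by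
      unfold potential
      rw [Finset.mul_sum, ← Finset.sum_add_distrib]
      refine Finset.sum_le_sum fun u _ => ?_
      have := hcell u
      by_cases h1 : u ∈ R
      · by_cases h2 : u ∈ R'
        · rw [if_pos h1, if_pos h2]
          omega
        · have : 2 * cellsIn p.w mem' u < p.w := by
            by_contra h3
            exact h2 (Finset.mem_filter.2 ⟨h1, by omega⟩)
          rw [if_pos h1, if_neg h2]
          omega
      · have h2 : u ∉ R' := fun h => h1 (Finset.mem_filter.1 h).1
        rw [if_neg h1, if_neg h2]
        omega
    have hblkB : ∑ u, cellsIn p.w blk u ≤ p.B :=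
      (sum_cellsIn_le _ _).trans (card_blockCells_le _ _ _)
    obtain ⟨t, rfl⟩ := Nat.exists_eq_add_of_le' ht.1
    rw [Nat.add_sub_cancel, Nat.add_mul]
    dsimp only
    omega
  | write b f A ih =>
    rcases Φ.eq_empty_or_nonempty with rfl | ⟨σ₀, hσ₀⟩
    · rw [Finset.card_empty, zero_pow (by omega)]
      exact Nat.zero_le _
    have := ih (c := ⟨c.mem, writeBlock p.B c.disk b f⟩) (t := t) (R := R) hl (fun σ hσ => by
        obtain ⟨t', a', d', ht', hr, hs⟩ := hrun σ hσ
        cases hr with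
        | write _ hr => exact ⟨_, a', d', by omega, hr, hs⟩) hmem hS hR hRc
    exact this
  | compare x y A A' ih ih' =>
    -- If all surviving orders agree on the answer, only one branch is relevant, and its induction
    -- hypothesis applies.
    have hbranch : ∀ (Φ' : Finset (List (Item S n))) (R' : Finset (Fin n)), Φ' ⊆ Φ →
        (∀ σ ∈ Φ', ∀ σ' ∈ Φ', Before σ x y → Before σ' x y) →
        Agree (Φ' : Set (List (Item S n))) (Sum.inr '' R') →
        (∀ x ∈ R', p.w ≤ 2 * cellsIn p.w c.mem x) →
        Φ'.card ^ p.w ≤ F ^ (2 * (t * p.B) + potential p.w c.mem R') := by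
      intro Φ' R' hΦ' hag hR' hRc'
      rcases Φ'.eq_empty_or_nonempty with rfl | ⟨σ₀, hσ₀⟩
      · rw [Finset.card_empty, zero_pow (by omega)]
        exact Nat.zero_le _
      by_cases hb : Before σ₀ x y
      · refine ih (fun σ hσ => hl σ (hΦ' hσ)) (fun σ hσ => ?_) hmem
          (fun σ hσ σ' hσ' => hS σ (hΦ' hσ) σ' (hΦ' hσ')) hR' hRc'
        have hbσ := hag σ₀ hσ₀ σ hσ hb
        obtain ⟨t', a', d', ht', hr, hs⟩ := hrun σ (hΦ' hσ)
        cases hr with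
        | compare_lt _ _ _ hr => exact ⟨t', a', d', ht', hr, hs⟩
        | compare_not_lt _ _ hlt _ => exact absurd hbσ hlt
      · refine ih' (fun σ hσ => hl σ (hΦ' hσ)) (fun σ hσ => ?_) hmem
          (fun σ hσ σ' hσ' => hS σ (hΦ' hσ) σ' (hΦ' hσ')) hR' hRc'
        have hbσ : ¬ Before σ x y := fun h => hb (hag σ hσ σ₀ hσ₀ h)
        obtain ⟨t', a', d', ht', hr, hs⟩ := hrun σ (hΦ' hσ)
        cases hr with
        | compare_lt _ _ hlt _ => exact absurd hlt hbσ
        | compare_not_lt _ _ _ hr => exact ⟨t', a', d', ht', hr, hs⟩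
    -- Only the order of large records varies in the family, so the answer to a comparison with a
    -- small record is known.
    by_cases hleft : x.isLeft ∨ y.isLeft
    · exact hbranch Φ R subset_rfl (fun σ hσ σ' hσ' => hS σ hσ σ' hσ' x y hleft) hR hRc
    rcases Φ.eq_empty_or_nonempty with rfl | ⟨σ₀, hσ₀⟩
    · rw [Finset.card_empty, zero_pow (by omega)]
      exact Nat.zero_le _
    have hxy : InMemory p.w c.mem x ∧ InMemory p.w c.mem y := by
      obtain ⟨t', a', d', ht', hr, hs⟩ := hrun σ₀ hσ₀
      cases hr with
      | compare_lt hx hy _ _ => exact ⟨hx, hy⟩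
      | compare_not_lt hx hy _ _ => exact ⟨hx, hy⟩
    obtain ⟨u, rfl⟩ : ∃ u, x = .inr u := by
      cases x
      · simp at hleft
      · exact ⟨_, rfl⟩
    obtain ⟨v, rfl⟩ : ∃ v, y = .inr v := by
      cases y
      · simp at hleft
      · exact ⟨_, rfl⟩
    have hfull : ∀ z : Fin n, InMemory p.w c.mem (.inr z : Item S n) →
        p.w ≤ 2 * cellsIn p.w c.mem z := by
      intro z hz
      have : cellsIn p.w c.mem z = p.w := by
        unfold cellsIn
        rw [Finset.filter_true_of_mem, Finset.card_range]
        exact fun j hj => hz j (Finset.mem_range.1 hj)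
      omega
    have hRc' : ∀ z ∈ insert u R, p.w ≤ 2 * cellsIn p.w c.mem z := by
      intro z hz
      rcases Finset.mem_insert.1 hz with rfl | hz
      · exact hfull _ hxy.1
      · exact hRc z hz
    -- Both compared records are complete in memory; once they are inserted into the known order,
    -- the answer is known.
    refine card_pow_le_of_insert hmem hF hxy.1 hRc hl hR fun Φ₁ hΦ₁ hag₁ => ?_
    refine card_pow_le_of_insert hmem hF hxy.2 hRc' (fun σ hσ => hl σ (hΦ₁ hσ)) hag₁
      fun Φ₂ hΦ₂ hag₂ => ?_
    refine hbranch Φ₂ _ (hΦ₂.trans hΦ₁) (fun σ hσ σ' hσ' => hag₂ σ hσ σ' hσ' _ ⟨u, by simp, rfl⟩ _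
      ⟨v, by simp, rfl⟩) hag₂ fun z hz => ?_
    rcases Finset.mem_insert.1 hz with rfl | hz
    · exact hfull _ hxy.2
    · exact hRc' z hz

end

/-! ### Inputs with given stripe sizes -/

/-- The lists `bs`, separated by the elements of `ss`. -/
def weave {α : Type*} : List (List α) → List α → List α
  | [], ss => ss
  | b :: bs, [] => (b :: bs).flatten
  | b :: bs, s :: ss => b ++ s :: weave bs ss

theorem weave_perm {α : Type*} (bs : List (List α)) (ss : List α) :
    (weave bs ss).Perm (bs.flatten ++ ss) := by
  induction bs generalizing ss with
  | nil => simp [weave]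
  | cons b bs ih =>
    cases ss with
    | nil => simp [weave]
    | cons s ss =>
      rw [weave, List.flatten_cons, List.append_assoc]
      exact ((ih ss).cons s |>.trans List.perm_middle.symm).append_left b

theorem filter_weave {α : Type*} {P : α → Bool} {bs : List (List α)} {ss : List α}
    (hb : ∀ b ∈ bs, ∀ x ∈ b, ¬ P x) (hs : ∀ s ∈ ss, P s) : (weave bs ss).filter P = ss := by
  have h0 : ∀ b : List α, (∀ x ∈ b, ¬ P x) → b.filter P = [] := fun b => List.filter_eq_nil_iff.2
  induction bs generalizing ss with
  | nil => exact List.filter_eq_self.2 hs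
  | cons b bs ih =>
    cases ss with
    | nil =>
      rw [weave]
      refine h0 _ fun x hx => ?_
      obtain ⟨c, hc, hx⟩ := List.mem_flatten.1 hx
      exact hb c hc x hx
    | cons s ss =>
      rw [weave, List.filter_append, h0 b (hb b List.mem_cons_self),
        List.filter_cons_of_pos (hs s List.mem_cons_self),
        ih (fun c hc => hb c (List.mem_cons_of_mem _ hc)) fun r hr => hs r (List.mem_cons_of_mem _ hr)]
      rfl

/-- Separators left over when the lists have run out create only empty pieces, which the filter
removes. The length condition prevents two lists from being joined without a separator. -/
theorem splitOnP_weave {α : Type*} {P : α → Bool} {bs : List (List α)} {ss : List α}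
    (hne : ∀ b ∈ bs, b ≠ []) (hb : ∀ b ∈ bs, ∀ x ∈ b, ¬ P x) (hs : ∀ s ∈ ss, P s)
    (hlen : bs.length ≤ ss.length + 1) :
    (((weave bs ss).splitOnP P).map List.length).filter (fun m => m ≠ 0) = bs.map List.length := by
  induction bs generalizing ss with
  | nil =>
    induction ss with
    | nil => simp [weave]
    | cons s ss ih =>
      have := ih (fun r hr => hs r (List.mem_cons_of_mem _ hr)) (by simp)
      rw [weave] at this ⊢
      rw [List.splitOnP_cons_eq_if_modifyHead, if_pos (hs s List.mem_cons_self), List.map_cons,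
        List.filter_cons_of_neg (by simp)]
      exact this
  | cons b bs ih =>
    have hbne : b.length ≠ 0 := fun h => hne b List.mem_cons_self (List.length_eq_zero_iff.1 h)
    cases ss with
    | nil =>
      obtain rfl : bs = [] := List.length_eq_zero_iff.1 (by simpa using hlen)
      rw [weave, List.flatten_cons, List.flatten_nil, List.append_nil,
        List.splitOnP_eq_singleton fun x hx => by simpa using hb b List.mem_cons_self x hx]
      simpa using hbne
    | cons s ss =>
      rw [weave, List.splitOnP_append_cons_of_forall_mem
        (fun x hx => by simpa using hb b List.mem_cons_self x hx) s
        (hs s List.mem_cons_self), List.map_cons, List.map_cons, List.filter_cons_of_pos (by simpa using hbne),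
        ih (fun c hc => hne c (List.mem_cons_of_mem _ hc))
        (fun c hc => hb c (List.mem_cons_of_mem _ hc)) (fun r hr => hs r (List.mem_cons_of_mem _ hr))
        (by simpa using hlen)]

/-- No separator lies inside one of the lists `bs`, so a separator is on the same side of all its
elements. -/
theorem idxOf_weave_lt {α : Type*} [BEq α] [LawfulBEq α] {P : α → Bool} {bs : List (List α)}
    {ss : List α} (hnd : (weave bs ss).Nodup) (hb : ∀ b ∈ bs, ∀ x ∈ b, ¬ P x) (hs : ∀ s ∈ ss, P s)
    {b : List α} (hbm : b ∈ bs) {x y s : α} (hx : x ∈ b) (hy : y ∈ b) (hsm : s ∈ ss)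
    (h : (weave bs ss).idxOf s < (weave bs ss).idxOf x) :
    (weave bs ss).idxOf s < (weave bs ss).idxOf y := by
  induction bs generalizing ss with
  | nil => simp at hbm
  | cons c bs ih =>
    cases ss with
    | nil => simp at hsm
    | cons r ss =>
      rw [weave] at h hnd ⊢
      have hsc : s ∉ c := fun h => hb c List.mem_cons_self s h (hs s hsm)
      rw [List.idxOf_append_of_notMem hsc] at h ⊢
      rcases List.mem_cons.1 hbm with rfl | hbm
      · have := List.idxOf_lt_length_iff.2 hx
        rw [List.idxOf_append_of_mem hx] at h
        omega
      · have hout : ∀ z ∈ b, z ∉ c ∧ r ≠ z := by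
          intro z hz
          have hzw : z ∈ weave bs ss :=
            (weave_perm _ _).mem_iff.2 (List.mem_append_left _ (List.mem_flatten.2 ⟨b, hbm, hz⟩))
          refine ⟨fun hzc => ?_, ?_⟩
          · exact (List.disjoint_of_nodup_append hnd) hzc (List.mem_cons_of_mem _ hzw)
          · rintro rfl
            exact (List.nodup_cons.1 (List.nodup_append.1 hnd).2.1).1 hzw
        rw [List.idxOf_append_of_notMem (hout _ hx).1, List.idxOf_cons_ne _ (hout _ hx).2] at h
        rw [List.idxOf_append_of_notMem (hout _ hy).1, List.idxOf_cons_ne _ (hout _ hy).2]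
        by_cases hrs : r = s
        · subst hrs
          simp
        · rw [List.idxOf_cons_ne _ hrs] at h ⊢
          have := ih (List.nodup_cons.1 (List.nodup_append.1 hnd).2.1).2
            (fun c hc => hb c (List.mem_cons_of_mem _ hc))
            (fun r hr => hs r (List.mem_cons_of_mem _ hr)) hbm
            ((List.mem_cons.1 hsm).resolve_left fun h => hrs h.symm) (by omega)
          omega

section

variable {S n : ℕ} {p : Params}

/-- There is a sorted order with the given stripe sizes that begins with a stripe. `E ⟨i, j⟩` is
the `j`-th record of stripe `i`. -/
theorem exists_order {ℓ : List ℕ} (hℓ : IsProfile S n ℓ) (hn : 1 ≤ n) :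
    ∃ σ : List (Item S n), IsListing σ ∧ SmallSorted σ ∧ stripeSizes σ = ℓ ∧
      (∃ x, σ.idxOf x = 0 ∧ x.isLeft = false) ∧
      ∃ E : (Σ i : Fin ℓ.length, Fin ℓ[i]) ≃ Fin n, ∀ i j j' s,
        Before σ (.inl s) (.inr (E ⟨i, j⟩)) → Before σ (.inl s) (.inr (E ⟨i, j'⟩)) := by
  obtain ⟨hsum, hpos, hlen⟩ := hℓ
  have hsum' : ∑ i : Fin ℓ.length, ℓ[i] = n := by
    rw [← hsum, ← List.sum_ofFn]
    simp
  let E : (Σ i : Fin ℓ.length, Fin ℓ[i]) ≃ Fin n := finSigmaFinEquiv.trans (finCongr hsum')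
  set bs : List (List (Item S n)) := List.ofFn fun i : Fin ℓ.length =>
    (List.finRange ℓ[i]).map fun j => Sum.inr (E ⟨i, j⟩) with hbs
  set ss : List (Item S n) := (List.finRange S).map Sum.inl with hss
  have hmem : ∀ i, ((List.finRange ℓ[i]).map fun j => (Sum.inr (E ⟨i, j⟩) : Item S n)) ∈ bs :=
    fun i => (List.mem_ofFn' _ _).2 ⟨i, rfl⟩
  have hb' : ∀ b ∈ bs, ∃ i : Fin ℓ.length, b = (List.finRange ℓ[i]).map fun j => Sum.inr (E ⟨i, j⟩) := by
    intro b hb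
    obtain ⟨i, rfl⟩ := (List.mem_ofFn' _ _).1 hb
    exact ⟨i, rfl⟩
  have hb : ∀ b ∈ bs, ∀ x ∈ b, ¬ x.isLeft := by
    intro b hb x hx
    obtain ⟨i, rfl⟩ := hb' b hb
    obtain ⟨j, -, rfl⟩ := List.mem_map.1 hx
    simp
  have hs : ∀ s ∈ ss, s.isLeft := by
    intro s hs
    obtain ⟨j, -, rfl⟩ := List.mem_map.1 hs
    rfl
  have hne : ∀ b ∈ bs, b ≠ [] := by
    intro b hb h
    obtain ⟨i, rfl⟩ := hb' b hb
    have h1 := congrArg List.length h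
    have h2 := hpos ℓ[i] (List.getElem_mem _)
    simp only [List.length_map, List.length_finRange, List.length_nil] at h1
    omega
  have hin : ∀ x, x ∈ weave bs ss := by
    intro x
    rw [(weave_perm _ _).mem_iff, List.mem_append]
    rcases x with i | u
    · exact .inr (List.mem_map.2 ⟨i, List.mem_finRange i, rfl⟩)
    · refine .inl (List.mem_flatten.2 ⟨_, hmem (E.symm u).1, List.mem_map.2
        ⟨(E.symm u).2, List.mem_finRange _, ?_⟩⟩)
      simp
  have hbl : bs.map List.length = ℓ := by
    rw [hbs, List.map_ofFn]
    conv_rhs => rw [← List.ofFn_getElem (xs := ℓ)]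
    congr 1
    ext i
    simp
  have hlist : IsListing (weave bs ss) := by
    refine ⟨?_, hin⟩
    -- A list that contains all records and has just as many entries has no duplicates.
    have hcard : (weave bs ss).length = Fintype.card (Item S n) := by
      rw [(weave_perm _ _).length_eq, List.length_append, List.length_flatten, hbl, hsum, hss]
      simp [add_comm]
    have : (weave bs ss).toFinset = Finset.univ := by
      ext x
      simpa using hin x
    exact Multiset.coe_nodup.1 (Multiset.toFinset_card_eq_card_iff_nodup.1
      (by rw [← List.toFinset_coe] at this; rw [this, Multiset.coe_card, hcard, Finset.card_univ]))
  have hlen' : bs.length ≤ ss.length + 1 := by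
    simpa [hbs, hss] using hlen
  refine ⟨weave bs ss, hlist, fun i j hij => ?_, ?_, ?_, E, fun i j j' s h => ?_⟩
  · have h1 := filter_weave hb hs
    have h2 : ss.Pairwise (Before (weave bs ss)) := by
      refine hlist.pairwise.sublist ?_
      conv_lhs => rw [← h1]
      exact List.filter_sublist
    have h3 : Before ss (.inl i) (.inl j) := by
      unfold Before
      rw [hss, idxOf_map_of_injective Sum.inl_injective, idxOf_map_of_injective Sum.inl_injective]
      simpa using hij
    exact pairwise_of_before h2 (List.mem_map.2 ⟨j, List.mem_finRange j, rfl⟩) h3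
  · exact (splitOnP_weave hne hb hs hlen').trans hbl
  · have : bs ≠ [] := by
      intro h
      rw [h] at hbl
      subst hbl
      simp at hsum
      omega
    obtain ⟨b, bs', hbb⟩ := List.exists_cons_of_ne_nil this
    have hbm : b ∈ bs := by rw [hbb]; exact List.mem_cons_self
    obtain ⟨x, b', hb''⟩ := List.exists_cons_of_ne_nil (hne b hbm)
    refine ⟨x, ?_, by simpa using hb b hbm x (by rw [hb'']; exact List.mem_cons_self)⟩
    rw [hbb, hb'']
    cases ss <;> simp [weave]
  · exact idxOf_weave_lt hlist.1 hb hs (hmem i) (List.mem_map.2 ⟨j, List.mem_finRange j, rfl⟩)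
      (List.mem_map.2 ⟨j', List.mem_finRange j', rfl⟩)
      (List.mem_map.2 ⟨s, List.mem_finRange s, rfl⟩) h

/-! ### The counting bounds for families of permuted inputs. -/

theorem card_image_map {σ : List (Item S n)} (hσ : IsListing σ) {ι : Type*} [Fintype ι]
    [DecidableEq (List (Item S n))] {e : ι → Equiv.Perm (Item S n)} (he : Function.Injective e) :
    (Finset.univ.image fun i => σ.map (e i)).card = Fintype.card ι := by
  rw [Finset.card_image_of_injective, Finset.card_univ]
  intro i j h
  refine he (Equiv.ext fun x => ?_)
  exact List.map_inj_left.1 h x (hσ.2 x)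

/-- The family consists of one order with the given stripe sizes under all permutations of the small
records. The large records keep their relative order, as the counting bound requires. -/
theorem factorial_smalls_le (hB : 1 ≤ p.B) (hw : 1 ≤ p.w) (hn : 1 ≤ n) {ℓ : List ℕ}
    (hℓ : IsProfile S n ℓ) {A : Alg S n} (hA : SolvesSort p (pleLayout S n) A) {t : ℕ}
    (ht : SortCostLE p (pleLayout S n) A ℓ t) :
    S.factorial ≤ ((smallSets (p.M + p.B) p.B).card ^ 2) ^ t * p.B ^ S := by
  classical
  obtain ⟨σ, hσ, -, hst, -, -⟩ := exists_order hℓ hn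
  set e : Equiv.Perm (Fin S) → Equiv.Perm (Item S n) := fun π => Equiv.sumCongr π 1 with he
  have heinj : Function.Injective e := by
    intro π π' h
    ext i
    have := Equiv.congr_fun h (.inl i)
    simpa [he, Fin.ext_iff] using this
  have hel : ∀ π x, (e π x).isLeft = x.isLeft := by
    rintro π (x | x) <;> rfl
  set Φ : Finset (List (Item S n)) := Finset.univ.image fun π => σ.map (e π) with hΦ
  have hmemΦ : ∀ τ ∈ Φ, ∃ π, τ = σ.map (e π) := by
    intro τ hτ
    obtain ⟨π, -, rfl⟩ := Finset.mem_image.1 hτ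
    exact ⟨π, rfl⟩
  have hl : ∀ τ ∈ Φ, IsListing τ := by
    intro τ hτ
    obtain ⟨π, rfl⟩ := hmemΦ τ hτ
    exact hσ.map _
  have hemp : ∀ x : Item S n, ¬ InMemory p.w (∅ : Finset (Cell S n)) x := fun x h => by
    simpa using h 0 (itemSize_pos hw x)
  have := card_le_of_small (p := p) (A := A) (c := start p.w (pleLayout S n)) (t := t) (Φ := Φ)
    (T := ∅) hB hw hl (fun τ hτ => ?_) (by simp [start])
    (fun _ _ _ _ x hx => absurd hx (hemp x)) ?_ ?_ (by simp)
  · rw [hΦ, card_image_map hσ heinj, Fintype.card_perm, Fintype.card_fin] at this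
    simpa using this
  · obtain ⟨t', a, d, hr, hs⟩ := hA τ (hl τ hτ)
    refine ⟨t', a, d, ht τ (hl τ hτ) ?_ _ _ _ hr, hr, hs⟩
    obtain ⟨π, rfl⟩ := hmemΦ τ hτ
    rw [stripeSizes_map (hel π), hst]
  · intro τ hτ τ' hτ' x hx y hy hxy
    obtain ⟨π, rfl⟩ := hmemΦ τ hτ
    obtain ⟨π', rfl⟩ := hmemΦ τ' hτ'
    rw [before_map] at hxy ⊢
    rcases x with x | x
    · simp at hx
    rcases y with y | y
    · simp at hy
    exact hxy
  · intro a _ i k h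
    have ha : a < (contiguousCells p.w (pleLayout S n)).length := by
      by_contra h'
      simp only [start, List.getElem?_eq_none (not_lt.1 h')] at h
      simp at h
    obtain ⟨x, -, k', hk', h1, h2⟩ := exists_pos_add isListing_pleLayout.1 ha
    simp only [start, List.getElem?_eq_getElem ha, h2, Option.some.injEq, Prod.mk.injEq] at h
    obtain ⟨rfl, rfl⟩ := h
    rw [pos_pleLayout_inl] at h1
    simp only [itemSize] at hk'
    omega

/-- The family consists of one order under all permutations of the large records within their
stripes. This leaves every comparison with a small record unchanged. -/
theorem prod_factorial_le (hw : 1 ≤ p.w) (hn : 1 ≤ n) {F : ℕ}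
    (hF : ∀ r, r * p.w ≤ 2 * p.M → r + 1 ≤ F) {ℓ : List ℕ}
    (hℓ : IsProfile S n ℓ) {l : List (Item S n)} {A : Alg S n} (hA : SolvesSort p l A) {t : ℕ}
    (ht : SortCostLE p l A ℓ t) :
    (ℓ.map Nat.factorial).prod ^ p.w ≤ F ^ (2 * (t * p.B)) := by
  classical
  obtain ⟨σ, hσ, -, hst, -, E, hE⟩ := exists_order hℓ hn
  set ρ : (∀ i : Fin ℓ.length, Equiv.Perm (Fin ℓ[i])) → Equiv.Perm (Fin n) := fun τ =>
    (E.symm.trans (Equiv.sigmaCongrRight τ)).trans E with hρ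
  have hρE : ∀ τ i j, ρ τ (E ⟨i, j⟩) = E ⟨i, τ i j⟩ := by
    intro τ i j
    simp [hρ]
  set e : (∀ i : Fin ℓ.length, Equiv.Perm (Fin ℓ[i])) → Equiv.Perm (Item S n) := fun τ =>
    Equiv.sumCongr 1 (ρ τ) with he
  have heinj : Function.Injective e := by
    intro τ τ' h
    funext i
    ext j
    have := Equiv.congr_fun h (.inr (E ⟨i, j⟩))
    simp only [he, Equiv.sumCongr_apply, Sum.map_inr, Sum.inr.injEq, hρE,
      EmbeddingLike.apply_eq_iff_eq] at this
    simpa [Fin.ext_iff] using this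
  have hel : ∀ τ x, (e τ x).isLeft = x.isLeft := by
    rintro τ (x | x) <;> rfl
  set Φ : Finset (List (Item S n)) := Finset.univ.image fun τ => σ.map (e τ) with hΦ
  have hmemΦ : ∀ υ ∈ Φ, ∃ τ, υ = σ.map (e τ) := by
    intro υ hυ
    obtain ⟨τ, -, rfl⟩ := Finset.mem_image.1 hυ
    exact ⟨τ, rfl⟩
  have hl : ∀ υ ∈ Φ, IsListing υ := by
    intro υ hυ
    obtain ⟨τ, rfl⟩ := hmemΦ υ hυ
    exact hσ.map _
  -- The permutation stays inside a stripe, and a small record is on the same side of the whole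
  -- stripe.
  have hleft : ∀ τ s u, Before (σ.map (e τ)) (.inl s) (.inr u) ↔ Before σ (.inl s) (.inr u) := by
    intro τ s u
    obtain ⟨⟨i, j⟩, rfl⟩ := E.surjective u
    obtain ⟨j', rfl⟩ := (τ i).surjective j
    have h1 : (.inl s : Item S n) = e τ (.inl s) := rfl
    have h2 : (.inr (E ⟨i, τ i j'⟩) : Item S n) = e τ (.inr (E ⟨i, j'⟩)) := by
      simp [he, hρE]
    conv_lhs => rw [h1, h2, before_map_apply]
    exact ⟨hE _ _ _ _, hE _ _ _ _⟩
  have hright : ∀ τ u s, Before (σ.map (e τ)) (.inr u) (.inl s) ↔ Before σ (.inr u) (.inl s) := by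
    have key : ∀ υ : List (Item S n), IsListing υ → ∀ u s,
        Before υ (.inr u) (.inl s) ↔ ¬ Before υ (.inl s) (.inr u) := fun υ hυ u s =>
      ⟨fun h => h.asymm, fun h => (hυ.before_or (by simp)).resolve_left h⟩
    intro τ u s
    rw [key _ (hσ.map _), key _ hσ, hleft]
  have hsame : ∀ τ τ' x y, (x.isLeft ∨ y.isLeft) → Before (σ.map (e τ)) x y →
      Before (σ.map (e τ')) x y := by
    rintro τ τ' (x | x) (y | y) hxy h
    · have h1 : ∀ τ, Before (σ.map (e τ)) (.inl x) (.inl y) ↔ Before σ (.inl x) (.inl y) := by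
        intro τ
        rw [before_map]
        rfl
      rwa [h1] at h ⊢
    · rwa [hleft] at h ⊢
    · rwa [hright] at h ⊢
    · simp at hxy
  have := card_pow_le_of_large (p := p) (A := A) (c := start p.w l) (t := t) (Φ := Φ)
    (R := ∅) hw hF hl (fun υ hυ => ?_) (by simp [start]) (fun υ hυ υ' hυ' x y hxy h => ?_)
    (by rw [Finset.coe_empty, Set.image_empty]; exact agree_empty _) (by simp)
  · rw [hΦ, card_image_map hσ heinj, Fintype.card_pi] at this
    have h0 : potential p.w (start p.w l).mem ∅ = 0 := by
      simp [potential, cellsIn, start]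
    have h1 : ∏ i : Fin ℓ.length, Fintype.card (Equiv.Perm (Fin ℓ[i])) =
        (ℓ.map Nat.factorial).prod := by
      simp only [Fintype.card_perm, Fintype.card_fin]
      rw [← List.prod_ofFn]
      congr 1
      conv_rhs => rw [← List.ofFn_getElem (xs := ℓ), List.map_ofFn]
      rfl
    rwa [h0, Nat.add_zero, h1] at this
  · obtain ⟨t', a, d, hr, hs⟩ := hA υ (hl υ hυ)
    refine ⟨t', a, d, ht υ (hl υ hυ) ?_ _ _ _ hr, hr, hs⟩
    obtain ⟨τ, rfl⟩ := hmemΦ υ hυ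
    rw [stripeSizes_map (hel τ), hst]
  · obtain ⟨τ, rfl⟩ := hmemΦ υ hυ
    obtain ⟨τ', rfl⟩ := hmemΦ υ' hυ'
    exact hsame τ τ' x y hxy h

end

/-! ### Estimates -/

/-- Since 3/2 log 2 > 1, linear terms can be absorbed into logarithmic ones when the memory ratio is
at least `2`. -/
theorem le_log_mul {x : ℝ} (hx : 2 ≤ x) : 1 ≤ 3 / 2 * Real.log x := by
  have := Real.log_le_log (by norm_num) hx
  have := Real.log_two_gt_d9
  linarith

/-- From m^m / m! ≤ e^m, one term of the exponential series. -/
theorem mul_log_sub_le_log_factorial (m : ℕ) : m * Real.log m - m ≤ Real.log m.factorial := by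
  rcases Nat.eq_zero_or_pos m with rfl | hm
  · simp
  have hm' : (0 : ℝ) < m := by exact_mod_cast hm
  have h := Real.pow_div_factorial_le_exp (x := m) hm'.le m
  have h0 : (0 : ℝ) < m.factorial := by exact_mod_cast m.factorial_pos
  rw [div_le_iff₀ h0] at h
  have := Real.log_le_log (by positivity) h
  rw [Real.log_pow, Real.log_mul (by positivity) h0.ne', Real.log_exp] at this
  linarith

/-- Each set counted has weight (B/N)^|s| ≥ (B/N)^B, and the weights of all subsets sum to (1 +
B/N)^N ≤ e^B. -/
theorem card_smallSets_mul_le {N B : ℕ} (hB : 1 ≤ B) (hBN : B ≤ N) :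
    ((smallSets N B).card : ℝ) * ((B : ℝ) / N) ^ B ≤ Real.exp B := by
  have hN : (0 : ℝ) < N := by exact_mod_cast hB.trans hBN
  have hB0 : (0 : ℝ) < B := by exact_mod_cast hB
  have hr1 : (B : ℝ) / N ≤ 1 := (div_le_one hN).2 (by exact_mod_cast hBN)
  have hr0 : 0 < (B : ℝ) / N := by positivity
  calc ((smallSets N B).card : ℝ) * ((B : ℝ) / N) ^ B
      = ∑ _s ∈ smallSets N B, ((B : ℝ) / N) ^ B := by rw [Finset.sum_const, nsmul_eq_mul]
    _ ≤ ∑ s ∈ smallSets N B, ((B : ℝ) / N) ^ s.card :=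
        Finset.sum_le_sum fun s hs =>
          pow_le_pow_of_le_one hr0.le hr1 (Finset.mem_filter.1 hs).2
    _ ≤ ∑ s ∈ (Finset.range N).powerset, ((B : ℝ) / N) ^ s.card :=
        Finset.sum_le_sum_of_subset_of_nonneg (Finset.filter_subset _ _)
          fun _ _ _ => by positivity
    _ = ((B : ℝ) / N + 1) ^ N := by
        have := Finset.sum_pow_mul_eq_add_pow ((B : ℝ) / N) 1 (Finset.range N)
        simpa using this
    _ ≤ Real.exp ((B : ℝ) / N) ^ N := pow_le_pow_left₀ (by positivity) (Real.add_one_le_exp _) _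
    _ = Real.exp B := by
        rw [← Real.exp_nat_mul]
        congr 1
        field_simp

theorem log_card_smallSets_le {M B : ℕ} (hB : 1 ≤ B) (hM : 2 * B ≤ M) :
    Real.log (smallSets (M + B) B).card ≤ B * (1 + 2 * Real.log ((M : ℝ) / B)) := by
  have hB0 : (0 : ℝ) < B := by exact_mod_cast hB
  have hq : (0 : ℝ) < (smallSets (M + B) B).card := by exact_mod_cast card_smallSets_pos _ _
  have hN : (0 : ℝ) < ((M + B : ℕ) : ℝ) := by exact_mod_cast (by omega : 0 < M + B)
  have h := Real.log_le_log (by positivity) (card_smallSets_mul_le hB (Nat.le_add_left B M))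
  rw [Real.log_exp, Real.log_mul hq.ne' (by positivity), Real.log_pow] at h
  have hx : 2 ≤ (M : ℝ) / B := by
    rw [le_div_iff₀ hB0]
    exact_mod_cast hM
  have h1 : Real.log ((B : ℝ) / (M + B : ℕ)) = -Real.log ((M : ℝ) / B + 1) := by
    rw [← Real.log_inv]
    congr 1
    push_cast
    field_simp
  -- For x ≥ 2, x + 1 ≤ x².
  have h2 : Real.log ((M : ℝ) / B + 1) ≤ 2 * Real.log ((M : ℝ) / B) := by
    have : (2 : ℝ) * Real.log ((M : ℝ) / B) = Real.log (((M : ℝ) / B) ^ 2) := by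
      rw [Real.log_pow]
      norm_num
    rw [this]
    exact Real.log_le_log (by positivity) (by nlinarith)
  rw [h1] at h
  nlinarith

/-- The estimate for the small records that follows from `factorial_smalls_le`. -/
theorem smalls_term_le {S B M t : ℕ} (hB : 1 ≤ B) (hM : 2 * B ≤ M) (hS : 1 ≤ S) (hSt : S ≤ t * B)
    (h : S.factorial ≤ ((smallSets (M + B) B).card ^ 2) ^ t * B ^ S) :
    (S : ℝ) / B * Real.logb ((M : ℝ) / B) ((S : ℝ) / B) ≤ 9 * t := by
  have hB0 : (0 : ℝ) < B := by exact_mod_cast hB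
  have hS0 : (0 : ℝ) < S := by exact_mod_cast hS
  have hq : (0 : ℝ) < (smallSets (M + B) B).card := by exact_mod_cast card_smallSets_pos _ _
  have hx : 2 ≤ (M : ℝ) / B := by
    rw [le_div_iff₀ hB0]
    exact_mod_cast hM
  have hlog := le_log_mul hx
  have h1 := mul_log_sub_le_log_factorial S
  have h2 : Real.log S.factorial ≤
      t * (2 * Real.log (smallSets (M + B) B).card) + S * Real.log B := by
    have h' : (S.factorial : ℝ) ≤ (((smallSets (M + B) B).card : ℝ) ^ 2) ^ t * (B : ℝ) ^ S := by
      exact_mod_cast h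
    have := Real.log_le_log (by exact_mod_cast S.factorial_pos) h'
    rwa [Real.log_mul (by positivity) (by positivity), Real.log_pow, Real.log_pow, Real.log_pow,
      Nat.cast_two] at this
  have h3 := mul_le_mul_of_nonneg_left (log_card_smallSets_le hB hM)
    (by positivity : (0 : ℝ) ≤ 2 * t)
  have h4 : (S : ℝ) ≤ t * B := by exact_mod_cast hSt
  have h5 : (t : ℝ) * B * 1 ≤ t * B * (3 / 2 * Real.log ((M : ℝ) / B)) :=
    mul_le_mul_of_nonneg_left hlog (by positivity)
  -- S log(S/B) ≤ S + 2tB + 4tB log(M/B). By S ≤ tB and `hlog` this is at most (9/2 + 4) tB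
  -- log(M/B).
  have h6 : (S : ℝ) * Real.log ((S : ℝ) / B) ≤ 9 * t * Real.log ((M : ℝ) / B) * B := by
    rw [Real.log_div hS0.ne' hB0.ne']
    have : (0 : ℝ) ≤ t * B * Real.log ((M : ℝ) / B) :=
      mul_nonneg (by positivity) (by linarith)
    nlinarith
  rw [Real.logb, ← mul_div_assoc, div_mul_eq_mul_div, div_div, div_le_iff₀ (by nlinarith)]
  nlinarith

theorem list_sum_le_log_prod (ℓ : List ℕ) :
    (ℓ.map fun m : ℕ => (m : ℝ) * Real.log m).sum - ℓ.sum ≤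
      Real.log ((ℓ.map Nat.factorial).prod : ℕ) := by
  induction ℓ with
  | nil => simp
  | cons m ℓ ih =>
    have h1 : (m.factorial : ℝ) ≠ 0 := by exact_mod_cast m.factorial_ne_zero
    have h2 : (((ℓ.map Nat.factorial).prod : ℕ) : ℝ) ≠ 0 := by
      rw [Nat.cast_ne_zero, Ne, List.prod_eq_zero_iff, List.mem_map]
      rintro ⟨k, -, hk⟩
      exact k.factorial_ne_zero hk
    have := mul_log_sub_le_log_factorial m
    simp only [List.map_cons, List.sum_cons, List.prod_cons, Nat.cast_mul, Nat.cast_add]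
    rw [Real.log_mul h1 h2]
    linarith

/-- The estimate for the large records that follows from `prod_factorial_le`. -/
theorem larges_term_le {ℓ : List ℕ} {B M w t : ℕ} (hB : 1 ≤ B) (hw : 1 ≤ w) (hM : 2 * w ≤ M)
    (hLt : ℓ.sum * w ≤ t * B)
    (h : (ℓ.map Nat.factorial).prod ^ w ≤ (2 * M / w + 1) ^ (2 * (t * B))) :
    (ℓ.map fun m : ℕ => ((m * w : ℕ) : ℝ) / B *
      Real.logb ((M : ℝ) / w) (((m * w : ℕ) : ℝ) / w)).sum ≤ 8 * t := by
  have hB0 : (0 : ℝ) < B := by exact_mod_cast hB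
  have hw0 : (0 : ℝ) < w := by exact_mod_cast hw
  have hx : 2 ≤ (M : ℝ) / w := by
    rw [le_div_iff₀ hw0]
    exact_mod_cast hM
  have hlog := le_log_mul hx
  have hprod : 0 < (ℓ.map Nat.factorial).prod := by
    refine Nat.pos_of_ne_zero ?_
    rw [Ne, List.prod_eq_zero_iff, List.mem_map]
    rintro ⟨k, -, hk⟩
    exact k.factorial_ne_zero hk
  -- For x = M/w ≥ 2, 2x + 1 ≤ x³.
  have hF : Real.log ((2 * M / w + 1 : ℕ) : ℝ) ≤ 3 * Real.log ((M : ℝ) / w) := by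
    have h1 : ((2 * M / w + 1 : ℕ) : ℝ) ≤ ((M : ℝ) / w) ^ 3 := by
      have : ((2 * M / w : ℕ) : ℝ) ≤ ((2 * M : ℕ) : ℝ) / w := Nat.cast_div_le
      push_cast at this ⊢
      rw [mul_div_assoc] at this
      nlinarith [mul_nonneg (by linarith : 0 ≤ (M : ℝ) / w - 2) (by positivity : 0 ≤ (M : ℝ) / w),
        mul_nonneg (by linarith : 0 ≤ (M : ℝ) / w - 2) (by positivity : 0 ≤ ((M : ℝ) / w) ^ 2)]
    have := Real.log_le_log (by positivity) h1
    rwa [Real.log_pow] at this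
  have h1 : (w : ℝ) * Real.log ((ℓ.map Nat.factorial).prod : ℕ) ≤
      2 * (t * B) * Real.log ((2 * M / w + 1 : ℕ) : ℝ) := by
    have h' : (((ℓ.map Nat.factorial).prod : ℕ) : ℝ) ^ w ≤
        ((2 * M / w + 1 : ℕ) : ℝ) ^ (2 * (t * B)) := by exact_mod_cast h
    have := Real.log_le_log (by positivity) h'
    rw [Real.log_pow, Real.log_pow] at this
    exact_mod_cast this
  have h2 := mul_le_mul_of_nonneg_left (list_sum_le_log_prod ℓ) hw0.le
  have h3 := mul_le_mul_of_nonneg_left hF (by positivity : (0 : ℝ) ≤ 2 * (t * B))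
  have h4 : (ℓ.sum : ℝ) * w ≤ t * B := by exact_mod_cast hLt
  have h5 : (t : ℝ) * B * 1 ≤ t * B * (3 / 2 * Real.log ((M : ℝ) / w)) :=
    mul_le_mul_of_nonneg_left hlog (by positivity)
  have h6 : (ℓ.map fun m : ℕ => ((m * w : ℕ) : ℝ) / B *
      Real.logb ((M : ℝ) / w) (((m * w : ℕ) : ℝ) / w)).sum =
      w / (B * Real.log ((M : ℝ) / w)) * (ℓ.map fun m : ℕ => (m : ℝ) * Real.log m).sum := by
    rw [← List.sum_map_mul_left]
    congr 1
    refine List.map_congr_left fun m _ => ?_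
    rw [Nat.cast_mul, mul_div_assoc (m : ℝ) w w, div_self hw0.ne', mul_one, Real.logb]
    have : Real.log ((M : ℝ) / w) ≠ 0 := by linarith
    field_simp
  have hpos : 0 < B * Real.log ((M : ℝ) / w) := mul_pos hB0 (by linarith)
  rw [h6, div_mul_eq_mul_div, div_le_iff₀ hpos]
  -- The volume contributes tB ≤ 3/2 tB log(M/w) and the counting 6 tB log(M/w), in total less than
  -- `8`.
  nlinarith

/-- The merge uses the integer fan-in `f`, the bound the real ratio `x`. Since x < f + 1 ≤ f², the
bases differ by a factor of at most `2` in the logarithm, and rounding up adds one round. -/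
theorem clog_mul_log_le {f N : ℕ} {x : ℝ} (hf : 2 ≤ f) (hx : 2 ≤ x) (hfx : x < f + 1) (hN : 1 ≤ N) :
    Nat.clog f N * Real.log x ≤ 2 * Real.log N + Real.log x := by
  have hf' : (2 : ℝ) ≤ f := by exact_mod_cast hf
  have hlogf : 0 < Real.log f := Real.log_pos (by linarith)
  have hlogx : 0 < Real.log x := Real.log_pos (by linarith)
  have hlogN : 0 ≤ Real.log N := Real.log_nonneg (by exact_mod_cast hN)
  have h1 : (Nat.clog f N : ℝ) ≤ Real.log N / Real.log f + 1 := by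
    rw [← Real.natCeil_logb_natCast]
    exact (Nat.ceil_lt_add_one (div_nonneg hlogN hlogf.le)).le
  have h2 : Real.log x ≤ 2 * Real.log f := by
    have : (2 : ℝ) * Real.log f = Real.log ((f : ℝ) ^ 2) := by
      rw [Real.log_pow]
      norm_num
    rw [this]
    exact Real.log_le_log (by linarith) (by nlinarith)
  calc Nat.clog f N * Real.log x ≤ (Real.log N / Real.log f + 1) * Real.log x :=
        mul_le_mul_of_nonneg_right h1 hlogx.le
    _ = Real.log N / Real.log f * Real.log x + Real.log x := by ring
    _ ≤ Real.log N / Real.log f * (2 * Real.log f) + Real.log x := by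
        gcongr
    _ = 2 * Real.log N + Real.log x := by
        field_simp

theorem lt_div_add_one {a b : ℕ} (hb : 1 ≤ b) : (a : ℝ) / b < (a / b : ℕ) + 1 := by
  have hb0 : (0 : ℝ) < b := by exact_mod_cast hb
  rw [div_lt_iff₀ hb0]
  have := Nat.lt_div_mul_add (a := a) (b := b) hb
  have h : a < (a / b + 1) * b := by rw [Nat.add_mul, Nat.one_mul]; exact this
  exact_mod_cast h

/-- The number of block transfers of merge sort on the small records. -/
theorem merge_cost_le {S B M : ℕ} (hB : 1 ≤ B) (hM : 2 * B ≤ M) (hS : 1 ≤ S) {T : ℝ} (hT : 1 ≤ T)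
    (hST : (S : ℝ) / B ≤ T) {L : ℝ} (hL : 1 ≤ L) :
    7 * ((Nat.clog (M / B) (S / B + 1) : ℝ) + 1) * ((S / B : ℕ) + 1) + 17 * T + 35 * L ≤
      240 * ((S : ℝ) / B * Real.logb ((M : ℝ) / B) ((S : ℝ) / B) + T + L) := by
  have hB0 : (0 : ℝ) < B := by exact_mod_cast hB
  have hS0 : (0 : ℝ) < S := by exact_mod_cast hS
  have hx : 2 ≤ (M : ℝ) / B := by
    rw [le_div_iff₀ hB0]
    exact_mod_cast hM
  have hf : 2 ≤ M / B := (Nat.le_div_iff_mul_le hB).2 hM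
  have hlogx : 0 < Real.log ((M : ℝ) / B) := Real.log_pos (by linarith)
  have hs0 : 0 < (S : ℝ) / B := by positivity
  have hsle : ((S / B : ℕ) : ℝ) ≤ (S : ℝ) / B := Nat.cast_div_le
  set s : ℝ := (S : ℝ) / B with hs
  set V := s * Real.logb ((M : ℝ) / B) s with hV
  have hVlog : V * Real.log ((M : ℝ) / B) = s * Real.log s := by
    rw [hV, Real.logb]
    field_simp
  -- For s = S/B < 1 the logarithmic term is negative, but s log s ≥ s - 1 keeps it above -3/2. The
  -- constant `240` is large enough for `T` and `L`, both at least `1`, to outweigh this.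
  by_cases h : S < B
  · rw [Nat.div_eq_of_lt h, Nat.zero_add, Nat.clog_one_right]
    have h1 : -1 ≤ s * Real.log s := by
      have := mul_le_mul_of_nonneg_left (Real.one_sub_inv_le_log_of_pos hs0) hs0.le
      rw [mul_sub, mul_inv_cancel₀ hs0.ne'] at this
      linarith
    have h2 : -(3 / 2) ≤ V := by
      have := le_log_mul hx
      by_contra hc
      rw [← hVlog] at h1
      nlinarith
    simp only [Nat.cast_zero]
    linarith
  · have hs1 : 1 ≤ s := by
      rw [hs, one_le_div hB0]
      exact_mod_cast not_lt.1 h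
    have hd : 1 ≤ S / B := (Nat.le_div_iff_mul_le hB).2 (by omega)
    have h1 := clog_mul_log_le hf hx (lt_div_add_one hB) (N := S / B + 1) (by omega)
    have h2 : Real.log ((S / B + 1 : ℕ) : ℝ) ≤ Real.log s + Real.log ((M : ℝ) / B) := by
      rw [← Real.log_mul hs0.ne' (by positivity)]
      refine Real.log_le_log (by positivity) ?_
      push_cast
      nlinarith
    -- One unit of the `3 s` is for rounding up the number of rounds, the others for s + 1 ≤ s M/B
    -- under the logarithm.
    have h3 : (Nat.clog (M / B) (S / B + 1) : ℝ) * s ≤ 2 * V + 3 * s := by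
      by_contra hc
      have h4 := mul_lt_mul_of_pos_right (not_le.1 hc) hlogx
      have h5 := mul_le_mul_of_nonneg_right h1 hs0.le
      nlinarith
    have hV0 : 0 ≤ V := mul_nonneg hs0.le (Real.logb_nonneg (by linarith) hs1)
    have h4 : ((Nat.clog (M / B) (S / B + 1) : ℝ) + 1) * ((S / B : ℕ) + 1) ≤
        ((Nat.clog (M / B) (S / B + 1) : ℝ) + 1) * (2 * s) := by
      gcongr
      linarith
    nlinarith

/-- The number of block transfers of merge sort on the stripes. -/
theorem stripes_cost_le {ℓ : List ℕ} {B M w : ℕ} (hB : 1 ≤ B) (hBw : B ≤ w) (hM : 2 * w ≤ M)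
    (hℓ : ∀ m ∈ ℓ, 0 < m) :
    (((ℓ.map fun m => (w / B + 2) * (Nat.clog (M / w) m * m)).sum : ℕ) : ℝ) ≤
      6 * (ℓ.map fun m : ℕ => ((m * w : ℕ) : ℝ) / B *
        Real.logb ((M : ℝ) / w) (((m * w : ℕ) : ℝ) / w)).sum +
        3 * (((ℓ.sum * w : ℕ) : ℝ) / B) := by
  have hB0 : (0 : ℝ) < B := by exact_mod_cast hB
  have hw : 1 ≤ w := hB.trans hBw
  have hw0 : (0 : ℝ) < w := by exact_mod_cast hw
  have hwB : 1 ≤ (w : ℝ) / B := by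
    rw [one_le_div hB0]
    exact_mod_cast hBw
  have hx : 2 ≤ (M : ℝ) / w := by
    rw [le_div_iff₀ hw0]
    exact_mod_cast hM
  have hlogx : 0 < Real.log ((M : ℝ) / w) := Real.log_pos (by linarith)
  have hf : 2 ≤ M / w := (Nat.le_div_iff_mul_le hw).2 hM
  induction ℓ with
  | nil => simp
  | cons m ℓ ih =>
    have hm : 1 ≤ m := hℓ m List.mem_cons_self
    have hm0 : (0 : ℝ) < m := by exact_mod_cast hm
    have ih := ih fun k hk => hℓ k (List.mem_cons_of_mem _ hk)
    have h1 : (Nat.clog (M / w) m : ℝ) ≤ 2 * Real.logb ((M : ℝ) / w) m + 1 := by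
      have := clog_mul_log_le hf hx (lt_div_add_one hw) hm
      rw [Real.logb, ← mul_div_assoc, ← sub_le_iff_le_add, le_div_iff₀ hlogx]
      linarith
    have h2 : ((w / B : ℕ) : ℝ) ≤ (w : ℝ) / B := Nat.cast_div_le
    -- As `B ≤ w`, the two extra blocks per record at most triple w/B.
    have h3 : (((w / B : ℕ) : ℝ) + 2) * (Nat.clog (M / w) m * m) ≤
        3 * ((w : ℝ) / B) * ((2 * Real.logb ((M : ℝ) / w) m + 1) * m) := by
      gcongr
      linarith
    have h4 : ((m * w : ℕ) : ℝ) / w = m := by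
      push_cast
      field_simp
    rw [List.map_cons, List.sum_cons, List.map_cons, List.sum_cons, List.sum_cons, h4]
    push_cast at ih h3 ⊢
    have h5 : ((m : ℝ) + (ℓ.sum : ℕ)) * w / B = m * w / B + (ℓ.sum : ℕ) * w / B := by ring
    have h6 : 3 * ((w : ℝ) / B) * ((2 * Real.logb ((M : ℝ) / w) m + 1) * m) =
        6 * (m * w / B * Real.logb ((M : ℝ) / w) m) + 3 * (m * w / B) := by ring
    push_cast at h5
    linarith

/-! ### Assembling the two bounds. -/

section

variable {S n : ℕ} {p : Params}

/-- A fully sorted output is in particular a PLE output, so PLE ≤ Sort. -/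
theorem SolvesSort.solvesPLE {A : Alg S n} (hA : SolvesSort p (pleLayout S n) A) :
    SolvesPLE p A := by
  intro σ hσ _
  obtain ⟨t, a, d, hr, hs⟩ := hA σ hσ
  exact ⟨t, a, d, hr, σ, ⟨hσ, hσ.pairwise.imp fun h => .inl h⟩, hs⟩

/-- There are finitely many orders, and each has only one run. -/
theorem SolvesPLE.exists_cost {P : Alg S n} (hP : SolvesPLE p P) :
    ∃ t, ∀ ℓ, PLECostLE p P ℓ t := by
  have hfin : {σ : List (Item S n) | IsListing σ}.Finite :=
    (List.finite_length_eq (Item S n) (S + n)).subset fun σ hσ => hσ.length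
  have hex : ∀ σ : List (Item S n), ∃ t, IsListing σ → SmallSorted σ →
      ∀ t' a d, Runs p σ P (start p.w (pleLayout S n)) t' a d → t' ≤ t := by
    intro σ
    by_cases h : IsListing σ ∧ SmallSorted σ
    · obtain ⟨t, a, d, hr, -⟩ := hP σ h.1 h.2
      exact ⟨t, fun _ _ t' a' d' hr' => (hr'.unique hr).1.le⟩
    · exact ⟨0, fun h1 h2 => absurd ⟨h1, h2⟩ h⟩
  choose f hf using hex
  obtain ⟨t, ht⟩ := (hfin.image f).bddAbove
  exact ⟨t, fun ℓ σ hσ hsm _ t' a d hr =>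
    (hf σ hσ hsm t' a d hr).trans (ht ⟨σ, hσ, rfl⟩)⟩

/-- Every sequence of stripe sizes occurs with a stripe in front of all small records, so PLE pays
for scanning the small records. -/
theorem SolvesPLE.smalls_le_cost (hB : 1 ≤ p.B) (hw : 1 ≤ p.w) (hn : 1 ≤ n) {P : Alg S n}
    (hP : SolvesPLE p P) {ℓ : List ℕ} (hℓ : IsProfile S n ℓ) {t : ℕ} (ht : PLECostLE p P ℓ t) :
    S ≤ t * p.B := by
  obtain ⟨σ, hσ, hsm, hst, ⟨x, hx, hxr⟩, -⟩ := exists_order (S := S) hℓ hn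
  obtain ⟨t', a, d, hr, -⟩ := hP σ hσ hsm
  exact (hP.smalls_le hB hw hσ hsm hx hxr hr).trans
    (Nat.mul_le_mul_right _ (ht σ hσ hsm hst t' a d hr))

/-- The four summands are at most `9 t`, `t`, `8 t` and `t`. -/
theorem sortingBound_le (hB : 1 ≤ p.B) (hBw : p.B ≤ p.w) (hM : 2 * p.w ≤ p.M) (hS : 1 ≤ S)
    (hn : 1 ≤ n) {ℓ : List ℕ} (hℓ : IsProfile S n ℓ) {A : Alg S n}
    (hA : SolvesSort p (pleLayout S n) A) {t : ℕ} (ht : SortCostLE p (pleLayout S n) A ℓ t)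
    {ple : ℕ} (hple : ple ≤ t) : sortingBound S p ℓ ple ≤ 20 * t := by
  have hw : 1 ≤ p.w := hB.trans hBw
  obtain ⟨σ, hσ, -, hst, -, -⟩ := exists_order (S := S) hℓ hn
  obtain ⟨t', a, d, hr, -⟩ := hA σ hσ
  have hvol := (hA.volume_le hw (by omega) hσ hr).trans
    (Nat.mul_le_mul_right _ (ht σ hσ hst t' a d hr))
  have h1 := smalls_term_le hB (by omega) hS (by omega) (factorial_smalls_le hB hw hn hℓ hA ht)
  have hL : ℓ.sum * p.w ≤ t * p.B := by
    rw [hℓ.1]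
    omega
  have h2 := larges_term_le hB hw hM hL (prod_factorial_le hw hn (fun r hr =>
    Nat.succ_le_succ ((Nat.le_div_iff_mul_le hw).2 hr)) hℓ hA ht)
  have h3 : ((ℓ.sum * p.w : ℕ) : ℝ) / p.B ≤ t := by
    rw [div_le_iff₀ (by exact_mod_cast hB)]
    exact_mod_cast hL
  have h4 : (ple : ℝ) ≤ t := by exact_mod_cast hple
  unfold sortingBound
  linarith

/-- The sorting algorithm that is based on a given solution of PLE. -/
theorem exists_sort_of_ple (hB : 1 ≤ p.B) (hBw : p.B ≤ p.w) (hM : 2 * p.w ≤ p.M) (hS : 1 ≤ S)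
    (hn : 1 ≤ n) {P : Alg S n} (hP : SolvesPLE p P) {l : List (Item S n)} (hl : IsListing l) :
    ∃ A : Alg S n, SolvesSort p l A ∧ ∀ ℓ : List ℕ, IsProfile S n ℓ → ∀ ple : ℕ,
      PLECostLE p P ℓ ple →
        SortCostLE p l A ℓ ⌊240 * sortingBound S p ℓ ple⌋₊ ∧ 0 ≤ sortingBound S p ℓ ple := by
  have hw : 1 ≤ p.w := hB.trans hBw
  have hf : 2 ≤ p.M / p.w := (Nat.le_div_iff_mul_le hw).2 hM
  have hf' : 2 ≤ p.M / p.B := (Nat.le_div_iff_mul_le hB).2 (by omega)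
  obtain ⟨A, hA⟩ := exists_sorting_alg hB hBw (fB := p.M / p.B) (fL := p.M / p.w)
    (k := Nat.clog (p.M / p.B) (S / p.B + 1)) (by omega) (Nat.div_mul_le_self _ _)
    (Nat.div_mul_le_self _ _) (fun m => Nat.le_pow_clog hf m) (by
      refine le_trans ?_ (Nat.mul_le_mul_right _ (Nat.le_pow_clog hf' _))
      rw [Nat.add_mul, Nat.one_mul]
      exact (Nat.lt_div_mul_add hB).le) hP hl
  refine ⟨A, fun σ hσ => ?_, fun ℓ hℓ ple hple => ?_⟩
  · obtain ⟨t, a, d, hr, hs, -⟩ := hA σ hσ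
    exact ⟨t, a, d, hr, hs⟩
  have hB0 : (0 : ℝ) < p.B := by exact_mod_cast hB
  have hSp := hP.smalls_le_cost hB hw hn hℓ hple
  have hST : (S : ℝ) / p.B ≤ ple := by
    rw [div_le_iff₀ hB0]
    exact_mod_cast hSp
  have hple1 : (1 : ℝ) ≤ ple := by
    rcases Nat.eq_zero_or_pos ple with rfl | h
    · omega
    · exact_mod_cast h
  have hL : (1 : ℝ) ≤ ((ℓ.sum * p.w : ℕ) : ℝ) / p.B := by
    rw [one_le_div hB0, hℓ.1]
    exact_mod_cast hBw.trans (Nat.le_mul_of_pos_left _ hn)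
  -- `17 T` stands for PLE itself and the `16` scans of S/B; `35 L` for the additive `16`, the `16`
  -- scans of L/B, and the `3 L/B` of the stripes, using L/B ≥ 1.
  have h1 := merge_cost_le hB (by omega : 2 * p.B ≤ p.M) hS hple1 hST hL
  have h2 := stripes_cost_le hB hBw hM hℓ.2.1
  set V := (ℓ.map fun m : ℕ => ((m * p.w : ℕ) : ℝ) / p.B *
        Real.logb ((p.M : ℝ) / p.w) (((m * p.w : ℕ) : ℝ) / p.w)).sum with hV
  set cost : ℕ := ple + (16 * ((S + n * p.w) / p.B) + 16 +
    7 * (Nat.clog (p.M / p.B) (S / p.B + 1) + 1) * numBlocks p.B S) +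
      (ℓ.map fun m => (p.w / p.B + 2) * (Nat.clog (p.M / p.w) m * m)).sum with hcost
  have hV0 : 0 ≤ V := by
    refine List.sum_nonneg fun v hv => ?_
    obtain ⟨m, hm, rfl⟩ := List.mem_map.1 hv
    have hw0 : (0 : ℝ) < p.w := by exact_mod_cast hw
    refine mul_nonneg (by positivity) (Real.logb_nonneg ?_ ?_)
    · rw [lt_div_iff₀ hw0]
      exact_mod_cast (by omega : 1 * p.w < p.M)
    · rw [one_le_div hw0]
      exact_mod_cast Nat.le_mul_of_pos_left _ (hℓ.2.1 m hm)
  have hbound : (cost : ℝ) ≤ 240 * sortingBound S p ℓ ple := by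
    have h3 : (((S + n * p.w) / p.B : ℕ) : ℝ) ≤ (S : ℝ) / p.B + ((ℓ.sum * p.w : ℕ) : ℝ) / p.B := by
      rw [hℓ.1, ← add_div, ← Nat.cast_add]
      exact Nat.cast_div_le
    have h4 : (numBlocks p.B S : ℝ) ≤ (S / p.B : ℕ) + 1 := by exact_mod_cast numBlocks_le S
    have h5 : 7 * ((Nat.clog (p.M / p.B) (S / p.B + 1) : ℝ) + 1) * (numBlocks p.B S : ℝ) ≤
        7 * ((Nat.clog (p.M / p.B) (S / p.B + 1) : ℝ) + 1) * ((S / p.B : ℕ) + 1) := by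
      gcongr
    have h6 : (cost : ℝ) = ple + (16 * (((S + n * p.w) / p.B : ℕ) : ℝ) + 16 +
        7 * ((Nat.clog (p.M / p.B) (S / p.B + 1) : ℝ) + 1) * (numBlocks p.B S : ℝ)) +
        (((ℓ.map fun m => (p.w / p.B + 2) * (Nat.clog (p.M / p.w) m * m)).sum : ℕ) : ℝ) := by
      rw [hcost]
      simp only [Nat.cast_add, Nat.cast_mul, Nat.cast_ofNat, Nat.cast_one]
    unfold sortingBound
    rw [h6]
    linarith
  have hcost0 : (0 : ℝ) ≤ cost := Nat.cast_nonneg _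
  -- Nonnegativity of the bound, not evident because of its first summand, follows as it dominates
  -- an actual cost.
  refine ⟨fun σ hσ hst t' a d hr => Nat.le_floor (le_trans ?_ hbound), by linarith⟩
  obtain ⟨t, a', d', hr', -, σ', tP, aP, dP, hσ', hsm, hst', hrP, ht⟩ := hA σ hσ
  obtain rfl := (hr'.unique hr).1
  have htP := hple σ' hσ' hsm (hst'.trans hst) tP aP dP hrP
  rw [hst] at ht
  exact_mod_cast ht.trans (Nat.add_le_add_right (Nat.add_le_add_right htP _) _)

end

theorem theorem2 :
    ∃ c C : ℝ, 0 < c ∧ 0 < C ∧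
      ∀ (p : Params) (S n : ℕ), 1 ≤ p.B → p.B ≤ p.w → 2 * p.w ≤ p.M → 1 ≤ S → 1 ≤ n →
        -- the complexity, for every sequence of stripe sizes
        (∀ ℓ : List ℕ, IsProfile S n ℓ →
          ∃ sort ple : ℕ, IsSortComplexity S n p ℓ sort ∧ IsPLEComplexity S n p ℓ ple ∧
            c * sortingBound S p ℓ ple ≤ sort ∧ sort ≤ C * sortingBound S p ℓ ple) ∧
        -- the upper bound, by one algorithm for all sequences of stripe sizes
        (∀ P : Alg S n, SolvesPLE p P → ∀ l : List (Item S n), IsListing l →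
          ∃ A : Alg S n, SolvesSort p l A ∧
            ∀ ℓ : List ℕ, IsProfile S n ℓ → ∀ ple : ℕ, PLECostLE p P ℓ ple →
              ∃ t : ℕ, SortCostLE p l A ℓ t ∧ (t : ℝ) ≤ C * sortingBound S p ℓ ple) := by
  refine ⟨1 / 20, 240, by norm_num, by norm_num, fun p S n hB hBw hM hS hn =>
    ⟨fun ℓ hℓ => ?_, fun P hP l hl => ?_⟩⟩
  · have hPLE : {t | ∃ A : Alg S n, SolvesPLE p A ∧ PLECostLE p A ℓ t}.Nonempty := by
      obtain ⟨A, hA⟩ := exists_solvesSort hB hBw hM (isListing_pleLayout (S := S) (n := n))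
      obtain ⟨t, ht⟩ := hA.solvesPLE.exists_cost
      exact ⟨t, A, hA.solvesPLE, ht ℓ⟩
    have hple : IsPLEComplexity S n p ℓ (sInf {t | ∃ A : Alg S n, SolvesPLE p A ∧ PLECostLE p A ℓ t}) :=
      ⟨Nat.sInf_mem hPLE, fun _ => Nat.sInf_le⟩
    set ple := sInf {t | ∃ A : Alg S n, SolvesPLE p A ∧ PLECostLE p A ℓ t}
    obtain ⟨P, hP, hPc⟩ := hple.1
    have hup : ⌊240 * sortingBound S p ℓ ple⌋₊ ∈ {t | ∀ l : List (Item S n), IsListing l →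
        ∃ A : Alg S n, SolvesSort p l A ∧ SortCostLE p l A ℓ t} := by
      intro l hl
      obtain ⟨A, hA, h⟩ := exists_sort_of_ple hB hBw hM hS hn hP hl
      exact ⟨A, hA, (h ℓ hℓ ple hPc).1⟩
    have hsort : IsSortComplexity S n p ℓ (sInf {t | ∀ l : List (Item S n), IsListing l →
        ∃ A : Alg S n, SolvesSort p l A ∧ SortCostLE p l A ℓ t}) :=
      ⟨Nat.sInf_mem ⟨_, hup⟩, fun _ => Nat.sInf_le⟩
    refine ⟨_, ple, hsort, hple, ?_, ?_⟩
    -- An optimal sorter for the PLE layout is itself a PLE algorithm, which bounds `ple` by the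
    -- sorting complexity.
    · obtain ⟨A, hA, hAc⟩ := hsort.1 _ isListing_pleLayout
      have := sortingBound_le hB hBw hM hS hn hℓ hA hAc
        (hple.2 ⟨A, hA.solvesPLE, fun σ hσ _ hst => hAc σ hσ hst⟩)
      linarith
    · obtain ⟨A, -, h⟩ := exists_sort_of_ple hB hBw hM hS hn hP
        (isListing_pleLayout (S := S) (n := n))
      exact (Nat.cast_le.2 (hsort.2 hup)).trans
        (Nat.floor_le (mul_nonneg (by norm_num) (h ℓ hℓ ple hPc).2))
  · obtain ⟨A, hA, h⟩ := exists_sort_of_ple hB hBw hM hS hn hP hl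
    exact ⟨A, hA, fun ℓ hℓ ple hple => ⟨_, (h ℓ hℓ ple hple).1,
      Nat.floor_le (mul_nonneg (by norm_num) (h ℓ hℓ ple hple).2)⟩⟩
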